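/- **Theorem 3.1.** Let $\mathbb D=\{|z|<1\}$ and let $\Omega$ be an almost-$\mathbb D$ domain, that is, a finitely connected subdomain of $\mathbb D$ (a domain whose complement in the Riemann sphere has finitely many connected components) which contains $0$ and an annulus $\{e^{-h}<|z|<1\}$ for some $h>0$. Let $p\in\Omega$. For a real continuous function $\xi$ on an interval $I$ of the form $[0,a]$ ($a>0$) or $[0,T)$ ($0<T\le\infty$), and $t\in I$, let $L^\xi_t$ and $\psi^\xi_t$ be the radial Loewner hulls and maps driven by $\xi$: $\psi^\xi_t(z)$ is the solution of $$\partial_t\psi_t(z)=\psi_t(z)\,\frac{e^{i\xi(t)}+\psi_t(z)}{e^{i\xi(t)}-\psi_t(z)},\qquad \psi_0(z)=z,$$ and $L^\xi_t$ is the set of $z\in\mathbb D$ for which the solution blows up before or at time $t$. If $L^\xi_t\subset\Omega\setminus\{p\}$, let $\Omega^\xi_t=\psi^\xi_t(\Omega\setminus L^\xi_t)$ and let $J^\xi_t=G(\Omega^\xi_t,\psi^\xi_t(p);\cdot)$, where $G(D,w;\cdot)$ is the Green function of $D$ with pole at $w$, i.e. the least nonnegative harmonic function $g$ on $D\setminus\{w\}$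 such that $g(z)+\log|z-w|$ extends harmonically to a neighbourhood of $w$. Let $\tilde J^\xi_t(z)=J^\xi_t(e^{iz})$, extended across $\mathbb R$ by Schwarz reflection (zero on $\mathbb R$ and odd under $z\mapsto\bar z$), and $$X^\xi(t)=\frac{\partial_x\partial_y\tilde J^\xi_t(\xi(t))}{\partial_y\tilde J^\xi_t(\xi(t))}.$$ Let $f:[0,\infty)\to\mathbb R$ be continuous and $\lambda\in\mathbb R$. A solution on the interval $I$ of $$\xi(t)=f(t)+\lambda\int_0^t X^\xi(s)\,ds \qquad (*)$$ is a continuous $\xi:I\to\mathbb R$ such that, for every $t\in I$, $L^\xi_t\subset\Omega\setminus\{p\}$, the function $X^\xi$ is integrable on $[0,t]$, and $(*)$ holds. (i) There are $a>0$ and a solution $\xi$ of $(*)$ on $[0,a]$. For this solution and every $t\in[0,a]$, $X^\xi(t)$ is well defined: the Green function exists, the reflected function $\tilde J^\xi_t$ is harmonic near every point of $\mathbb R$, and $\partial_y\tilde J^\xi_t(\xi(t))\ne0$. (ii) If, for $j=1,2$, $\xi_j$ is a solution of $(*)$ on $[0,T_j)$ with $0<T_j\le\infty$, then there is $S>0$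 with $S<T_1$ and $S<T_2$ such that $\xi_1(t)=\xi_2(t)$ for $0\le t\le S$. -/

import Mathlib

namespace RadialLERW

noncomputable section

/-- A finitely connected domain in the plane: a nonempty connected open set whose complement in the
Riemann sphere `OnePoint ℂ` has finitely many connected components. (Components that are single
points are allowed.) -/
structure IsFinitelyConnectedDomain (D : Set ℂ) : Prop where
  isOpen : IsOpen D
  isConnected : IsConnected D
  finite_components :
    Finite (ConnectedComponents ↥(((fun z : ℂ => (z : OnePoint ℂ)) '' D)ᶜ))

/-- An almost-`𝔻` domain: a finitely connected subdomain of the open unit disc which contains `0`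
and some annulus `{e^{-h} < |z| < 1}`, `h > 0`. -/
structure IsAlmostDiscDomain (Ω : Set ℂ) : Prop where
  finitelyConnected : IsFinitelyConnectedDomain Ω
  subset_disc : Ω ⊆ Metric.ball 0 1
  zero_mem : (0 : ℂ) ∈ Ω
  annulus : ∃ h : ℝ, 0 < h ∧ {z : ℂ | Real.exp (-h) < ‖z‖ ∧ ‖z‖ < 1} ⊆ Ω

/-! ### The radial Loewner equation -/

/-- The map `x ↦ e^{ix}` from the real line to the unit circle. -/
def circlePoint (x : ℝ) : ℂ := Complex.exp (Complex.I * x)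

/-- `u` solves the radial Loewner equation driven by `ξ` on the closed interval `[0, t]`, with
initial value `z`; in particular the denominator does not vanish on `[0, t]`. -/
def IsRadialTrajectory (ξ : ℝ → ℝ) (t : ℝ) (z : ℂ) (u : ℝ → ℂ) : Prop :=
  u 0 = z ∧ ∀ s ∈ Set.Icc 0 t, u s ≠ circlePoint (ξ s) ∧
    HasDerivWithinAt u
      (u s * ((circlePoint (ξ s) + u s) / (circlePoint (ξ s) - u s))) (Set.Icc 0 t) s

/-- The radial Loewner hull `L_t`: the points of the unit disc whose trajectory blows up before or
at time `t`, i.e. for which there is no solution on the closed interval `[0, t]`. -/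
def radialHull (ξ : ℝ → ℝ) (t : ℝ) : Set ℂ :=
  {z | z ∈ Metric.ball (0 : ℂ) 1 ∧ ¬ ∃ u : ℝ → ℂ, IsRadialTrajectory ξ t z u}

open Classical in
/-- The radial Loewner map `ψ_t`, with value `0` at points where the solution does not exist. -/
def radialMap (ξ : ℝ → ℝ) (t : ℝ) (z : ℂ) : ℂ :=
  if h : ∃ u : ℝ → ℂ, IsRadialTrajectory ξ t z u then h.choose t else 0

/-- The domain `Ω_t = ψ_t(Ω \ L_t)`. -/
def imageDomain (Ω : Set ℂ) (ξ : ℝ → ℝ) (t : ℝ) : Set ℂ :=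
  radialMap ξ t '' (Ω \ radialHull ξ t)

/-! ### The Green function -/

/-- `g` is a nonnegative harmonic function on `D \ {p}` with a logarithmic pole at `p`, that is,
`g(z) + log |z - p|` extends harmonically to a neighbourhood of `p`. (On a domain `D` such a `g`
is positive, by the minimum principle.) -/
structure HasLogPole (D : Set ℂ) (p : ℂ) (g : ℂ → ℝ) : Prop where
  harmonic : InnerProductSpace.HarmonicOnNhd g (D \ {p})
  nonneg : ∀ z ∈ D \ {p}, 0 ≤ g z
  pole : ∃ h : ℂ → ℝ, InnerProductSpace.HarmonicAt h p ∧
    ∀ᶠ z in nhdsWithin p {p}ᶜ, g z + Real.log ‖z - p‖ = h z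

/-- `g` is the Green function of `D` with pole at `p`: the least nonnegative harmonic function on
`D \ {p}` with a logarithmic pole at `p`. This determines `g` on `D \ {p}`. -/
def IsGreenFunction (D : Set ℂ) (p : ℂ) (g : ℂ → ℝ) : Prop :=
  HasLogPole D p g ∧ ∀ g' : ℂ → ℝ, HasLogPole D p g' → ∀ z ∈ D \ {p}, g z ≤ g' z

open Classical in
/-- The Green function `G(D, p; ·)`; the zero function if there is none. Only its values on
`D \ {p}` are meaningful. -/
def greenFunction (D : Set ℂ) (p : ℂ) : ℂ → ℝ :=
  if h : ∃ g : ℂ → ℝ, IsGreenFunction D p g then h.choose else 0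

/-! ### The functional `X^ξ` and the integral equation -/

/-- The function `J_t = G(Ω_t, ψ_t(p); ·)`. -/
def J (Ω : Set ℂ) (p : ℂ) (ξ : ℝ → ℝ) (t : ℝ) : ℂ → ℝ :=
  greenFunction (imageDomain Ω ξ t) (radialMap ξ t p)

/-- The function `J_t ∘ (z ↦ e^{iz})`, which lives on a subset of the upper half plane, extended
across the real line by Schwarz reflection: zero on the real line, odd under conjugation. -/
def tildeJ (Ω : Set ℂ) (p : ℂ) (ξ : ℝ → ℝ) (t : ℝ) (z : ℂ) : ℝ :=
  if 0 < z.im then J Ω p ξ t (Complex.exp (Complex.I * z))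
  else if z.im = 0 then 0
  else - J Ω p ξ t (Complex.exp (Complex.I * (starRingEnd ℂ) z))

/-- The normal derivative `∂_y` of a function on the plane at the real point `x`. -/
def normalDeriv (u : ℂ → ℝ) (x : ℝ) : ℝ :=
  deriv (fun y : ℝ => u ((x : ℂ) + y * Complex.I)) 0

/-- `X^ξ(t) = (∂_x ∂_y J̃_t / ∂_y J̃_t)(ξ(t))`. -/
def X (Ω : Set ℂ) (p : ℂ) (ξ : ℝ → ℝ) (t : ℝ) : ℝ :=
  deriv (normalDeriv (tildeJ Ω p ξ t)) (ξ t) / normalDeriv (tildeJ Ω p ξ t) (ξ t)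

/-- `X^ξ(t)` is meaningful, that is, no default value enters in its definition: the Green function
exists, its lift extends harmonically across the real line, and the quotient has a nonzero
denominator. -/
structure XIsDefined (Ω : Set ℂ) (p : ℂ) (ξ : ℝ → ℝ) (t : ℝ) : Prop where
  green : IsGreenFunction (imageDomain Ω ξ t) (radialMap ξ t p) (J Ω p ξ t)
  harmonic : ∀ x : ℝ, InnerProductSpace.HarmonicAt (tildeJ Ω p ξ t) (x : ℂ)
  denom_ne_zero : normalDeriv (tildeJ Ω p ξ t) (ξ t) ≠ 0

/-- `ξ` solves `ξ(t) = f(t) + lam ∫_0^t X^ξ(s) ds` on the interval `S` (which starts at `0`): it is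
continuous there, the hulls stay inside `Ω \ {p}` so that `X^ξ` makes sense, the integral exists,
and the equation holds. -/
structure IsSolutionOn (Ω : Set ℂ) (p : ℂ) (f : ℝ → ℝ) (lam : ℝ) (ξ : ℝ → ℝ) (S : Set ℝ) :
    Prop where
  continuousOn : ContinuousOn ξ S
  hull_subset : ∀ t ∈ S, radialHull ξ t ⊆ Ω \ {p}
  integrable : ∀ t ∈ S, IntervalIntegrable (X Ω p ξ) MeasureTheory.volume 0 t
  equation : ∀ t ∈ S, ξ t = f t + lam * ∫ s in (0 : ℝ)..t, X Ω p ξ s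

end

end RadialLERW

/-! For short times `X` is a bounded Lipschitz functional of the driving function in the sup norm
(`XIsLocallyLipschitz`). Granted this, existence is Banach's fixed point theorem for `ξ ↦ f + lam *
∫ X` on a closed ball of `C(Icc 0 a, ℝ)`. For uniqueness, the maximum `M` of `|ξ₁ - ξ₂|` on a short
interval satisfies `M ≤ M / 2`.

The Lipschitz bound combines three estimates. First, the flow. Trajectories started in the disc of
radius `1 - d` stay away from the unit circle up to time `d ^ 2 / 8`, so by Gronwall the Loewner map
there is Lipschitz in time and in the driving function. That disc contains `p` and every hole of
`Ω`, and the image domain is the unit disc minus the images of the holes.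

Second, the Green functions (`exists_green_lipschitz`). Let `φ₁`, `φ₂` be maps at distance at most
`δ`, and let `m` be the maximum of `|g₁ - g₂|` on a circle in the collar. Both functions vanish on
the unit circle, so comparison with a multiple of `log ‖w‖` bounds the difference by `q * m`, `q <
1`, nearer to that circle. Inside, the poles of `g₁ ∘ φ₁` and `g₂ ∘ φ₂` cancel and a maximum
principle carries the bound back, with an error of order `δ` for replacing one map by the other.
Hence `m ≤ q * m + O(δ)`. The holes may have irregular boundary, so no boundary values are available
there. The maximum principle comes from minimality instead: with `χ = φ₂ ∘ φ₁⁻¹`, the function `min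
g₁ (g₂ ∘ χ + M)` glued to `g₁` is a competitor for `g₁`. It is only supermean, so the Green function
is built by successive Poisson modifications, which make it least among supermean competitors
(`exists_least_logPole`).

Third, the derivatives. The lift by `z ↦ e^{iz}` and odd reflection is harmonic in a strip about the
real line, and Cauchy estimates for Herglotz integrals turn sup bounds into bounds for `∂_y` and
`∂_x ∂_y`. Hopf's lemma makes the denominator positive for the unperturbed domain, and a small
perturbation keeps at least half of it. -/

namespace RadialLERW

open Metric Set Filter Topology InnerProductSpace Real

/-! ### Harmonic and submean functions -/

/-- Near `g z` the function is the real part of a holomorphic `F`, and `F ∘ g` is holomorphic. -/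
theorem HarmonicAt.comp_analyticAt {u : ℂ → ℝ} {g : ℂ → ℂ} {z : ℂ} (hu : HarmonicAt u (g z))
    (hg : AnalyticAt ℂ g z) : HarmonicAt (fun w => u (g w)) z := by
  obtain ⟨ε, hε, hb⟩ := Metric.isOpen_iff.1 (isOpen_setOfPred_harmonicAt (f := u)) (g z) hu
  obtain ⟨F, hF, hFu⟩ := InnerProductSpace.HarmonicOnNhd.exists_analyticOnNhd_ball_re_eq
    (f := u) (fun y hy => hb hy)
  have h1 : HarmonicAt (fun w => (F (g w)).re) z :=
    ((hF (g z) (mem_ball_self hε)).comp hg).harmonicAt_re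
  refine (harmonicAt_congr_nhds ?_).1 h1
  filter_upwards [hg.continuousAt.preimage_mem_nhds (ball_mem_nhds _ hε)] with w hw
  exact hFu hw

/-- `u` is continuous near `x` and satisfies the sub-mean value inequality on small circles
about `x`. -/
def SubmeanAt (u : ℂ → ℝ) (x : ℂ) : Prop :=
  (∀ᶠ y in 𝓝 x, ContinuousAt u y) ∧ ∀ᶠ r in 𝓝[>] (0 : ℝ), u x ≤ circleAverage u x r

theorem eventually_closedBall {x : ℂ} {p : ℂ → Prop} (h : ∀ᶠ y in 𝓝 x, p y) :
    ∀ᶠ r in 𝓝[>] (0 : ℝ), ∀ y ∈ closedBall x r, p y := by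
  obtain ⟨ε, hε, hb⟩ := Metric.eventually_nhds_iff_ball.1 h
  filter_upwards [Ioo_mem_nhdsGT hε] with r hr y hy
  exact hb y (closedBall_subset_ball hr.2 hy)

theorem eventually_sphere {x : ℂ} {p : ℂ → Prop} (h : ∀ᶠ y in 𝓝[≠] x, p y) :
    ∀ᶠ r in 𝓝[>] (0 : ℝ), ∀ y ∈ sphere x |r|, p y := by
  filter_upwards [eventually_closedBall (eventually_nhdsWithin_iff.1 h), self_mem_nhdsWithin]
    with r hr hr0 y hy
  rw [abs_of_pos hr0] at hy
  refine hr y (sphere_subset_closedBall hy) ?_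
  rintro rfl
  simp at hy
  exact (hr0.ne hy).elim

theorem SubmeanAt.circleIntegrable {u : ℂ → ℝ} {x : ℂ} (h : ∀ᶠ y in 𝓝 x, ContinuousAt u y) :
    ∀ᶠ r in 𝓝[>] (0 : ℝ), CircleIntegrable u x r := by
  filter_upwards [eventually_closedBall h, self_mem_nhdsWithin] with r hr hr0
  refine ContinuousOn.circleIntegrable hr0.le ?_
  exact fun y hy => (hr y (sphere_subset_closedBall hy)).continuousWithinAt

theorem SubmeanAt.congr {u v : ℂ → ℝ} {x : ℂ} (h : SubmeanAt u x) (huv : u =ᶠ[𝓝 x] v) :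
    SubmeanAt v x := by
  refine ⟨?_, ?_⟩
  · filter_upwards [h.1, huv.eventually_nhds] with y hy hy'
    exact hy.congr hy'
  · filter_upwards [h.2, eventually_sphere (huv.filter_mono nhdsWithin_le_nhds)] with r hr hr'
    rw [← huv.self_of_nhds, ← circleAverage_congr_sphere (f₁ := u) (f₂ := v) hr']
    exact hr

theorem HarmonicAt.eventually_circleAverage {u : ℂ → ℝ} {x : ℂ} (h : HarmonicAt u x) :
    ∀ᶠ r in 𝓝[>] (0 : ℝ), circleAverage u x r = u x := by
  filter_upwards [eventually_closedBall h.eventually, self_mem_nhdsWithin] with r hr hr0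
  refine InnerProductSpace.HarmonicOnNhd.circleAverage_eq ?_
  rw [abs_of_pos hr0]
  exact hr

theorem HarmonicAt.continuousAt {u : ℂ → ℝ} {x : ℂ} (h : HarmonicAt u x) : ContinuousAt u x :=
  h.1.continuousAt

theorem HarmonicAt.submeanAt {u : ℂ → ℝ} {x : ℂ} (h : HarmonicAt u x) : SubmeanAt u x :=
  ⟨h.eventually.mono fun _ hy => HarmonicAt.continuousAt hy,
    (HarmonicAt.eventually_circleAverage h).mono fun _ hr => hr.ge⟩

theorem SubmeanAt.add {u v : ℂ → ℝ} {x : ℂ} (hu : SubmeanAt u x) (hv : SubmeanAt v x) :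
    SubmeanAt (fun z => u z + v z) x := by
  refine ⟨?_, ?_⟩
  · filter_upwards [hu.1, hv.1] with y h1 h2 using h1.add h2
  · filter_upwards [hu.2, hv.2, SubmeanAt.circleIntegrable hu.1, SubmeanAt.circleIntegrable hv.1]
      with r h1 h2 h3 h4
    rw [circleAverage_fun_add h3 h4]
    exact add_le_add h1 h2

theorem SubmeanAt.sup {u v : ℂ → ℝ} {x : ℂ} (hu : SubmeanAt u x) (hv : SubmeanAt v x) :
    SubmeanAt (fun z => max (u z) (v z)) x := by
  have hc : ∀ᶠ y in 𝓝 x, ContinuousAt (fun z => max (u z) (v z)) y := by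
    filter_upwards [hu.1, hv.1] with y h1 h2 using h1.max h2
  refine ⟨hc, ?_⟩
  filter_upwards [hu.2, hv.2, SubmeanAt.circleIntegrable hu.1, SubmeanAt.circleIntegrable hv.1,
    SubmeanAt.circleIntegrable hc] with r h1 h2 h3 h4 h5
  refine max_le (h1.trans ?_) (h2.trans ?_)
  · exact circleAverage_mono h3 h5 fun z _ => le_max_left _ _
  · exact circleAverage_mono h4 h5 fun z _ => le_max_right _ _

/-- By continuity the strict inequality at angle `0` persists on a set of positive measure, so a
single point suffices. -/
theorem circleAverage_lt {u : ℂ → ℝ} {a : ℂ} {r m : ℝ} (hr : 0 < r)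
    (hc : ContinuousOn u (sphere a r)) (hle : ∀ z ∈ sphere a r, u z ≤ m) (hlt : u (a + r) < m) :
    circleAverage u a r < m := by
  have h2pi : (0 : ℝ) < 2 * π := by positivity
  have hmap : ∀ θ, circleMap a r θ ∈ sphere a r := fun θ => circleMap_mem_sphere a hr.le θ
  have h := intervalIntegral.integral_lt_integral_of_continuousOn_of_le_of_exists_lt
    (f := fun θ => u (circleMap a r θ)) (g := fun _ => m) h2pi
    (hc.comp (continuous_circleMap a r).continuousOn fun θ _ => hmap θ) continuousOn_const
    (fun θ _ => hle _ (hmap θ)) ⟨0, ⟨le_rfl, h2pi.le⟩, by simpa [circleMap] using hlt⟩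
  rw [circleAverage_def, smul_eq_mul, inv_mul_lt_iff₀ h2pi]
  simpa using h

/-- The maximum principle. -/
theorem le_of_submeanAt {U : Set ℂ} {u : ℂ → ℝ} {M : ℝ} (hU : IsOpen U)
    (hUb : Bornology.IsBounded U) (hc : ContinuousOn u (closure U))
    (hs : ∀ x ∈ U, SubmeanAt u x) (hb : ∀ x ∈ frontier U, u x ≤ M) :
    ∀ x ∈ closure U, u x ≤ M := by
  by_contra! hcon
  obtain ⟨x, hx, hxM⟩ := hcon
  have hK : IsCompact (closure U) := hUb.isCompact_closure
  obtain ⟨x0, hx0, hmax⟩ := hK.exists_isMaxOn ⟨x, hx⟩ hc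
  have hm : M < u x0 := hxM.trans_le (hmax hx)
  set A := closure U ∩ u ⁻¹' {u x0} with hA
  have hAc : IsCompact A :=
    hK.of_isClosed_subset (hc.preimage_isClosed_of_isClosed isClosed_closure isClosed_singleton)
      inter_subset_left
  -- Among the points where the maximum is attained, take one of largest real part. The point `a +
  -- r` of a small circle about it then lies outside that set, so the mean over the circle is
  -- strictly below the maximum.
  obtain ⟨a, haA, ha⟩ := hAc.exists_isMaxOn ⟨x0, hx0, rfl⟩ Complex.continuous_re.continuousOn
  have hau : u a = u x0 := haA.2
  have haU : a ∈ U := by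
    by_contra h
    have : a ∈ frontier U := by rw [hU.frontier_eq]; exact ⟨haA.1, h⟩
    linarith [hb a this]
  obtain ⟨r, ⟨h1, h2⟩, h3⟩ := (((hs a haU).2.and
    (eventually_closedBall (hU.mem_nhds haU))).and self_mem_nhdsWithin).exists
  have hr : (0 : ℝ) < r := h3
  have hsub : sphere a r ⊆ closure U := fun z hz => subset_closure (h2 z (sphere_subset_closedBall hz))
  have har : a + r ∈ sphere a r := by simp [abs_of_pos hr]
  have := circleAverage_lt (m := u x0) hr (hc.mono hsub) (fun z hz => hmax (hsub hz)) (by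
    refine lt_of_le_of_ne (hmax (hsub har)) fun h => ?_
    have := ha ⟨hsub har, h⟩
    simp at this
    linarith)
  linarith

/-! ### The Dirichlet problem in a disc -/

/-- The Poisson integral of `u` over the circle `sphere c R`. -/
noncomputable def poissonIntegral (u : ℂ → ℝ) (c : ℂ) (R : ℝ) (w : ℂ) : ℝ :=
  circleAverage (poissonKernel c w • u) c R

/-- The Herglotz integral of `u` over the circle `sphere c R`, whose real part is the Poisson
integral. -/
noncomputable def herglotzIntegral (u : ℂ → ℝ) (c : ℂ) (R : ℝ) (w : ℂ) : ℂ :=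
  circleAverage (fun ζ => herglotzRieszKernel 0 (w - c) ζ • ((u (ζ + c) : ℝ) : ℂ)) 0 R

theorem circleIntegrable_add_const {E : Type*} [NormedAddCommGroup E] {u : ℂ → E} {c : ℂ} {R : ℝ}
    (hu : CircleIntegrable u c R) : CircleIntegrable (fun ζ => u (ζ + c)) 0 R := by
  unfold CircleIntegrable at hu ⊢
  convert hu using 3
  simp [circleMap, add_comm]

theorem circleIntegrable_ofReal {u : ℂ → ℝ} {c : ℂ} {R : ℝ}
    (hu : CircleIntegrable u c R) : CircleIntegrable (fun ζ => ((u ζ : ℝ) : ℂ)) c R := by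
  simp only [CircleIntegrable, intervalIntegrable_iff] at hu ⊢
  exact Complex.ofRealCLM.integrable_comp hu

theorem re_herglotzIntegral {u : ℂ → ℝ} {c w : ℂ} {R : ℝ} (hu : CircleIntegrable u c R)
    (hw : w ∈ ball c R) : (herglotzIntegral u c R w).re = poissonIntegral u c R w := by
  have hw' : w - c ∈ ball 0 R := by simpa [dist_eq_norm] using hw
  rw [herglotzIntegral, re_circleAverage_herglotzRieszKernel_smul
    (g := fun ζ => u (ζ + c)) (circleIntegrable_add_const hu) hw', poissonIntegral,
    ← circleAverage_map_add_const (c := c)]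
  congr 1
  ext z
  simp [poissonKernel_eq_re_herglotzRieszKernel, herglotzRieszKernel_add_const]

theorem analyticOnNhd_herglotzIntegral {u : ℂ → ℝ} {c : ℂ} {R : ℝ} (hu : CircleIntegrable u c R) :
    AnalyticOnNhd ℂ (herglotzIntegral u c R) (ball c R) := by
  intro w hw
  have hw' : w - c ∈ ball 0 R := by simpa [dist_eq_norm] using hw
  have := analyticOnNhd_circleAverage_herglotzRieszKernel_smul
    (circleIntegrable_ofReal (circleIntegrable_add_const hu)) (w - c) hw'
  exact this.comp (f := fun w => w - c) (by fun_prop)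

theorem harmonicOnNhd_poissonIntegral {u : ℂ → ℝ} {c : ℂ} {R : ℝ} (hu : CircleIntegrable u c R) :
    HarmonicOnNhd (poissonIntegral u c R) (ball c R) := by
  intro w hw
  refine (harmonicAt_congr_nhds ?_).1 (analyticOnNhd_herglotzIntegral hu w hw).harmonicAt_re
  filter_upwards [isOpen_ball.mem_nhds hw] with z hz
  exact re_herglotzIntegral hu hz

theorem continuousOn_poissonKernel_sphere {c w : ℂ} {R : ℝ} (hw : w ∈ ball c R) :
    ContinuousOn (poissonKernel c w) (sphere c R) := by
  unfold poissonKernel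
  refine ContinuousOn.div (by fun_prop) (by fun_prop) fun z hz => ?_
  have h1 : ‖z - c‖ = R := by simpa [dist_eq_norm] using hz
  have h2 : ‖w - c‖ < R := by simpa [dist_eq_norm] using hw
  have : z - c - (w - c) ≠ 0 := by
    intro h
    rw [sub_eq_zero.1 h] at h1
    linarith
  positivity

theorem circleIntegrable_poissonKernel_smul {u : ℂ → ℝ} {c w : ℂ} {R : ℝ}
    (hu : CircleIntegrable u c R) (hw : w ∈ ball c R) :
    CircleIntegrable (poissonKernel c w • u) c R := by
  have hR : |R| = R := abs_of_pos (pos_of_mem_ball hw)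
  exact hu.continuousOn_smul (hR.symm ▸ continuousOn_poissonKernel_sphere hw)

theorem poissonKernel_nonneg {c w z : ℂ} {R : ℝ} (hw : w ∈ ball c R) (hz : z ∈ sphere c R) :
    0 ≤ poissonKernel c w z := by
  have h1 : ‖z - c‖ = R := by simpa [dist_eq_norm] using hz
  have h2 : ‖w - c‖ < R := by simpa [dist_eq_norm] using hw
  unfold poissonKernel
  refine div_nonneg ?_ (by positivity)
  rw [h1]
  nlinarith [norm_nonneg (w - c)]

theorem poissonIntegral_const {c w : ℂ} {R : ℝ} (hw : w ∈ ball c R) (a : ℝ) :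
    poissonIntegral (fun _ => a) c R w = a :=
  HarmonicOnNhd.circleAverage_poissonKernel_smul (harmonicOnNhd_const a) hw

theorem poissonIntegral_neg (u : ℂ → ℝ) (c w : ℂ) (R : ℝ) :
    poissonIntegral (fun z => -u z) c R w = -poissonIntegral u c R w := by
  have : poissonKernel c w • (fun z => -u z) = (-1 : ℝ) • (poissonKernel c w • u) := by
    ext z; simp
  rw [poissonIntegral, this, circleAverage_smul, poissonIntegral]
  simp

/-- The kernel is nonnegative with mean one. Points near `ζ` contribute at most `u ζ + ε / 2`, and
at points away from `ζ` the kernel is at most `4 / δ ^ 2 * (R ^ 2 - ‖w - c‖ ^ 2)`, which tends to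
zero. The lower bound is the same statement for `-u`. -/
theorem eventually_poissonIntegral_le {u : ℂ → ℝ} {c ζ : ℂ} {R ε : ℝ} (hR : 0 < R)
    (hu : ContinuousOn u (sphere c R)) (hζ : ζ ∈ sphere c R) (hε : 0 < ε) :
    ∀ᶠ w in 𝓝[ball c R] ζ, poissonIntegral u c R w ≤ u ζ + ε := by
  obtain ⟨B, hB⟩ := (isCompact_sphere c R).exists_bound_of_continuousOn hu
  have hBζ := hB ζ hζ
  have hB0 : 0 ≤ B := (norm_nonneg _).trans hBζ
  obtain ⟨δ, hδ, hδu⟩ := Metric.continuousOn_iff.1 hu ζ hζ (ε / 2) (half_pos hε)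
  have hζn : ‖ζ - c‖ = R := by simpa [dist_eq_norm] using hζ
  have hlim : Tendsto (fun w => (2 * B * (4 / δ ^ 2)) * (R ^ 2 - ‖w - c‖ ^ 2)) (𝓝[ball c R] ζ)
      (𝓝 0) := by
    have : Continuous fun w : ℂ => (2 * B * (4 / δ ^ 2)) * (R ^ 2 - ‖w - c‖ ^ 2) := by fun_prop
    have h := this.continuousWithinAt (s := ball c R) (x := ζ)
    rw [ContinuousWithinAt, hζn] at h
    simpa using h
  filter_upwards [hlim.eventually (gt_mem_nhds (half_pos hε)), self_mem_nhdsWithin,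
    nhdsWithin_le_nhds (ball_mem_nhds ζ (half_pos hδ))] with w hw1 hw2 hw3
  have hwn : ‖w - c‖ < R := by simpa [dist_eq_norm] using hw2
  have hs : 0 ≤ R ^ 2 - ‖w - c‖ ^ 2 := by nlinarith [norm_nonneg (w - c)]
  -- `2 * B` bounds the oscillation of `u`; the remaining factor bounds the kernel at distance at
  -- least `δ` from `ζ`, where `‖z - w‖ ≥ δ / 2`.
  set k := (2 * B * (4 / δ ^ 2)) * (R ^ 2 - ‖w - c‖ ^ 2) with hk
  have hui : CircleIntegrable u c R := hu.circleIntegrable hR.le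
  have hconst : CircleIntegrable (fun _ : ℂ => u ζ + ε / 2) c R := circleIntegrable_const _ _ _
  have hki : CircleIntegrable (fun _ : ℂ => k) c R := circleIntegrable_const _ _ _
  have hpt : ∀ z ∈ sphere c |R|, (poissonKernel c w • u) z ≤
      ((poissonKernel c w • (fun _ : ℂ => u ζ + ε / 2) : ℂ → ℝ) + (fun _ => k) : ℂ → ℝ) z := by
    intro z hz
    rw [abs_of_pos hR] at hz
    have hp := poissonKernel_nonneg hw2 hz
    change poissonKernel c w z * u z ≤ poissonKernel c w z * (u ζ + ε / 2) + k
    by_cases hzd : dist z ζ < δ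
    · have h1 := hδu z hz hzd
      rw [Real.dist_eq] at h1
      have h2 : u z ≤ u ζ + ε / 2 := by linarith [(abs_lt.1 h1).2]
      have : 0 ≤ k := by positivity
      nlinarith
    · have hzw : δ / 2 ≤ ‖z - w‖ := by
        have := dist_triangle z w ζ
        rw [dist_eq_norm z w] at this
        rw [mem_ball] at hw3
        linarith
      have hzn : ‖z - c‖ = R := by simpa [dist_eq_norm] using hz
      have hple : poissonKernel c w z ≤ (4 / δ ^ 2) * (R ^ 2 - ‖w - c‖ ^ 2) := by
        rw [poissonKernel, hzn, sub_sub_sub_cancel_right, div_le_iff₀ (by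
          have : 0 < ‖z - w‖ := by linarith
          positivity)]
        have h4 : 1 ≤ 4 / δ ^ 2 * ‖z - w‖ ^ 2 := by
          rw [div_mul_eq_mul_div, le_div_iff₀ (by positivity)]
          nlinarith
        nlinarith
      have h5 : u z - u ζ ≤ 2 * B := by
        have h6 := abs_le.1 (hB z hz)
        have h7 := abs_le.1 hBζ
        linarith
      have h8 : poissonKernel c w z * (u z - u ζ) ≤ poissonKernel c w z * (2 * B) :=
        mul_le_mul_of_nonneg_left h5 hp
      have h9 : poissonKernel c w z * (2 * B) ≤ k := by
        rw [hk]
        nlinarith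
      nlinarith
  have h := circleAverage_mono (circleIntegrable_poissonKernel_smul hui hw2)
    ((circleIntegrable_poissonKernel_smul hconst hw2).add hki) hpt
  rw [circleAverage_add (circleIntegrable_poissonKernel_smul hconst hw2) hki,
    circleAverage_const] at h
  have h' := poissonIntegral_const hw2 (u ζ + ε / 2)
  rw [poissonIntegral] at h' ⊢
  linarith

theorem tendsto_poissonIntegral {u : ℂ → ℝ} {c ζ : ℂ} {R : ℝ} (hR : 0 < R)
    (hu : ContinuousOn u (sphere c R)) (hζ : ζ ∈ sphere c R) :
    Tendsto (poissonIntegral u c R) (𝓝[ball c R] ζ) (𝓝 (u ζ)) := by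
  rw [Metric.tendsto_nhds]
  intro ε hε
  filter_upwards [eventually_poissonIntegral_le hR hu hζ (half_pos hε),
    eventually_poissonIntegral_le hR hu.neg hζ (half_pos hε)] with w h1 h2
  rw [show (-u : ℂ → ℝ) = fun z => -u z from rfl] at h2
  rw [poissonIntegral_neg] at h2
  rw [Real.dist_eq, abs_lt]
  constructor <;> linarith

/-- The function `u` with its values in `ball c R` replaced by the Poisson integral. -/
noncomputable def sweep (u : ℂ → ℝ) (c : ℂ) (R : ℝ) (w : ℂ) : ℝ :=
  open Classical in if w ∈ ball c R then poissonIntegral u c R w else u w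

theorem sweep_of_mem {u : ℂ → ℝ} {c w : ℂ} {R : ℝ} (hw : w ∈ ball c R) :
    sweep u c R w = poissonIntegral u c R w := if_pos hw

theorem sweep_of_notMem {u : ℂ → ℝ} {c w : ℂ} {R : ℝ} (hw : w ∉ ball c R) :
    sweep u c R w = u w := if_neg hw

theorem sweep_eventuallyEq_of_mem {u : ℂ → ℝ} {c w : ℂ} {R : ℝ} (hw : w ∈ ball c R) :
    sweep u c R =ᶠ[𝓝 w] poissonIntegral u c R := by
  filter_upwards [isOpen_ball.mem_nhds hw] with z hz using sweep_of_mem hz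

theorem harmonicAt_sweep {u : ℂ → ℝ} {c w : ℂ} {R : ℝ} (hR : 0 < R)
    (hu : ContinuousOn u (sphere c R)) (hw : w ∈ ball c R) : HarmonicAt (sweep u c R) w :=
  (harmonicAt_congr_nhds (sweep_eventuallyEq_of_mem hw)).2
    (harmonicOnNhd_poissonIntegral (hu.circleIntegrable hR.le) w hw)

/-- On the boundary circle the limit from inside is the boundary value of the Poisson integral,
which is the value of the unmodified function outside. -/
theorem continuousOn_sweep {u : ℂ → ℝ} {c : ℂ} {R : ℝ} (hR : 0 < R) {D : Set ℂ}
    (hD : closedBall c R ⊆ D) (hu : ContinuousOn u D) : ContinuousOn (sweep u c R) D := by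
  have hus := hu.mono (sphere_subset_closedBall.trans hD)
  intro x hx
  by_cases h1 : x ∈ ball c R
  · exact (HarmonicAt.continuousAt (harmonicAt_sweep hR hus h1)).continuousWithinAt
  have h2 : Tendsto (sweep u c R) (𝓝[D ∩ (ball c R)ᶜ] x) (𝓝 (u x)) := by
    refine Tendsto.congr' ?_ ((hu x hx).mono inter_subset_left)
    filter_upwards [self_mem_nhdsWithin] with z hz using (sweep_of_notMem hz.2).symm
  have h3 : Tendsto (sweep u c R) (𝓝[D ∩ ball c R] x) (𝓝 (u x)) := by
    by_cases h4 : x ∈ closedBall c R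
    · have h5 : x ∈ sphere c R := by
        rw [mem_closedBall] at h4
        rw [mem_ball, not_lt] at h1
        exact le_antisymm h4 h1
      refine Tendsto.congr' ?_ ((tendsto_poissonIntegral hR hus h5).mono_left
        (nhdsWithin_mono _ inter_subset_right))
      filter_upwards [self_mem_nhdsWithin] with z hz using (sweep_of_mem hz.2).symm
    · have : 𝓝[D ∩ ball c R] x = ⊥ := by
        rw [← notMem_closure_iff_nhdsWithin_eq_bot]
        exact fun h => h4 (closure_ball_subset_closedBall (closure_mono inter_subset_right h))
      rw [this]
      exact tendsto_bot
  rw [ContinuousWithinAt, sweep_of_notMem h1, ← inter_union_compl D (ball c R), nhdsWithin_union]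
  exact h3.sup h2

/-- A continuous submean function in a closed disc is dominated by the Poisson integral. -/
theorem le_sweep {u v : ℂ → ℝ} {c : ℂ} {R : ℝ} (hR : 0 < R)
    (hu : ContinuousOn u (closedBall c R)) (hv : ContinuousOn v (closedBall c R))
    (hs : ∀ x ∈ ball c R, SubmeanAt u x) (huv : ∀ x ∈ sphere c R, u x ≤ v x) :
    ∀ x ∈ closedBall c R, u x ≤ sweep v c R x := by
  have hvs := hv.mono sphere_subset_closedBall
  have h := le_of_submeanAt (U := ball c R) (u := fun z => u z + -sweep v c R z) (M := 0)
    isOpen_ball isBounded_ball (by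
      rw [closure_ball c hR.ne']
      exact hu.add (continuousOn_sweep hR Subset.rfl hv).neg)
    (fun x hx => (hs x hx).add (HarmonicAt.submeanAt (harmonicAt_sweep hR hvs hx).neg)) (by
      intro x hx
      rw [frontier_ball c hR.ne'] at hx
      rw [sweep_of_notMem (by simpa using (mem_sphere.1 hx).ge)]
      linarith [huv x hx])
  rw [closure_ball c hR.ne'] at h
  intro x hx
  linarith [h x hx]

theorem sweep_neg {u : ℂ → ℝ} {c : ℂ} {R : ℝ} (w : ℂ) :
    sweep (fun z => -u z) c R w = -sweep u c R w := by
  unfold sweep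
  split_ifs
  · exact poissonIntegral_neg _ _ _ _
  · rfl

/-- A continuous function with the mean value property is harmonic. -/
theorem harmonicAt_of_submeanAt {u : ℂ → ℝ} {x : ℂ} (h1 : ∀ᶠ y in 𝓝 x, SubmeanAt u y)
    (h2 : ∀ᶠ y in 𝓝 x, SubmeanAt (fun z => -u z) y) : HarmonicAt u x := by
  obtain ⟨r, hr, hr0⟩ := ((eventually_closedBall (h1.and h2)).and self_mem_nhdsWithin).exists
  have hr0 : 0 < r := hr0
  have hc : ContinuousOn u (closedBall x r) :=
    fun y hy => (hr y hy).1.1.self_of_nhds.continuousWithinAt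
  have ha := le_sweep hr0 hc hc (fun y hy => (hr y (ball_subset_closedBall hy)).1)
    (fun _ _ => le_rfl)
  have hb := le_sweep hr0 hc.neg hc.neg (fun y hy => (hr y (ball_subset_closedBall hy)).2)
    (fun _ _ => le_rfl)
  refine (harmonicAt_congr_nhds ?_).1
    (harmonicAt_sweep hr0 (hc.mono sphere_subset_closedBall) (mem_ball_self hr0))
  filter_upwards [closedBall_mem_nhds x hr0] with y hy
  have h3 := hb y hy
  rw [show (-u : ℂ → ℝ) = fun z => -u z from rfl, sweep_neg] at h3
  simp only at h3
  exact le_antisymm (by linarith) (ha y hy)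

/-! ### Greatest submean minorants -/

theorem continuousOn_of_submeanAt {D : Set ℂ} {u : ℂ → ℝ} (hu : ∀ x ∈ D, SubmeanAt u x) :
    ContinuousOn u D := fun x hx => (hu x hx).1.self_of_nhds.continuousWithinAt

theorem continuousOn_of_submeanAt_neg {D : Set ℂ} {u : ℂ → ℝ}
    (hu : ∀ x ∈ D, SubmeanAt (fun z => -u z) x) : ContinuousOn u D := fun x hx => by
  exact (by simpa [Function.comp_def] using continuousAt_neg.comp (hu x hx).1.self_of_nhds :
    ContinuousAt u x).continuousWithinAt

theorem sweep_le {u : ℂ → ℝ} {c : ℂ} {R : ℝ} (hR : 0 < R) {D : Set ℂ} (hD : closedBall c R ⊆ D)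
    (hu : ∀ x ∈ D, SubmeanAt (fun z => -u z) x) (x : ℂ) : sweep u c R x ≤ u x := by
  by_cases hx : x ∈ ball c R
  · have hc := (continuousOn_of_submeanAt hu).mono hD
    have h := le_sweep hR hc hc (fun y hy => hu y (hD (ball_subset_closedBall hy)))
      (fun _ _ => le_rfl) x (ball_subset_closedBall hx)
    rw [sweep_neg] at h
    linarith
  · rw [sweep_of_notMem hx]

/-- Outside the open disc the value at the centre is unchanged while the function has only
decreased, so the supermean inequality survives; inside, the function is harmonic. Points of the
boundary circle need no separate treatment. -/
theorem submeanAt_neg_sweep {u : ℂ → ℝ} {c : ℂ} {R : ℝ} (hR : 0 < R) {D : Set ℂ} (hDo : IsOpen D)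
    (hD : closedBall c R ⊆ D) (hu : ∀ x ∈ D, SubmeanAt (fun z => -u z) x) :
    ∀ x ∈ D, SubmeanAt (fun z => -sweep u c R z) x := by
  intro x hx
  have huc : ContinuousOn u D := continuousOn_of_submeanAt_neg hu
  by_cases hxb : x ∈ ball c R
  · exact HarmonicAt.submeanAt
      (harmonicAt_sweep hR (huc.mono (sphere_subset_closedBall.trans hD)) hxb).neg
  have hc : ∀ᶠ y in 𝓝 x, ContinuousAt (fun z => -sweep u c R z) y := by
    filter_upwards [hDo.mem_nhds hx] with y hy
    exact ((continuousOn_sweep hR hD huc).continuousAt (hDo.mem_nhds hy)).neg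
  refine ⟨hc, ?_⟩
  filter_upwards [(hu x hx).2, SubmeanAt.circleIntegrable hc,
    SubmeanAt.circleIntegrable (hu x hx).1] with r h1 h2 h3
  rw [sweep_of_notMem hxb]
  exact h1.trans (circleAverage_mono h3 h2 fun z _ => neg_le_neg (sweep_le hR hD hu z))

/-- Successive Poisson modifications of `s` in the discs inside `D` with centres in a countable
dense set and radii `1 / (m + 1)`; each disc is used infinitely often. -/
noncomputable def sweepSeq (D : Set ℂ) (s : ℂ → ℝ) : ℕ → ℂ → ℝ
  | 0 => s
  | n + 1 =>
    open Classical in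
    if closedBall (TopologicalSpace.denseSeq ℂ n.unpair.1.unpair.1) (1 / ((n.unpair.1.unpair.2 : ℝ) + 1)) ⊆ D then
      sweep (sweepSeq D s n) (TopologicalSpace.denseSeq ℂ n.unpair.1.unpair.1)
        (1 / ((n.unpair.1.unpair.2 : ℝ) + 1))
    else sweepSeq D s n

theorem submeanAt_neg_sweepSeq {D : Set ℂ} (hD : IsOpen D) {s : ℂ → ℝ}
    (hs : ∀ x ∈ D, SubmeanAt (fun z => -s z) x) (n : ℕ) :
    ∀ x ∈ D, SubmeanAt (fun z => -sweepSeq D s n z) x := by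
  induction n with
  | zero => exact hs
  | succ n ih =>
    rw [sweepSeq]
    split_ifs with h
    · exact submeanAt_neg_sweep (by positivity) hD h ih
    · exact ih

theorem sweepSeq_succ_le {D : Set ℂ} (hD : IsOpen D) {s : ℂ → ℝ}
    (hs : ∀ x ∈ D, SubmeanAt (fun z => -s z) x) (n : ℕ) (x : ℂ) :
    sweepSeq D s (n + 1) x ≤ sweepSeq D s n x := by
  rw [sweepSeq]
  split_ifs with h
  · exact sweep_le (by positivity) h (submeanAt_neg_sweepSeq hD hs n) x
  · rfl

/-- A submean function that lies below on the boundary circle lies below the Poisson integral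
inside, so no modification pushes the sequence under `W`. -/
theorem le_sweepSeq {D : Set ℂ} (hD : IsOpen D) {s W : ℂ → ℝ}
    (hs : ∀ x ∈ D, SubmeanAt (fun z => -s z) x) (hW : ∀ x ∈ D, SubmeanAt W x)
    (hle : ∀ x ∈ D, W x ≤ s x) (n : ℕ) : ∀ x ∈ D, W x ≤ sweepSeq D s n x := by
  induction n with
  | zero => exact hle
  | succ n ih =>
    rw [sweepSeq]
    split_ifs with h
    · intro x hx
      set c := TopologicalSpace.denseSeq ℂ n.unpair.1.unpair.1
      set R := 1 / ((n.unpair.1.unpair.2 : ℝ) + 1) with hRdef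
      have hR : 0 < R := by positivity
      by_cases hxb : x ∈ closedBall c R
      · have hc : ContinuousOn (sweepSeq D s n) D := continuousOn_of_submeanAt_neg (submeanAt_neg_sweepSeq hD hs n)
        exact le_sweep hR ((continuousOn_of_submeanAt hW).mono h) (hc.mono h)
          (fun y hy => hW y (h (ball_subset_closedBall hy)))
          (fun y hy => ih y (h (sphere_subset_closedBall hy))) x hxb
      · rw [sweep_of_notMem fun h' => hxb (ball_subset_closedBall h')]
        exact ih x hx
    · exact ih

/-- The modifications decrease to a limit `h`. For each disc used, the subsequence taken just after
its own modifications tends to `h` and also to the Poisson integral of `h`, so `h` is harmonic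
there. Every submean minorant of `s` survives all modifications, hence lies below `h`. -/
theorem exists_greatest_submean_minorant {D : Set ℂ} (hD : IsOpen D) {s : ℂ → ℝ}
    (hs : ∀ x ∈ D, SubmeanAt (fun z => -s z) x) (hs0 : ∀ x ∈ D, 0 ≤ s x) :
    ∃ h : ℂ → ℝ, HarmonicOnNhd h D ∧ (∀ x ∈ D, h x ≤ s x) ∧
      ∀ W : ℂ → ℝ, (∀ x ∈ D, SubmeanAt W x) → (∀ x ∈ D, W x ≤ s x) → ∀ x ∈ D, W x ≤ h x := by
  have hanti : ∀ x, Antitone fun n => sweepSeq D s n x := fun x =>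
    antitone_nat_of_succ_le fun n => sweepSeq_succ_le hD hs n x
  have hnn : ∀ n, ∀ x ∈ D, 0 ≤ sweepSeq D s n x := fun n =>
    le_sweepSeq hD hs (W := fun _ => 0)
      (fun x _ => HarmonicAt.submeanAt (harmonicOnNhd_const (s := univ) (0 : ℝ) x (mem_univ x)))
      hs0 n
  have hles : ∀ n x, sweepSeq D s n x ≤ s x := fun n x => hanti x (Nat.zero_le n)
  have hsc : ∀ n, ContinuousOn (sweepSeq D s n) D := fun n =>
    continuousOn_of_submeanAt_neg (submeanAt_neg_sweepSeq hD hs n)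
  set h : ℂ → ℝ := fun x => ⨅ n, sweepSeq D s n x with hh
  have hlim : ∀ x ∈ D, Tendsto (fun n => sweepSeq D s n x) atTop (𝓝 (h x)) := fun x hx =>
    tendsto_atTop_ciInf (hanti x) ⟨0, by rintro _ ⟨n, rfl⟩; exact hnn n x hx⟩
  refine ⟨h, ?_, fun x hx => le_of_tendsto (hlim x hx) (Eventually.of_forall fun n => hles n x),
    fun W hW hWs x hx => ge_of_tendsto (hlim x hx)
      (Eventually.of_forall fun n => le_sweepSeq hD hs hW hWs n x hx)⟩
  intro x hx
  obtain ⟨ε, hε, hεD⟩ := Metric.isOpen_iff.1 hD x hx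
  obtain ⟨m, hm⟩ := exists_nat_one_div_lt (half_pos hε)
  set R : ℝ := 1 / ((m : ℝ) + 1) with hRdef
  have hR : 0 < R := by positivity
  obtain ⟨i, hi⟩ := (TopologicalSpace.denseRange_denseSeq ℂ).exists_dist_lt x hR
  set c := TopologicalSpace.denseSeq ℂ i with hcdef
  have hxb : x ∈ ball c R := hi
  have hcD : closedBall c R ⊆ D := by
    intro y hy
    refine hεD ?_
    rw [mem_ball]
    have := dist_triangle y c x
    rw [dist_comm c x] at this
    rw [mem_closedBall] at hy
    linarith
  have hsphD : sphere c R ⊆ D := sphere_subset_closedBall.trans hcD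
  -- The stages at which the disc with index `(i, m)` is treated.
  set φ : ℕ → ℕ := fun j => Nat.pair (Nat.pair i m) j with hφ
  have hφt : Tendsto φ atTop atTop :=
    tendsto_atTop_mono (fun j => Nat.right_le_pair _ _) tendsto_id
  have hsucc : ∀ j, sweepSeq D s (φ j + 1) = sweep (sweepSeq D s (φ j)) c R := by
    intro j
    rw [sweepSeq]
    have h1 : (φ j).unpair.1.unpair.1 = i := by simp [hφ]
    have h2 : (φ j).unpair.1.unpair.2 = m := by simp [hφ]
    rw [h1, h2, if_pos hcD]
  have hmap : ∀ θ, circleMap c R θ ∈ D := fun θ => hsphD (circleMap_mem_sphere c hR.le θ)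
  have hci : ∀ n, CircleIntegrable (sweepSeq D s n) c R := fun n =>
    ((hsc n).mono hsphD).circleIntegrable hR.le
  have hhi : CircleIntegrable h c R := by
    refine IntervalIntegrable.mono_fun' (hci 0) ?_ ?_
    · exact aestronglyMeasurable_of_tendsto_ae atTop
        (fun n => (intervalIntegrable_iff.1 (hci n)).aestronglyMeasurable)
        (MeasureTheory.ae_of_all _ fun θ => hlim _ (hmap θ))
    · refine MeasureTheory.ae_of_all _ fun θ => ?_
      have h0 : 0 ≤ h (circleMap c R θ) := ge_of_tendsto (hlim _ (hmap θ))
        (Eventually.of_forall fun n => hnn n _ (hmap θ))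
      beta_reduce
      rw [Real.norm_of_nonneg h0]
      exact le_of_tendsto (hlim _ (hmap θ)) (Eventually.of_forall fun n => hles n _)
  refine (harmonicAt_congr_nhds ?_).1 (harmonicOnNhd_poissonIntegral hhi x hxb)
  filter_upwards [isOpen_ball.mem_nhds hxb] with w hw
  have hwD : w ∈ D := hcD (ball_subset_closedBall hw)
  have hk := fun n => circleIntegrable_poissonKernel_smul (hci n) hw
  -- The sequence lies between zero and its initial term on the circle, so dominated convergence
  -- applies.
  have hdom : Tendsto (fun n => poissonIntegral (sweepSeq D s n) c R w) atTop
      (𝓝 (poissonIntegral h c R w)) := by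
    refine Tendsto.const_smul ?_ _
    refine intervalIntegral.tendsto_integral_filter_of_dominated_convergence
      (fun θ => (poissonKernel c w • sweepSeq D s 0) (circleMap c R θ))
      (Eventually.of_forall fun n => (intervalIntegrable_iff.1 (hk n)).aestronglyMeasurable)
      (Eventually.of_forall fun n => MeasureTheory.ae_of_all _ fun θ _ => ?_) (hk 0)
      (MeasureTheory.ae_of_all _ fun θ _ => ?_)
    · have hp := poissonKernel_nonneg hw (circleMap_mem_sphere c hR.le θ)
      change ‖poissonKernel c w (circleMap c R θ) * sweepSeq D s n (circleMap c R θ)‖ ≤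
        poissonKernel c w (circleMap c R θ) * sweepSeq D s 0 (circleMap c R θ)
      rw [Real.norm_of_nonneg (mul_nonneg hp (hnn n _ (hmap θ)))]
      exact mul_le_mul_of_nonneg_left (hles n _) hp
    · exact (hlim _ (hmap θ)).const_mul (poissonKernel c w (circleMap c R θ))
  have h1 := hdom.comp hφt
  have h2 : Tendsto (fun j => sweepSeq D s (φ j + 1) w) atTop (𝓝 (h w)) :=
    (hlim w hwD).comp ((tendsto_add_atTop_nat 1).comp hφt)
  refine tendsto_nhds_unique h1 (h2.congr fun j => ?_)
  rw [hsucc, sweep_of_mem hw]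
  rfl

/-! ### The Green function -/

/-- The Green function of the unit disc. -/
noncomputable def discGreen (p z : ℂ) : ℝ :=
  Real.log ‖1 - (starRingEnd ℂ) p * z‖ - Real.log ‖z - p‖

/-- This identity gives both the sign of `discGreen` in the disc and its vanishing on the circle. -/
theorem norm_sq_one_sub_conj_mul (p z : ℂ) :
    ‖1 - (starRingEnd ℂ) p * z‖ ^ 2 = ‖z - p‖ ^ 2 + (1 - ‖p‖ ^ 2) * (1 - ‖z‖ ^ 2) := by
  simp only [← Complex.normSq_eq_norm_sq, Complex.normSq_apply]
  simp
  ring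

theorem one_sub_conj_mul_ne_zero {p z : ℂ} (hp : ‖p‖ < 1) (hz : ‖z‖ ≤ 1) :
    1 - (starRingEnd ℂ) p * z ≠ 0 := by
  intro h
  have h1 : ‖(starRingEnd ℂ) p * z‖ = 1 := by rw [← sub_eq_zero.1 h, norm_one]
  rw [norm_mul, RCLike.norm_conj] at h1
  nlinarith [norm_nonneg p, norm_nonneg z]

theorem discGreen_nonneg {p z : ℂ} (hp : ‖p‖ < 1) (hz : ‖z‖ ≤ 1) (hzp : z ≠ p) :
    0 ≤ discGreen p z := by
  have h1 : 0 < ‖z - p‖ := norm_pos_iff.2 (sub_ne_zero.2 hzp)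
  refine sub_nonneg.2 (Real.log_le_log h1 ?_)
  refine le_of_sq_le_sq ?_ (norm_nonneg _)
  rw [norm_sq_one_sub_conj_mul]
  have := mul_nonneg (sub_nonneg.2 (pow_le_one₀ (n := 2) (norm_nonneg p) hp.le))
    (sub_nonneg.2 (pow_le_one₀ (n := 2) (norm_nonneg z) hz))
  linarith

theorem harmonicAt_log_norm_one_sub_conj_mul {p z : ℂ} (hp : ‖p‖ < 1) (hz : ‖z‖ ≤ 1) :
    HarmonicAt (fun z => Real.log ‖1 - (starRingEnd ℂ) p * z‖) z :=
  AnalyticAt.harmonicAt_log_norm (f := fun z => 1 - (starRingEnd ℂ) p * z) (by fun_prop)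
    (one_sub_conj_mul_ne_zero hp hz)

theorem harmonicAt_discGreen {p z : ℂ} (hp : ‖p‖ < 1) (hz : ‖z‖ ≤ 1) (hzp : z ≠ p) :
    HarmonicAt (discGreen p) z :=
  (harmonicAt_log_norm_one_sub_conj_mul hp hz).sub
    (AnalyticAt.harmonicAt_log_norm (f := fun z => z - p) (by fun_prop) (sub_ne_zero.2 hzp))

theorem discGreen_le {p z : ℂ} {ε : ℝ} (hp : ‖p‖ ≤ 1) (hz : ‖z‖ ≤ 1) (hε : 0 < ε)
    (h : ε ≤ ‖z - p‖) : discGreen p z ≤ Real.log 2 - Real.log ε := by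
  refine sub_le_sub ?_ (Real.log_le_log hε h)
  -- This case would force `z = p`, which `h` excludes; the convention `Real.log 0 = 0` settles it
  -- without that argument.
  by_cases h0 : ‖1 - (starRingEnd ℂ) p * z‖ = 0
  · rw [h0, Real.log_zero]
    exact Real.log_nonneg one_le_two
  refine Real.log_le_log (lt_of_le_of_ne (norm_nonneg _) (Ne.symm h0)) ?_
  refine (norm_sub_le _ _).trans ?_
  rw [norm_one, norm_mul, RCLike.norm_conj]
  nlinarith [norm_nonneg p, norm_nonneg z]

theorem tendsto_discGreen {p : ℂ} (hp : ‖p‖ < 1) : Tendsto (discGreen p) (𝓝[≠] p) atTop := by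
  have h1 : Tendsto (fun z => Real.log ‖1 - (starRingEnd ℂ) p * z‖) (𝓝[≠] p)
      (𝓝 (Real.log ‖1 - (starRingEnd ℂ) p * p‖)) :=
    (HarmonicAt.continuousAt (harmonicAt_log_norm_one_sub_conj_mul hp hp.le)).mono_left
      nhdsWithin_le_nhds
  have h2 : Tendsto (fun z => -Real.log ‖z - p‖) (𝓝[≠] p) atTop := by
    refine tendsto_neg_atBot_atTop.comp (Real.tendsto_log_nhdsGT_zero.comp ?_)
    refine tendsto_nhdsWithin_iff.2 ⟨?_, ?_⟩
    · have : Continuous fun z : ℂ => ‖z - p‖ := by fun_prop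
      simpa using (this.tendsto p).mono_left (nhdsWithin_le_nhds (s := {p}ᶜ))
    · filter_upwards [self_mem_nhdsWithin] with z hz
      exact norm_pos_iff.2 (sub_ne_zero.2 hz)
  exact h1.add_atTop h2

/-- A nonnegative continuous supermean function on `D \ {p}` with a logarithmic pole at `p`. -/
structure IsLogSupermean (D : Set ℂ) (p : ℂ) (v : ℂ → ℝ) : Prop where
  supermean : ∀ x ∈ D \ {p}, SubmeanAt (fun z => -v z) x
  nonneg : ∀ x ∈ D \ {p}, 0 ≤ v x
  pole : ∃ k : ℂ → ℝ, SubmeanAt (fun z => -k z) p ∧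
    ∀ᶠ z in 𝓝[≠] p, v z + Real.log ‖z - p‖ = k z

theorem HasLogPole.isLogSupermean {D : Set ℂ} {p : ℂ} {g : ℂ → ℝ} (h : HasLogPole D p g) :
    IsLogSupermean D p g := by
  refine ⟨fun x hx => HarmonicAt.submeanAt (h.harmonic x hx).neg, h.nonneg, ?_⟩
  obtain ⟨k, hk, hk'⟩ := h.pole
  exact ⟨k, HarmonicAt.submeanAt hk.neg, hk'⟩

/-- The least function is `G - h`, with `G` the Green function of the disc and `h` the greatest
submean minorant of a truncation of `G`. Any competitor `v` gives a submean function `G - v` across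
the pole, hence `G - v ≤ h`. -/
theorem exists_least_logPole {D : Set ℂ} {p : ℂ} (hD : IsOpen D) (hDb : D ⊆ ball 0 1)
    (hp : p ∈ D) : ∃ g : ℂ → ℝ, HasLogPole D p g ∧ (∀ z ∈ D \ {p}, g z ≤ discGreen p z) ∧
      ∀ v, IsLogSupermean D p v → ∀ z ∈ D \ {p}, g z ≤ v z := by
  have hn : ∀ z ∈ D, ‖z‖ < 1 := fun z hz => by simpa using hDb hz
  have hp1 := hn p hp
  obtain ⟨ε, hε, hεD⟩ := Metric.nhds_basis_closedBall.mem_iff.1 (hD.mem_nhds hp)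
  -- `N` bounds `G` outside a small disc about the pole. Truncating `G` at this level makes it
  -- supermean on all of `D` and loses no minorant: by the maximum principle a submean minorant of
  -- `G` is at most `N` in the small disc too.
  set N := Real.log 2 - Real.log ε with hN
  set G := discGreen p with hG
  have hGN : ∀ z ∈ D, ε ≤ ‖z - p‖ → G z ≤ N := fun z hz h =>
    discGreen_le hp1.le (hn z hz).le hε h
  have hN0 : 0 ≤ N := by
    have hmem : p + (ε : ℂ) ∈ D := hεD (by simp [abs_of_pos hε])
    have hne : p + (ε : ℂ) ≠ p := by simpa using hε.ne'
    exact (discGreen_nonneg hp1 (hn _ hmem).le hne).trans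
      (hGN _ hmem (by simp [abs_of_pos hε]))
  classical
  set s : ℂ → ℝ := fun z => if z = p then N else min (G z) N with hs
  have hconst : ∀ (a : ℝ) (x : ℂ), SubmeanAt (fun _ => a) x := fun a x =>
    HarmonicAt.submeanAt (harmonicOnNhd_const (s := univ) a x (mem_univ x))
  have hsp : ∀ z, z ≠ p → s z = min (G z) N := fun z hz => if_neg hz
  have hsub : ∀ x ∈ D, SubmeanAt (fun z => -s z) x := by
    intro x hx
    by_cases hxp : x = p
    · refine (hconst (-N) x).congr ?_
      have := eventually_nhdsWithin_iff.1 ((tendsto_discGreen hp1).eventually_ge_atTop N)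
      rw [hxp]
      filter_upwards [this] with z hz
      by_cases hzp : z = p
      · simp [hs, hzp]
      · rw [hsp z hzp, min_eq_right (hz hzp)]
    · have h1 : SubmeanAt (fun z => -G z) x :=
        HarmonicAt.submeanAt (harmonicAt_discGreen hp1 (hn x hx).le hxp).neg
      refine (h1.sup (hconst (-N) x)).congr ?_
      filter_upwards [isOpen_ne.mem_nhds hxp] with z hz
      rw [hsp z hz, max_neg_neg]
  have hs0 : ∀ x ∈ D, 0 ≤ s x := by
    intro x hx
    by_cases hxp : x = p
    · simp [hs, hxp, hN0]
    · rw [hsp x hxp]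
      exact le_min (discGreen_nonneg hp1 (hn x hx).le hxp) hN0
  obtain ⟨h, hh, hhs, hgr⟩ := exists_greatest_submean_minorant hD hsub hs0
  have hsG : ∀ x, x ≠ p → s x ≤ G x := fun x hx => (hsp x hx).trans_le (min_le_left _ _)
  refine ⟨fun z => G z - h z, ⟨?_, ?_, ?_⟩, ?_, ?_⟩
  · rintro x ⟨hx, hxp⟩
    exact (harmonicAt_discGreen hp1 (hn x hx).le hxp).sub (hh x hx)
  · rintro x ⟨hx, hxp⟩
    exact sub_nonneg.2 ((hhs x hx).trans (hsG x hxp))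
  · refine ⟨fun z => Real.log ‖1 - (starRingEnd ℂ) p * z‖ - h z,
      (harmonicAt_log_norm_one_sub_conj_mul hp1 hp1.le).sub (hh p hp),
      Eventually.of_forall fun z => ?_⟩
    simp only [hG, discGreen]
    ring
  · rintro x ⟨hx, hxp⟩
    have := hgr (fun _ => 0) (fun x _ => hconst 0 x) hs0 x hx
    simp only at this ⊢
    linarith
  · intro v hv
    obtain ⟨k, hk, hvk⟩ := hv.pole
    -- The logarithms of `G` and `v` cancel, and the value at the pole is the one that makes `W`
    -- continuous there.
    set W : ℂ → ℝ := fun z => if z = p then Real.log ‖1 - (starRingEnd ℂ) p * z‖ - k z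
      else G z - v z with hW
    have hWp : ∀ z, z ≠ p → W z = G z - v z := fun z hz => if_neg hz
    have hWsub : ∀ x ∈ D, SubmeanAt W x := by
      intro x hx
      by_cases hxp : x = p
      · rw [hxp]
        refine ((HarmonicAt.submeanAt
          (harmonicAt_log_norm_one_sub_conj_mul hp1 hp1.le)).add hk).congr ?_
        filter_upwards [eventually_nhdsWithin_iff.1 hvk] with z hz
        by_cases hzp : z = p
        · simp only [hW, hzp, if_true]
          ring
        · rw [hWp z hzp, ← hz hzp, hG, discGreen]
          ring
      · refine ((HarmonicAt.submeanAt (harmonicAt_discGreen hp1 (hn x hx).le hxp)).add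
          (hv.supermean x ⟨hx, hxp⟩)).congr ?_
        filter_upwards [isOpen_ne.mem_nhds hxp] with z hz
        rw [hWp z hz, hG]
        ring
    have hWG : ∀ x ∈ D, x ≠ p → W x ≤ G x := by
      intro x hx hxp
      rw [hWp x hxp]
      linarith [hv.nonneg x ⟨hx, hxp⟩]
    -- Nothing bounds `W` directly near the pole, so the bound is carried inside from the circle of
    -- radius `ε`.
    have hball : ∀ x ∈ closedBall p ε, W x ≤ N := by
      have := le_of_submeanAt (U := ball p ε) (u := W) (M := N) isOpen_ball isBounded_ball
        (by
          rw [closure_ball p hε.ne']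
          exact (continuousOn_of_submeanAt hWsub).mono hεD)
        (fun x hx => hWsub x (hεD (ball_subset_closedBall hx))) (by
          intro x hx
          rw [frontier_ball p hε.ne', mem_sphere, dist_eq_norm] at hx
          have hxD : x ∈ D := hεD (by rw [mem_closedBall, dist_eq_norm]; exact hx.le)
          refine (hWG x hxD ?_).trans (hGN x hxD hx.ge)
          rintro rfl
          simp at hx
          exact hε.ne hx)
      rwa [closure_ball p hε.ne'] at this
    have hWs : ∀ x ∈ D, W x ≤ s x := by
      intro x hx
      have hWN : W x ≤ N := by
        by_cases hb : x ∈ closedBall p ε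
        · exact hball x hb
        · rw [mem_closedBall, not_le, dist_eq_norm] at hb
          refine (hWG x hx ?_).trans (hGN x hx hb.le)
          rintro rfl
          simp at hb
          linarith
      by_cases hxp : x = p
      · simpa [hs, hxp] using hxp ▸ hWN
      · rw [hsp x hxp]
        exact le_min (hWG x hx hxp) hWN
    rintro z ⟨hz, hzp⟩
    have := hgr W hWsub hWs z hz
    rw [hWp z hzp] at this
    simp only
    linarith

theorem isGreenFunction_greenFunction {D : Set ℂ} {p : ℂ} (hD : IsOpen D) (hDb : D ⊆ ball 0 1)
    (hp : p ∈ D) : IsGreenFunction D p (greenFunction D p) := by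
  obtain ⟨g, hg, -, hmin⟩ := exists_least_logPole hD hDb hp
  have hex : ∃ g : ℂ → ℝ, IsGreenFunction D p g := ⟨g, hg, fun g' hg' => hmin g' hg'.isLogSupermean⟩
  rw [greenFunction, dif_pos hex]
  exact hex.choose_spec

/-- `IsGreenFunction` compares with harmonic competitors only; the gluing argument needs supermean
ones. -/
theorem IsGreenFunction.le_of_isLogSupermean {D : Set ℂ} {p : ℂ} {g v : ℂ → ℝ} (hD : IsOpen D)
    (hDb : D ⊆ ball 0 1) (hp : p ∈ D) (hg : IsGreenFunction D p g) (hv : IsLogSupermean D p v) :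
    ∀ z ∈ D \ {p}, g z ≤ v z := by
  obtain ⟨g', hg', -, hmin⟩ := exists_least_logPole hD hDb hp
  exact fun z hz => (hg.2 g' hg' z hz).trans (hmin v hv z hz)

theorem IsGreenFunction.le_discGreen {D : Set ℂ} {p : ℂ} {g : ℂ → ℝ} (hD : IsOpen D)
    (hDb : D ⊆ ball 0 1) (hp : p ∈ D) (hg : IsGreenFunction D p g) :
    ∀ z ∈ D \ {p}, g z ≤ discGreen p z := by
  obtain ⟨g', hg', hle, -⟩ := exists_least_logPole hD hDb hp
  exact fun z hz => (hg.2 g' hg' z hz).trans (hle z hz)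

/-! ### Estimates for harmonic functions -/

/-- The Herglotz kernel differs from one by `2 * (w - c) / (z - w)`, whose denominator has modulus
at least `R / 2`. -/
theorem abs_poissonKernel_sub_one_le {c w z : ℂ} {R : ℝ} (hz : z ∈ sphere c R)
    (hw : ‖w - c‖ ≤ R / 2) (hR : 0 < R) : |poissonKernel c w z - 1| ≤ 4 / R * ‖w - c‖ := by
  have h1 : ‖z - c‖ = R := by simpa [dist_eq_norm] using hz
  have h2 : R / 2 ≤ ‖z - c - (w - c)‖ := by
    have := norm_sub_norm_le (z - c) (w - c)
    linarith
  have hne : z - c - (w - c) ≠ 0 := by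
    intro h
    rw [h, norm_zero] at h2
    linarith
  have h3 : herglotzRieszKernel c w z - 1 = 2 * (w - c) / (z - c - (w - c)) := by
    rw [herglotzRieszKernel]
    field_simp
    ring
  rw [poissonKernel_eq_re_herglotzRieszKernel]
  have h4 : (Complex.re ∘ herglotzRieszKernel c w) z - 1 = (herglotzRieszKernel c w z - 1).re := by
    simp
  rw [h4, h3]
  refine (Complex.abs_re_le_norm _).trans ?_
  rw [norm_div, norm_mul, Complex.norm_ofNat, div_le_iff₀ (by linarith)]
  have : 4 / R * ‖w - c‖ * (R / 2) ≤ 4 / R * ‖w - c‖ * ‖z - c - (w - c)‖ := by gcongr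
  have h5 : 4 / R * ‖w - c‖ * (R / 2) = 2 * ‖w - c‖ := by field_simp; ring
  linarith

/-- Both values are Poisson integrals over the same circle, and the kernel of the centre is
identically one. -/
theorem HarmonicOnNhd.abs_sub_le {u : ℂ → ℝ} {c w : ℂ} {R M : ℝ} (hR : 0 < R)
    (hu : HarmonicOnNhd u (closedBall c R)) (hM : ∀ z ∈ sphere c R, |u z| ≤ M)
    (hw : ‖w - c‖ ≤ R / 2) : |u w - u c| ≤ 4 / R * ‖w - c‖ * M := by
  have hwb : w ∈ ball c R := by rw [mem_ball, dist_eq_norm]; linarith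
  have huc : ContinuousOn u (sphere c R) :=
    fun z hz => (HarmonicAt.continuousAt (hu z (sphere_subset_closedBall hz))).continuousWithinAt
  have hui := huc.circleIntegrable hR.le
  rw [← HarmonicOnNhd.circleAverage_poissonKernel_smul hu hwb,
    ← HarmonicOnNhd.circleAverage_poissonKernel_smul hu (mem_ball_self hR),
    ← circleAverage_sub (circleIntegrable_poissonKernel_smul hui hwb)
      (circleIntegrable_poissonKernel_smul hui (mem_ball_self hR))]
  refine abs_circleAverage_le_circleAverage_abs.trans ?_
  refine circleAverage_mono_on_of_le_circle ?_ fun z hz => ?_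
  · exact ((circleIntegrable_poissonKernel_smul hui hwb).sub
      (circleIntegrable_poissonKernel_smul hui (mem_ball_self hR))).abs
  · rw [abs_of_pos hR] at hz
    have h1 : ‖z - c‖ = R := by simpa [dist_eq_norm] using hz
    have h2 : poissonKernel c c z = 1 := by
      rw [poissonKernel, sub_self, norm_zero, sub_zero, h1]
      field_simp
      ring
    change |poissonKernel c w z * u z - poissonKernel c c z * u z| ≤ _
    rw [h2, ← sub_mul, abs_mul]
    exact mul_le_mul (abs_poissonKernel_sub_one_le hz hw hR) (hM z hz) (abs_nonneg _)
      (by positivity)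

theorem isOpen_annulus (σ : ℝ) : IsOpen {w : ℂ | σ < ‖w‖ ∧ ‖w‖ < 1} :=
  (isOpen_lt continuous_const continuous_norm).inter (isOpen_lt continuous_norm continuous_const)

/-- Comparison with `m * log ‖w‖ / log σ` in the annulus `σ < ‖w‖ < 1`. -/
theorem annulus_le {u : ℂ → ℝ} {σ m : ℝ} (hσ0 : 0 < σ) (hσ1 : σ < 1)
    (hc : ContinuousOn u {w | σ ≤ ‖w‖ ∧ ‖w‖ ≤ 1})
    (hs : ∀ w : ℂ, σ < ‖w‖ → ‖w‖ < 1 → SubmeanAt u w) (hm : ∀ w, ‖w‖ = σ → u w ≤ m)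
    (h1 : ∀ w, ‖w‖ = 1 → u w ≤ 0) :
    ∀ w, σ ≤ ‖w‖ → ‖w‖ ≤ 1 → u w ≤ m * (Real.log ‖w‖ / Real.log σ) := by
  have hlog : Real.log σ ≠ 0 := (Real.log_neg hσ0 hσ1).ne
  set U : Set ℂ := {w | σ < ‖w‖ ∧ ‖w‖ < 1} with hU
  have hcl : IsClosed {w : ℂ | σ ≤ ‖w‖ ∧ ‖w‖ ≤ 1} :=
    (isClosed_le continuous_const continuous_norm).inter
      (isClosed_le continuous_norm continuous_const)
  have hsub : closure U ⊆ {w | σ ≤ ‖w‖ ∧ ‖w‖ ≤ 1} :=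
    closure_minimal (fun w hw => ⟨hw.1.le, hw.2.le⟩) hcl
  have hharm : ∀ w : ℂ, σ ≤ ‖w‖ → HarmonicAt (fun w => -(m / Real.log σ) * Real.log ‖w‖) w := by
    intro w hw
    have : w ≠ 0 := norm_pos_iff.1 (hσ0.trans_le hw)
    exact (AnalyticAt.harmonicAt_log_norm (f := fun w => w) (by fun_prop) this).const_smul
      (c := -(m / Real.log σ))
  set v : ℂ → ℝ := fun w => u w + -(m / Real.log σ) * Real.log ‖w‖ with hv
  have hvle : ∀ w, ‖w‖ = σ ∨ ‖w‖ = 1 → v w ≤ 0 := by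
    rintro w (hw | hw)
    · have := hm w hw
      simp only [hv, hw]
      field_simp
      linarith
    · have := h1 w hw
      simpa [hv, hw] using this
  have hmax := le_of_submeanAt (U := U) (u := v) (M := 0) (isOpen_annulus σ)
    ((isBounded_ball (x := (0 : ℂ)) (r := 1)).subset fun w hw => mem_ball_zero_iff.2 hw.2)
    ((hc.mono hsub).add fun w hw =>
      (HarmonicAt.continuousAt (hharm w (hsub hw).1)).continuousWithinAt)
    (fun w hw => (hs w hw.1 hw.2).add (HarmonicAt.submeanAt (hharm w hw.1.le)))
    (fun w hw => by
      rw [(isOpen_annulus σ).frontier_eq] at hw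
      have h2 := hsub hw.1
      refine hvle w ?_
      by_contra! h3
      exact hw.2 ⟨lt_of_le_of_ne h2.1 (Ne.symm h3.1), lt_of_le_of_ne h2.2 h3.2⟩)
  intro w hw1 hw2
  have : v w ≤ 0 := by
    by_cases h : ‖w‖ = σ ∨ ‖w‖ = 1
    · exact hvle w h
    · push Not at h
      exact hmax w (subset_closure ⟨lt_of_le_of_ne hw1 (Ne.symm h.1), lt_of_le_of_ne hw2 h.2⟩)
  have h4 : v w = u w - m * (Real.log ‖w‖ / Real.log σ) := by simp only [hv]; ring
  linarith

/-! ### Maps close to the identity -/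

/-- The domain `Ω` contains the annulus `r < ‖z‖ < 1`, and `p` lies in it with `‖p‖ ≤ r`. -/
structure IsCollared (Ω : Set ℂ) (p : ℂ) (r d : ℝ) : Prop where
  r_pos : 0 < r
  d_pos : 0 < d
  eq_one : r + 10 * d = 1
  mem : p ∈ Ω
  norm_le : ‖p‖ ≤ r
  annulus : ∀ z : ℂ, r < ‖z‖ → ‖z‖ < 1 → z ∈ Ω

/-- `φ` is a conformal map close to the identity and `D` is the image of `Ω` under an extension
of `φ`. -/
structure IsNearIdentity (Ω : Set ℂ) (r d : ℝ) (φ : ℂ → ℂ) (D : Set ℂ) : Prop where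
  differentiableOn : DifferentiableOn ℂ φ (ball 0 (r + 9 * d))
  injOn : InjOn φ (ball 0 (r + 9 * d))
  deriv_ne_zero : ∀ z ∈ ball (0 : ℂ) (r + 9 * d), deriv φ z ≠ 0
  norm_le : ∀ z ∈ ball (0 : ℂ) (r + 9 * d), ‖z‖ ≤ ‖φ z‖
  norm_sub_le : ∀ z ∈ ball (0 : ℂ) (r + 9 * d), ‖φ z - z‖ ≤ d
  surj : ∀ w, ‖w‖ < r + 9 * d → ∃ z ∈ ball (0 : ℂ) (r + 9 * d), φ z = w
  isOpen : IsOpen D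
  subset : D ⊆ ball 0 1
  mem_iff : ∀ z ∈ ball (0 : ℂ) (r + 9 * d), φ z ∈ D ↔ z ∈ Ω
  annulus : ∀ w : ℂ, r + d < ‖w‖ → ‖w‖ < 1 → w ∈ D

section

variable {Ω : Set ℂ} {p : ℂ} {r d : ℝ} {φ : ℂ → ℂ} {D : Set ℂ}

theorem IsCollared.mem_ball (h : IsCollared Ω p r d) : p ∈ ball (0 : ℂ) (r + 9 * d) := by
  have := h.norm_le
  have := h.d_pos
  rw [mem_ball_zero_iff]
  linarith

theorem IsNearIdentity.norm_pole_le (hΩ : IsCollared Ω p r d) (h : IsNearIdentity Ω r d φ D) :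
    ‖φ p‖ ≤ r + d := by
  have h1 := h.norm_sub_le p hΩ.mem_ball
  have h2 := hΩ.norm_le
  have := norm_add_le (φ p - p) p
  rw [sub_add_cancel] at this
  linarith

theorem IsNearIdentity.pole_mem (hΩ : IsCollared Ω p r d) (h : IsNearIdentity Ω r d φ D) :
    φ p ∈ D := (h.mem_iff p hΩ.mem_ball).2 hΩ.mem

theorem IsNearIdentity.norm_pole_lt_one (hΩ : IsCollared Ω p r d) (h : IsNearIdentity Ω r d φ D) :
    ‖φ p‖ < 1 := by
  have := h.norm_pole_le hΩ
  have := hΩ.eq_one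
  have := hΩ.d_pos
  linarith

theorem IsNearIdentity.mem_diff (hΩ : IsCollared Ω p r d) (h : IsNearIdentity Ω r d φ D) {w : ℂ}
    (h1 : r + d < ‖w‖) (h2 : ‖w‖ < 1) : w ∈ D \ {φ p} :=
  ⟨h.annulus w h1 h2, by rintro rfl; linarith [h.norm_pole_le hΩ]⟩

/-- A bound for the Green functions in the annulus `r + 3 / 2 d ≤ ‖w‖ < 1`. -/
noncomputable def greenBound (d : ℝ) : ℝ := Real.log 2 - Real.log (d / 2)

theorem IsCollared.greenBound_nonneg (hΩ : IsCollared Ω p r d) : 0 ≤ greenBound d := by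
  have := hΩ.d_pos
  have := hΩ.eq_one
  have := hΩ.r_pos
  exact sub_nonneg.2 (Real.log_le_log (by linarith) (by linarith))

theorem IsGreenFunction.le_greenBound (hΩ : IsCollared Ω p r d) (h : IsNearIdentity Ω r d φ D)
    {g : ℂ → ℝ} (hg : IsGreenFunction D (φ p) g) {w : ℂ} (h1 : r + 3 / 2 * d ≤ ‖w‖)
    (h2 : ‖w‖ < 1) : |g w| ≤ greenBound d := by
  have hd := hΩ.d_pos
  have hw : w ∈ D \ {φ p} := h.mem_diff hΩ (by linarith) h2
  rw [abs_of_nonneg (hg.1.nonneg w hw)]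
  refine (hg.le_discGreen h.isOpen h.subset (h.pole_mem hΩ) w hw).trans ?_
  refine discGreen_le (h.norm_pole_lt_one hΩ).le h2.le (half_pos hd) ?_
  have := norm_sub_norm_le w (φ p)
  linarith [h.norm_pole_le hΩ]

/-- For close points this is the estimate in a disc of radius `d / 2`, which stays where
`greenBound` applies. For points more than `d / 4` apart the bound `2 * greenBound d` is already
enough. -/
theorem IsGreenFunction.abs_sub_le (hΩ : IsCollared Ω p r d) (h : IsNearIdentity Ω r d φ D)
    {g : ℂ → ℝ} (hg : IsGreenFunction D (φ p) g) {w w' : ℂ} (h1 : r + 2 * d ≤ ‖w‖)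
    (h2 : ‖w‖ ≤ r + 9 * d) (h1' : r + 2 * d ≤ ‖w'‖) (h2' : ‖w'‖ ≤ r + 9 * d) :
    |g w' - g w| ≤ 8 / d * greenBound d * ‖w' - w‖ := by
  have hd := hΩ.d_pos
  have h10 := hΩ.eq_one
  have hM := hΩ.greenBound_nonneg
  have hb : ∀ z ∈ closedBall w (d / 2), r + 3 / 2 * d ≤ ‖z‖ ∧ ‖z‖ < 1 := by
    intro z hz
    rw [mem_closedBall, dist_eq_norm] at hz
    have h3 := norm_sub_norm_le z w
    have h4 := norm_sub_norm_le w z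
    rw [norm_sub_rev] at h4
    constructor <;> linarith
  by_cases hww : ‖w' - w‖ ≤ d / 2 / 2
  · have := HarmonicOnNhd.abs_sub_le (half_pos hd) (u := g) (c := w) (w := w') (M := greenBound d)
      (fun z hz => hg.1.harmonic z (h.mem_diff hΩ (by linarith [(hb z hz).1]) (hb z hz).2))
      (fun z hz => hg.le_greenBound hΩ h (hb z (sphere_subset_closedBall hz)).1
        (hb z (sphere_subset_closedBall hz)).2) hww
    refine this.trans (le_of_eq ?_)
    field_simp
    ring
  · rw [not_le] at hww
    have h3 := abs_le.1 (hg.le_greenBound hΩ h (w := w) (by linarith) (by linarith))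
    have h4 := abs_le.1 (hg.le_greenBound hΩ h (w := w') (by linarith) (by linarith))
    have h5 : 2 * greenBound d ≤ 8 / d * greenBound d * ‖w' - w‖ := by
      have : 8 / d * greenBound d * (d / 4) ≤ 8 / d * greenBound d * ‖w' - w‖ := by
        gcongr; linarith
      have h6 : 8 / d * greenBound d * (d / 4) = 2 * greenBound d := by field_simp; ring
      linarith
    rw [abs_le]
    constructor <;> linarith [h3.1, h3.2, h4.1, h4.2]

/-- The function `g` in the unit disc, extended by zero. -/
noncomputable def zeroExtend (g : ℂ → ℝ) (w : ℂ) : ℝ := if ‖w‖ < 1 then g w else 0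

theorem discGreen_eq_zero {p w : ℂ} (hw : ‖w‖ = 1) : discGreen p w = 0 := by
  have h : ‖1 - (starRingEnd ℂ) p * w‖ ^ 2 = ‖w - p‖ ^ 2 := by
    rw [norm_sq_one_sub_conj_mul, hw]; ring
  rw [discGreen, (pow_left_inj₀ (norm_nonneg _) (norm_nonneg _) two_ne_zero).1 h, sub_self]

theorem zeroExtend_eventuallyEq {g : ℂ → ℝ} {w : ℂ} (hw : ‖w‖ < 1) : zeroExtend g =ᶠ[𝓝 w] g := by
  filter_upwards [(isOpen_lt continuous_norm continuous_const).mem_nhds hw] with z hz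
  exact if_pos hz

/-- On the unit circle the function is squeezed between zero and the Green function of the disc,
which vanishes there. -/
theorem IsGreenFunction.continuousAt_zeroExtend (hΩ : IsCollared Ω p r d)
    (h : IsNearIdentity Ω r d φ D) {g : ℂ → ℝ} (hg : IsGreenFunction D (φ p) g) {w : ℂ}
    (hw : r + d < ‖w‖) : ContinuousAt (zeroExtend g) w := by
  rcases lt_trichotomy ‖w‖ 1 with h1 | h1 | h1
  · exact (HarmonicAt.continuousAt (hg.1.harmonic w (h.mem_diff hΩ hw h1))).congr
      (zeroExtend_eventuallyEq h1).symm
  · have hp := h.norm_pole_lt_one hΩ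
    have hz : zeroExtend g w = 0 := if_neg (by simp [h1])
    rw [ContinuousAt, hz]
    have hne : w ≠ φ p := by rintro rfl; linarith
    have hlim := (HarmonicAt.continuousAt (harmonicAt_discGreen hp h1.le hne)).abs
    rw [ContinuousAt, discGreen_eq_zero h1, abs_zero] at hlim
    refine squeeze_zero_norm' ?_ hlim
    filter_upwards [(isOpen_lt continuous_const continuous_norm).mem_nhds hw] with z hz
    rw [zeroExtend]
    split_ifs with h3
    · have hzm := h.mem_diff hΩ hz h3
      rw [Real.norm_of_nonneg (hg.1.nonneg z hzm)]
      exact (hg.le_discGreen h.isOpen h.subset (h.pole_mem hΩ) z hzm).trans (le_abs_self _)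
    · simp
  · refine continuousAt_const.congr (f := fun _ => (0 : ℝ)) ?_
    filter_upwards [(isOpen_lt continuous_const continuous_norm).mem_nhds h1] with z hz
    exact (if_neg (not_lt.2 (le_of_lt hz))).symm

end

/-! ### Comparison of Green functions -/

section

variable {Ω : Set ℂ} {p : ℂ} {r d : ℝ} {φ φ₁ φ₂ : ℂ → ℂ} {D D₁ D₂ : Set ℂ} {g g₁ g₂ : ℂ → ℝ}

/-- The inverse of `φ` on the image of the disc of radius `r + 9 * d`. -/
noncomputable def ballInverse (r d : ℝ) (φ : ℂ → ℂ) : ℂ → ℂ :=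
  Function.invFunOn φ (ball 0 (r + 9 * d))

theorem IsNearIdentity.ballInverse_apply (h : IsNearIdentity Ω r d φ D) {z : ℂ}
    (hz : z ∈ ball (0 : ℂ) (r + 9 * d)) : ballInverse r d φ (φ z) = z :=
  h.injOn.leftInvOn_invFunOn hz

theorem IsNearIdentity.analyticAt (h : IsNearIdentity Ω r d φ D) {z : ℂ}
    (hz : z ∈ ball (0 : ℂ) (r + 9 * d)) : AnalyticAt ℂ φ z :=
  h.differentiableOn.analyticAt (isOpen_ball.mem_nhds hz)

theorem IsNearIdentity.hasStrictDerivAt (h : IsNearIdentity Ω r d φ D) {z : ℂ}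
    (hz : z ∈ ball (0 : ℂ) (r + 9 * d)) : HasStrictDerivAt φ (deriv φ z) z :=
  (h.analyticAt hz).hasStrictDerivAt

theorem IsNearIdentity.image_mem_nhds (h : IsNearIdentity Ω r d φ D) {z : ℂ}
    (hz : z ∈ ball (0 : ℂ) (r + 9 * d)) {s : Set ℂ} (hs : s ∈ 𝓝 z) : φ '' s ∈ 𝓝 (φ z) := by
  rw [← (h.hasStrictDerivAt hz).map_nhds_eq (h.deriv_ne_zero z hz)]
  exact image_mem_map hs

/-- By injectivity the inverse on the whole disc agrees near `φ z` with the local inverse from the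
inverse function theorem. -/
theorem IsNearIdentity.hasDerivAt_ballInverse (h : IsNearIdentity Ω r d φ D) {z : ℂ}
    (hz : z ∈ ball (0 : ℂ) (r + 9 * d)) :
    HasDerivAt (ballInverse r d φ) (deriv φ z)⁻¹ (φ z) := by
  have hs := h.hasStrictDerivAt hz
  have hne := h.deriv_ne_zero z hz
  have hloc := (hs.to_localInverse hne).hasDerivAt
  refine hloc.congr_of_eventuallyEq ?_
  have h1 : hs.localInverse φ (deriv φ z) z hne (φ z) = z :=
    HasStrictFDerivAt.localInverse_apply_image _
  have h2 := HasStrictFDerivAt.eventually_right_inverse (hs.hasStrictFDerivAt_equiv hne)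
  have h3 : ∀ᶠ w in 𝓝 (φ z), hs.localInverse φ (deriv φ z) z hne w ∈ ball (0 : ℂ) (r + 9 * d) :=
    hloc.continuousAt.eventually (by rw [h1]; exact isOpen_ball.mem_nhds hz)
  filter_upwards [h2, h3] with w hw hw'
  calc ballInverse r d φ w = ballInverse r d φ (φ (hs.localInverse φ (deriv φ z) z hne w)) := by
        congr 1; exact hw.symm
    _ = _ := h.ballInverse_apply hw'

theorem IsNearIdentity.analyticAt_ballInverse (h : IsNearIdentity Ω r d φ D) {z : ℂ}
    (hz : z ∈ ball (0 : ℂ) (r + 9 * d)) : AnalyticAt ℂ (ballInverse r d φ) (φ z) := by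
  refine DifferentiableOn.analyticAt (s := φ '' ball 0 (r + 9 * d)) ?_
    (h.image_mem_nhds hz (isOpen_ball.mem_nhds hz))
  rintro _ ⟨y, hy, rfl⟩
  exact (h.hasDerivAt_ballInverse hy).differentiableAt.differentiableWithinAt

/-- A logarithmic pole is preserved by composition with a locally conformal map. -/
theorem logPole_comp {χ : ℂ → ℂ} {b : ℂ} (hχ : AnalyticAt ℂ χ b)
    (hinj : ∀ᶠ z in 𝓝[≠] b, χ z ≠ χ b) (hd : deriv χ b ≠ 0)
    (hg : ∃ k : ℂ → ℝ, HarmonicAt k (χ b) ∧ ∀ᶠ z in 𝓝[≠] (χ b), g z + Real.log ‖z - χ b‖ = k z) :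
    ∃ k : ℂ → ℝ, HarmonicAt k b ∧ ∀ᶠ z in 𝓝[≠] b, g (χ z) + Real.log ‖z - b‖ = k z := by
  obtain ⟨k, hk, hgk⟩ := hg
  obtain ⟨q, hq⟩ := hχ
  have hds : AnalyticAt ℂ (dslope χ b) b := ⟨_, hq.has_fpower_series_dslope_fslope⟩
  refine ⟨fun z => k (χ z) - Real.log ‖dslope χ b z‖,
    (HarmonicAt.comp_analyticAt hk ⟨q, hq⟩).sub
      (hds.harmonicAt_log_norm (by rwa [dslope_same])), ?_⟩
  have ht : Tendsto χ (𝓝[≠] b) (𝓝[≠] (χ b)) :=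
    tendsto_nhdsWithin_iff.2 ⟨hq.continuousAt.mono_left nhdsWithin_le_nhds, hinj⟩
  filter_upwards [ht.eventually hgk, self_mem_nhdsWithin, hinj] with z h1 h2 h3
  have h4 : 0 < ‖z - b‖ := norm_pos_iff.2 (sub_ne_zero.2 h2)
  have h5 : 0 < ‖χ z - χ b‖ := norm_pos_iff.2 (sub_ne_zero.2 h3)
  rw [← h1, dslope_of_ne _ h2, slope_def_field, norm_div, Real.log_div h5.ne' h4.ne']
  ring

/-- The maximum principle for the difference of two transplanted Green functions, away from the
complement of `Ω`. -/
theorem IsGreenFunction.le_add_of_lt (hΩ : IsCollared Ω p r d) (h₁ : IsNearIdentity Ω r d φ₁ D₁)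
    (h₂ : IsNearIdentity Ω r d φ₂ D₂) (hg₁ : IsGreenFunction D₁ (φ₁ p) g₁)
    (hg₂ : IsGreenFunction D₂ (φ₂ p) g₂) {M : ℝ} (hM : 0 ≤ M)
    (hlt : ∀ z : ℂ, ‖z‖ = r + 6 * d → g₁ (φ₁ z) < g₂ (φ₂ z) + M) {z : ℂ} (hz : ‖z‖ < r + 6 * d)
    (hzΩ : z ∈ Ω) (hzp : z ≠ p) : g₁ (φ₁ z) ≤ g₂ (φ₂ z) + M := by
  have hd := hΩ.d_pos
  have hmem : ∀ z : ℂ, ‖z‖ ≤ r + 6 * d → z ∈ ball (0 : ℂ) (r + 9 * d) := fun z hz => by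
    rw [mem_ball_zero_iff]; linarith
  -- The transition map from `D₁` to `D₂`, conformal on the image of the disc; it carries the pole
  -- of `g₁` to that of `g₂`.
  set χ : ℂ → ℂ := fun w => φ₂ (ballInverse r d φ₁ w) with hχ
  have hχφ : ∀ z ∈ ball (0 : ℂ) (r + 9 * d), χ (φ₁ z) = φ₂ z := fun z hz => by
    simp only [hχ, h₁.ballInverse_apply hz]
  have hχa : ∀ z ∈ ball (0 : ℂ) (r + 9 * d), AnalyticAt ℂ χ (φ₁ z) := fun z hz => by
    refine AnalyticAt.fun_comp ?_ (h₁.analyticAt_ballInverse hz)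
    rw [h₁.ballInverse_apply hz]
    exact h₂.analyticAt hz
  have hχd : ∀ z ∈ ball (0 : ℂ) (r + 9 * d), deriv χ (φ₁ z) ≠ 0 := fun z hz => by
    have ha : HasDerivAt φ₂ (deriv φ₂ z) (ballInverse r d φ₁ (φ₁ z)) := by
      rw [h₁.ballInverse_apply hz]
      exact (h₂.hasStrictDerivAt hz).hasDerivAt
    have hc : HasDerivAt χ _ (φ₁ z) := ha.comp (φ₁ z) (h₁.hasDerivAt_ballInverse hz)
    rw [hc.deriv]
    exact mul_ne_zero (h₂.deriv_ne_zero z hz) (inv_ne_zero (h₁.deriv_ne_zero z hz))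
  have hne : ∀ {φ : ℂ → ℂ} {D : Set ℂ}, IsNearIdentity Ω r d φ D →
      ∀ z ∈ ball (0 : ℂ) (r + 9 * d), z ≠ p → φ z ≠ φ p := fun h z hz hzp heq =>
    hzp (h.injOn hz hΩ.mem_ball heq)
  have hdiff : ∀ {φ : ℂ → ℂ} {D : Set ℂ}, IsNearIdentity Ω r d φ D →
      ∀ z ∈ ball (0 : ℂ) (r + 9 * d), z ∈ Ω → z ≠ p → φ z ∈ D \ {φ p} := fun h z hz hzΩ hzp =>
    ⟨(h.mem_iff z hz).2 hzΩ, hne h z hz hzp⟩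
  have hq : ∀ z ∈ ball (0 : ℂ) (r + 9 * d), z ∈ Ω → z ≠ p →
      HarmonicAt (fun w => g₂ (χ w)) (φ₁ z) := fun z hz hzΩ hzp => by
    refine HarmonicAt.comp_analyticAt ?_ (hχa z hz)
    rw [hχφ z hz]
    exact hg₂.1.harmonic _ (hdiff h₂ z hz hzΩ hzp)
  have hconst : ∀ x : ℂ, HarmonicAt (fun _ => M) x :=
    fun x => harmonicOnNhd_const (s := univ) M x (mem_univ x)
  set V : Set ℂ := φ₁ '' ball 0 (r + 6 * d) with hV
  have hVmem : ∀ z : ℂ, ‖z‖ < r + 6 * d → V ∈ 𝓝 (φ₁ z) := fun z hz =>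
    h₁.image_mem_nhds (hmem z hz.le) (isOpen_ball.mem_nhds (mem_ball_zero_iff.2 hz))
  classical
  -- The competitor for `g₁`. By `hlt` the minimum equals `g₁` near the image of the circle of
  -- radius `r + 6 * d`, so the two definitions fit together there. Nothing is required at the
  -- boundary of the holes.
  set v : ℂ → ℝ := fun w => if w ∈ V then min (g₁ w) (g₂ (χ w) + M) else g₁ w with hv
  have hvV : ∀ w ∈ V, v w = min (g₁ w) (g₂ (χ w) + M) := fun w hw => if_pos hw
  have hvn : ∀ w, w ∉ V → v w = g₁ w := fun w hw => if_neg hw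
  have hg₁s : ∀ x ∈ D₁ \ {φ₁ p}, SubmeanAt (fun w => -g₁ w) x := fun x hx =>
    HarmonicAt.submeanAt (hg₁.1.harmonic x hx).neg
  have hsuper : IsLogSupermean D₁ (φ₁ p) v := by
    refine ⟨?_, ?_, ?_⟩
    · intro x hx
      by_cases hx6 : x ∈ φ₁ '' closedBall 0 (r + 6 * d)
      · obtain ⟨y, hy, rfl⟩ := hx6
        rw [mem_closedBall_zero_iff] at hy
        have hyb := hmem y hy
        have hyΩ : y ∈ Ω := (h₁.mem_iff y hyb).1 hx.1
        have hyp : y ≠ p := fun h => hx.2 (by rw [h]; rfl)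
        have hqy := hq y hyb hyΩ hyp
        rcases hy.lt_or_eq with hy6 | hy6
        · refine ((hg₁s _ hx).sup (HarmonicAt.submeanAt (hqy.add (hconst _)).neg)).congr ?_
          filter_upwards [hVmem y hy6] with w hw
          rw [hvV w hw, ← max_neg_neg]
          rfl
        · refine (hg₁s _ hx).congr ?_
          have hc1 := HarmonicAt.continuousAt (hg₁.1.harmonic _ hx)
          have hc2 := HarmonicAt.continuousAt (hqy.add (hconst _))
          have hlt' : g₁ (φ₁ y) < g₂ (χ (φ₁ y)) + M := by rw [hχφ y hyb]; exact hlt y hy6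
          filter_upwards [hc1.eventually_lt hc2 hlt'] with w hw
          by_cases hwV : w ∈ V
          · rw [hvV w hwV, min_eq_left (le_of_lt (show g₁ w < g₂ (χ w) + M from hw))]
          · rw [hvn w hwV]
      · refine (hg₁s x hx).congr ?_
        have hcl : IsClosed (φ₁ '' closedBall 0 (r + 6 * d)) :=
          ((isCompact_closedBall 0 _).image_of_continuousOn
            (h₁.differentiableOn.continuousOn.mono fun z hz =>
              hmem z (mem_closedBall_zero_iff.1 hz))).isClosed
        filter_upwards [hcl.isOpen_compl.mem_nhds hx6] with w hw
        rw [hvn w fun h => hw (image_mono ball_subset_closedBall h)]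
    · intro x hx
      by_cases hxV : x ∈ V
      · rw [hvV x hxV]
        obtain ⟨y, hy, rfl⟩ := hxV
        have hyb := hmem y (mem_ball_zero_iff.1 hy).le
        have hyΩ : y ∈ Ω := (h₁.mem_iff y hyb).1 hx.1
        have hyp : y ≠ p := fun h => hx.2 (by rw [h]; rfl)
        rw [hχφ y hyb]
        exact le_min (hg₁.1.nonneg _ hx)
          (add_nonneg (hg₂.1.nonneg _ (hdiff h₂ y hyb hyΩ hyp)) hM)
      · rw [hvn x hxV]
        exact hg₁.1.nonneg x hx
    · have hp6 : ‖p‖ < r + 6 * d := by linarith [hΩ.norm_le]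
      have hpb := hΩ.mem_ball
      obtain ⟨k₁, hk₁, hgk₁⟩ := hg₁.1.pole
      -- Both entries of the minimum have the same logarithmic pole, so the regular part of `v` is
      -- the minimum of their regular parts.
      obtain ⟨k₂, hk₂, hgk₂⟩ := logPole_comp (g := g₂) (hχa p hpb) (by
          have hne' : ∀ᶠ w in 𝓝[≠] (φ₁ p), w ∈ φ₁ '' ball 0 (r + 6 * d) :=
            nhdsWithin_le_nhds (hVmem p hp6)
          filter_upwards [hne', self_mem_nhdsWithin] with w hw hwp
          obtain ⟨y, hy, rfl⟩ := hw
          have hyb := hmem y (mem_ball_zero_iff.1 hy).le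
          rw [hχφ y hyb, hχφ p hpb]
          exact hne h₂ y hyb fun h => hwp (by rw [h]; rfl)) (hχd p hpb)
        (by rw [hχφ p hpb]; exact hg₂.1.pole)
      refine ⟨fun z => min (k₁ z) (k₂ z + M),
        ((HarmonicAt.submeanAt hk₁.neg).sup (HarmonicAt.submeanAt
          (hk₂.add (hconst _)).neg)).congr (Eventually.of_forall fun w => ?_), ?_⟩
      · change max (-k₁ w) (-(k₂ w + M)) = -min (k₁ w) (k₂ w + M)
        rw [max_neg_neg]
      · filter_upwards [hgk₁, hgk₂, nhdsWithin_le_nhds (hVmem p hp6)] with w h1 h2 h3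
        rw [hvV w h3, ← h1, ← h2, ← min_add_add_right]
        congr 1
        ring
  have hzb := hmem z hz.le
  have := hg₁.le_of_isLogSupermean h₁.isOpen h₁.subset (h₁.pole_mem hΩ) hsuper (φ₁ z)
    (hdiff h₁ z hzb hzΩ hzp)
  rw [hvV _ (mem_image_of_mem _ (mem_ball_zero_iff.2 hz)), hχφ z hzb] at this
  exact this.trans (min_le_right _ _)

/-- The gluing needs a strict inequality on the circle; adding `ε` to `M` provides it, and then `ε`
tends to zero. -/
theorem IsGreenFunction.le_add (hΩ : IsCollared Ω p r d) (h₁ : IsNearIdentity Ω r d φ₁ D₁)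
    (h₂ : IsNearIdentity Ω r d φ₂ D₂) (hg₁ : IsGreenFunction D₁ (φ₁ p) g₁)
    (hg₂ : IsGreenFunction D₂ (φ₂ p) g₂) {M : ℝ} (hM : 0 ≤ M)
    (hle : ∀ z : ℂ, ‖z‖ = r + 6 * d → g₁ (φ₁ z) ≤ g₂ (φ₂ z) + M) {z : ℂ} (hz : ‖z‖ < r + 6 * d)
    (hzΩ : z ∈ Ω) (hzp : z ≠ p) : g₁ (φ₁ z) ≤ g₂ (φ₂ z) + M := by
  refine le_of_forall_pos_le_add fun ε hε => ?_
  have := hg₁.le_add_of_lt hΩ h₁ h₂ hg₂ (M := M + ε) (by linarith)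
    (fun z hz => by linarith [hle z hz]) hz hzΩ hzp
  linarith

/-- Both functions vanish on the unit circle, so their difference is controlled by its values on the
inner circle and decays towards the outer one. -/
theorem IsGreenFunction.sub_le_annulus (hΩ : IsCollared Ω p r d)
    (h₁ : IsNearIdentity Ω r d φ₁ D₁) (h₂ : IsNearIdentity Ω r d φ₂ D₂)
    (hg₁ : IsGreenFunction D₁ (φ₁ p) g₁) (hg₂ : IsGreenFunction D₂ (φ₂ p) g₂) {m : ℝ}
    (hm : ∀ w : ℂ, ‖w‖ = r + 3 * d → g₁ w - g₂ w ≤ m) {w : ℂ} (hw : r + 3 * d ≤ ‖w‖)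
    (hw1 : ‖w‖ < 1) : g₁ w - g₂ w ≤ m * (Real.log ‖w‖ / Real.log (r + 3 * d)) := by
  have hd := hΩ.d_pos
  have hr := hΩ.r_pos
  have h10 := hΩ.eq_one
  have key := annulus_le (u := fun w => zeroExtend g₁ w + -zeroExtend g₂ w) (σ := r + 3 * d)
    (m := m) (by linarith) (by linarith)
    (fun w hw => ((hg₁.continuousAt_zeroExtend hΩ h₁ (by linarith [hw.1])).add
      (hg₂.continuousAt_zeroExtend hΩ h₂ (by linarith [hw.1])).neg).continuousWithinAt)
    (fun w hw1 hw2 => by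
      refine SubmeanAt.congr ((HarmonicAt.submeanAt (hg₁.1.harmonic w
        (h₁.mem_diff hΩ (by linarith) hw2))).add (HarmonicAt.submeanAt (hg₂.1.harmonic w
        (h₂.mem_diff hΩ (by linarith) hw2)).neg)) ?_
      filter_upwards [zeroExtend_eventuallyEq (g := g₁) hw2,
        zeroExtend_eventuallyEq (g := g₂) hw2] with z h1 h2
      rw [h1, h2]
      rfl)
    (fun w hw => by
      have : ‖w‖ < 1 := by linarith
      rw [zeroExtend, zeroExtend, if_pos this, if_pos this]
      linarith [hm w hw])
    (fun w hw => by simp [zeroExtend, hw]) w hw hw1.le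
  rw [zeroExtend, zeroExtend, if_pos hw1, if_pos hw1] at key
  linarith

/-- The Green functions depend on the maps in a Lipschitz way. -/
theorem exists_green_lipschitz (hΩ : IsCollared Ω p r d) :
    ∃ C : ℝ, 0 ≤ C ∧ ∀ (φ₁ φ₂ : ℂ → ℂ) (D₁ D₂ : Set ℂ) (g₁ g₂ : ℂ → ℝ),
      IsNearIdentity Ω r d φ₁ D₁ → IsNearIdentity Ω r d φ₂ D₂ →
      IsGreenFunction D₁ (φ₁ p) g₁ → IsGreenFunction D₂ (φ₂ p) g₂ →
      ∀ δ : ℝ, (∀ z ∈ ball (0 : ℂ) (r + 9 * d), ‖φ₁ z - φ₂ z‖ ≤ δ) →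
        ∀ w : ℂ, r + 3 * d ≤ ‖w‖ → ‖w‖ < 1 → |g₁ w - g₂ w| ≤ C * δ := by
  have hd := hΩ.d_pos
  have hr := hΩ.r_pos
  have h10 := hΩ.eq_one
  -- The maps move points by at most `d`, so poles and holes stay in the disc of radius `r + d`. The
  -- circle of radius `r + 3 * d` carries the maximum `m`, and the transplanted comparison takes
  -- place inside radius `r + 6 * d`. The gap between these two radii produces `q < 1`.
  set σ := r + 3 * d with hσ
  have hlogσ : Real.log σ < 0 := Real.log_neg (by linarith) (by linarith)
  set q := Real.log (r + 6 * d) / Real.log σ with hq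
  have hlog6 : Real.log σ < Real.log (r + 6 * d) := Real.log_lt_log (by linarith) (by linarith)
  have hq1 : q < 1 := by
    rw [hq, div_lt_one_of_neg hlogσ]
    exact hlog6
  set L := 8 / d * greenBound d with hL
  have hL0 : 0 ≤ L := mul_nonneg (by positivity) hΩ.greenBound_nonneg
  refine ⟨2 * L / (1 - q), div_nonneg (by linarith) (by linarith), ?_⟩
  intro φ₁ φ₂ D₁ D₂ g₁ g₂ h₁ h₂ hg₁ hg₂ δ hδ
  have hδ0 : 0 ≤ δ := (norm_nonneg _).trans (hδ p hΩ.mem_ball)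
  have hcont : ContinuousOn (fun w => |g₁ w - g₂ w|) (sphere 0 σ) := fun w hw => by
    rw [mem_sphere_zero_iff_norm] at hw
    exact (((HarmonicAt.continuousAt (hg₁.1.harmonic w (h₁.mem_diff hΩ (by linarith)
      (by linarith)))).sub (HarmonicAt.continuousAt (hg₂.1.harmonic w (h₂.mem_diff hΩ (by linarith)
      (by linarith))))).abs).continuousWithinAt
  obtain ⟨w₀, hw₀, hmax⟩ := (isCompact_sphere (0 : ℂ) σ).exists_isMaxOn
    (NormedSpace.sphere_nonempty.2 (by linarith)) hcont
  set m := |g₁ w₀ - g₂ w₀| with hm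
  have hm0 : 0 ≤ m := abs_nonneg _
  have hmle : ∀ w : ℂ, ‖w‖ = σ → |g₁ w - g₂ w| ≤ m := fun w hw =>
    hmax (mem_sphere_zero_iff_norm.2 hw)
  -- one step of the alternating procedure
  have step : ∀ (φ₁ φ₂ : ℂ → ℂ) (D₁ D₂ : Set ℂ) (g₁ g₂ : ℂ → ℝ),
      IsNearIdentity Ω r d φ₁ D₁ → IsNearIdentity Ω r d φ₂ D₂ →
      IsGreenFunction D₁ (φ₁ p) g₁ → IsGreenFunction D₂ (φ₂ p) g₂ →
      (∀ z ∈ ball (0 : ℂ) (r + 9 * d), ‖φ₁ z - φ₂ z‖ ≤ δ) →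
      (∀ w : ℂ, ‖w‖ = σ → |g₁ w - g₂ w| ≤ m) →
      ∀ w : ℂ, ‖w‖ = σ → g₁ w - g₂ w ≤ q * m + 2 * L * δ := by
    intro φ₁ φ₂ D₁ D₂ g₁ g₂ h₁ h₂ hg₁ hg₂ hδ hmle w hw
    have hshift : ∀ z ∈ ball (0 : ℂ) (r + 9 * d), r + 2 * d ≤ ‖φ₁ z‖ → ‖φ₁ z‖ ≤ r + 9 * d →
        r + 2 * d ≤ ‖φ₂ z‖ → ‖φ₂ z‖ ≤ r + 9 * d → |g₂ (φ₁ z) - g₂ (φ₂ z)| ≤ L * δ := by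
      intro z hz ha hb hc he
      exact (hg₂.abs_sub_le hΩ h₂ hc he ha hb).trans (mul_le_mul_of_nonneg_left (hδ z hz) hL0)
    have hup : ∀ {φ : ℂ → ℂ} {D : Set ℂ}, IsNearIdentity Ω r d φ D →
        ∀ z ∈ ball (0 : ℂ) (r + 9 * d), ‖φ z‖ ≤ ‖z‖ + d := by
      intro φ D h z hz
      have := norm_add_le (φ z - z) z
      rw [sub_add_cancel] at this
      linarith [h.norm_sub_le z hz]
    -- The logarithmic decay gives the factor `q`, since `r + 6 * d ≤ ‖φ₁ z‖`; moving the argument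
    -- of `g₂` from `φ₁ z` to `φ₂ z` costs `L * δ`.
    have hsph : ∀ z : ℂ, ‖z‖ = r + 6 * d → g₁ (φ₁ z) ≤ g₂ (φ₂ z) + (q * m + L * δ) := by
      intro z hz
      have hzb : z ∈ ball (0 : ℂ) (r + 9 * d) := by rw [mem_ball_zero_iff]; linarith
      have hn1 := h₁.norm_le z hzb
      have hn2 := h₂.norm_le z hzb
      have hu1 := hup h₁ z hzb
      have hu2 := hup h₂ z hzb
      have ha := hshift z hzb (by linarith) (by linarith) (by linarith) (by linarith)
      have hb := hg₁.sub_le_annulus hΩ h₁ h₂ hg₂ (m := m)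
        (fun w hw => (le_abs_self _).trans (hmle w hw)) (w := φ₁ z) (by linarith) (by linarith)
      have hc : m * (Real.log ‖φ₁ z‖ / Real.log σ) ≤ q * m := by
        rw [mul_comm]
        refine mul_le_mul_of_nonneg_right ?_ hm0
        refine div_le_div_of_nonpos_of_le hlogσ.le (Real.log_le_log (by linarith) (by linarith))
      linarith [(abs_le.1 ha).2]
    -- The preimage of the circle of radius `σ` lies in `Ω`, inside radius `r + 6 * d` and away from
    -- `p`, so the bound on the larger circle reaches it.
    obtain ⟨z, hzb, rfl⟩ := h₁.surj w (by linarith)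
    have hn1 := h₁.norm_le z hzb
    have hn2 := h₂.norm_le z hzb
    have hu1 := hup h₁ z hzb
    have hu2 := hup h₂ z hzb
    have hzp : z ≠ p := by rintro rfl; linarith [hΩ.norm_le]
    have hq0 : 0 ≤ q := div_nonneg_of_nonpos (Real.log_nonpos (by linarith) (by linarith)) hlogσ.le
    have ha := hg₁.le_add hΩ h₁ h₂ hg₂ (M := q * m + L * δ) (by positivity) hsph (z := z)
      (by linarith) (hΩ.annulus z (by linarith) (by linarith)) hzp
    have hb := hshift z hzb (by linarith) (by linarith) (by linarith) (by linarith)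
    linarith [(abs_le.1 hb).1]
  have hmle' : m ≤ q * m + 2 * L * δ := by
    have hw₀' := mem_sphere_zero_iff_norm.1 hw₀
    refine abs_le.2 ⟨?_, step φ₁ φ₂ D₁ D₂ g₁ g₂ h₁ h₂ hg₁ hg₂ hδ hmle w₀ hw₀'⟩
    have := step φ₂ φ₁ D₂ D₁ g₂ g₁ h₂ h₁ hg₂ hg₁
      (fun z hz => by rw [norm_sub_rev]; exact hδ z hz)
      (fun w hw => by rw [abs_sub_comm]; exact hmle w hw) w₀ hw₀'
    linarith
  -- The maximum `m` is finite and `q < 1`, so one step suffices: the term `q * m` is absorbed.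
  have hm' : m ≤ 2 * L / (1 - q) * δ := by
    rw [div_mul_eq_mul_div, le_div_iff₀ (by linarith)]
    linarith
  intro w hw hw1
  have hratio : m * (Real.log ‖w‖ / Real.log σ) ≤ m := by
    refine mul_le_of_le_one_right hm0 ?_
    rw [div_le_one_of_neg hlogσ]
    exact Real.log_le_log (by linarith) hw
  have ha := hg₁.sub_le_annulus hΩ h₁ h₂ hg₂ (m := m)
    (fun w hw => (le_abs_self _).trans (hmle w hw)) hw hw1
  have hb := hg₂.sub_le_annulus hΩ h₂ h₁ hg₁ (m := m)
    (fun w hw => (le_abs_self _).trans (by rw [abs_sub_comm]; exact hmle w hw)) hw hw1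
  rw [abs_le]
  constructor <;> linarith

end

/-! ### Normal derivatives of harmonic functions -/

/-- For `w` within `R / 2` of the centre the Herglotz kernel has modulus at most `3`. -/
theorem norm_herglotzIntegral_le {u : ℂ → ℝ} {c w : ℂ} {R B : ℝ} (hR : 0 < R)
    (hB : ∀ z ∈ sphere c R, |u z| ≤ B) (hw : w ∈ closedBall c (R / 2)) :
    ‖herglotzIntegral u c R w‖ ≤ 3 * B := by
  have h2pi : (0 : ℝ) < 2 * π := by positivity
  rw [mem_closedBall, dist_eq_norm] at hw
  have hpt : ∀ θ : ℝ, ‖herglotzRieszKernel 0 (w - c) (circleMap 0 R θ) •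
      ((u (circleMap 0 R θ + c) : ℝ) : ℂ)‖ ≤ 3 * B := by
    intro θ
    have h1 : ‖circleMap 0 R θ‖ = R := by simp [abs_of_pos hR]
    have h2 : R / 2 ≤ ‖circleMap 0 R θ - (w - c)‖ := by
      have := norm_sub_norm_le (circleMap 0 R θ) (w - c)
      linarith
    have h3 : ‖circleMap 0 R θ + (w - c)‖ ≤ 3 * ‖circleMap 0 R θ - (w - c)‖ := by
      have := norm_add_le (circleMap 0 R θ) (w - c)
      linarith
    rw [norm_smul, herglotzRieszKernel, sub_zero, sub_zero, norm_div, Complex.norm_real]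
    refine mul_le_mul ?_ (hB _ ?_) (norm_nonneg _) (by norm_num)
    · rwa [div_le_iff₀ (by linarith)]
    · rw [mem_sphere, dist_eq_norm, add_sub_cancel_right, h1]
  rw [herglotzIntegral, circleAverage_def, norm_smul, norm_inv, Real.norm_of_nonneg h2pi.le,
    inv_mul_le_iff₀ h2pi]
  have := intervalIntegral.norm_integral_le_of_norm_le_const (a := 0) (b := 2 * π)
    (fun θ _ => hpt θ)
  rw [sub_zero, abs_of_pos h2pi] at this
  linarith

theorem herglotzIntegral_sub {u v : ℂ → ℝ} {c w : ℂ} {R : ℝ} (hu : CircleIntegrable u c R)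
    (hv : CircleIntegrable v c R) (hw : w ∈ ball c R) :
    herglotzIntegral (fun z => u z - v z) c R w =
      herglotzIntegral u c R w - herglotzIntegral v c R w := by
  have hR := pos_of_mem_ball hw
  have hw' : w - c ∈ ball 0 R := by simpa [dist_eq_norm] using hw
  have hk : ContinuousOn (herglotzRieszKernel 0 (w - c)) (sphere 0 |R|) := by
    rw [abs_of_pos hR]
    unfold herglotzRieszKernel
    refine ContinuousOn.div (by fun_prop) (by fun_prop) fun z hz h => ?_
    rw [mem_sphere_zero_iff_norm] at hz
    rw [mem_ball_zero_iff] at hw'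
    simp only [sub_zero, sub_eq_zero] at h
    rw [h] at hz
    linarith
  have hi : ∀ {u : ℂ → ℝ}, CircleIntegrable u c R → CircleIntegrable
      (fun ζ => herglotzRieszKernel 0 (w - c) ζ • ((u (ζ + c) : ℝ) : ℂ)) 0 R := fun hu =>
    (circleIntegrable_ofReal (circleIntegrable_add_const hu)).continuousOn_smul hk
  rw [herglotzIntegral, herglotzIntegral, herglotzIntegral, ← circleAverage_fun_sub (hi hu) (hi hv)]
  congr 1
  ext z
  push_cast
  rw [smul_sub]

theorem norm_deriv_le_of_closedBall {F : ℂ → ℂ} {c : ℂ} {s t A : ℝ} (ht : 0 < t)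
    (hF : AnalyticOnNhd ℂ F (closedBall c (s + t))) (hA : ∀ z ∈ closedBall c (s + t), ‖F z‖ ≤ A) :
    ∀ z ∈ closedBall c s, ‖deriv F z‖ ≤ A / t := by
  intro z hz
  have hsub : closedBall z t ⊆ closedBall c (s + t) := closedBall_subset_closedBall' (by
    rw [mem_closedBall] at hz
    linarith)
  refine Complex.norm_deriv_le_of_forall_mem_sphere_norm_le ht (DifferentiableOn.diffContOnCl ?_)
    fun y hy => hA y (hsub (sphere_subset_closedBall hy))
  rw [closure_ball z ht.ne']
  exact hF.differentiableOn.mono hsub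

section

variable {x₀ : ℝ} {ρ : ℝ} {u : ℂ → ℝ}

theorem eventuallyEq_re_herglotzIntegral {c w : ℂ} (hu : HarmonicOnNhd u (closedBall c ρ))
    (hw : w ∈ ball c ρ) : u =ᶠ[𝓝 w] fun z => (herglotzIntegral u c ρ z).re := by
  filter_upwards [isOpen_ball.mem_nhds hw] with z hz
  have hρ := pos_of_mem_ball hw
  have huc : ContinuousOn u (sphere c ρ) :=
    fun z hz => (HarmonicAt.continuousAt (hu z (sphere_subset_closedBall hz))).continuousWithinAt
  rw [re_herglotzIntegral (huc.circleIntegrable hρ.le) hz]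
  exact (HarmonicOnNhd.circleAverage_poissonKernel_smul hu hz).symm

theorem circleIntegrable_of_harmonicOnNhd {c : ℂ} (hρ : 0 ≤ ρ)
    (hu : HarmonicOnNhd u (closedBall c ρ)) : CircleIntegrable u c ρ :=
  ContinuousOn.circleIntegrable hρ fun z hz =>
    (HarmonicAt.continuousAt (hu z (sphere_subset_closedBall hz))).continuousWithinAt

/-- Near `x` the function is `Re F` with `F` its Herglotz integral, and the derivative of `F` in the
direction `i` is `i * F'`. -/
theorem hasDerivAt_normal (hu : HarmonicOnNhd u (closedBall (x₀ : ℂ) ρ)) {x : ℝ}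
    (hx : (x : ℂ) ∈ ball (x₀ : ℂ) ρ) :
    HasDerivAt (fun y : ℝ => u ((x : ℂ) + y * Complex.I))
      (-(deriv (herglotzIntegral u x₀ ρ) x).im) 0 := by
  have hρ := pos_of_mem_ball hx
  have hF := (analyticOnNhd_herglotzIntegral (circleIntegrable_of_harmonicOnNhd hρ.le hu) x
    hx).differentiableAt.hasDerivAt
  have hline : HasDerivAt (fun y : ℝ => (x : ℂ) + y * Complex.I) Complex.I 0 := by
    simpa using ((Complex.ofRealCLM.hasDerivAt (x := (0 : ℝ))).mul_const Complex.I).const_add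
      (x : ℂ)
  have h0 : (x : ℂ) + ((0 : ℝ) : ℂ) * Complex.I = x := by simp
  have hcomp := HasDerivAt.comp_of_eq (0 : ℝ) hF hline h0.symm
  have hre := (Complex.reCLM.hasFDerivAt (x := herglotzIntegral u x₀ ρ x)).comp_hasDerivAt_of_eq
    (0 : ℝ) hcomp (by simp)
  have hval : Complex.reCLM (deriv (herglotzIntegral u x₀ ρ) x * Complex.I) =
      -(deriv (herglotzIntegral u x₀ ρ) x).im := by simp
  rw [hval] at hre
  refine hre.congr_of_eventuallyEq ?_
  have ht : Tendsto (fun y : ℝ => (x : ℂ) + y * Complex.I) (𝓝 0) (𝓝 (x : ℂ)) := by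
    have := hline.continuousAt
    rwa [ContinuousAt, h0] at this
  filter_upwards [ht.eventually (eventuallyEq_re_herglotzIntegral hu hx)] with y hy
  exact hy

theorem normalDeriv_eq (hu : HarmonicOnNhd u (closedBall (x₀ : ℂ) ρ)) {x : ℝ}
    (hx : (x : ℂ) ∈ ball (x₀ : ℂ) ρ) :
    normalDeriv u x = -(deriv (herglotzIntegral u x₀ ρ) x).im :=
  (hasDerivAt_normal hu hx).deriv

theorem deriv_normalDeriv_eq (hu : HarmonicOnNhd u (closedBall (x₀ : ℂ) ρ)) {x : ℝ}
    (hx : (x : ℂ) ∈ ball (x₀ : ℂ) ρ) :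
    deriv (normalDeriv u) x = -(deriv (deriv (herglotzIntegral u x₀ ρ)) x).im := by
  have hρ := pos_of_mem_ball hx
  have hF := (analyticOnNhd_herglotzIntegral (circleIntegrable_of_harmonicOnNhd hρ.le hu) x
    hx).deriv.differentiableAt.hasDerivAt.comp_ofReal
  have him := (Complex.imCLM.hasFDerivAt (x := deriv (herglotzIntegral u x₀ ρ) x)).comp_hasDerivAt
    x hF
  refine HasDerivAt.deriv (f' := -(deriv (deriv (herglotzIntegral u x₀ ρ)) x).im)
    (him.neg.congr_of_eventuallyEq ?_)
  have : ∀ᶠ y : ℝ in 𝓝 x, (y : ℂ) ∈ ball (x₀ : ℂ) ρ :=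
    Complex.continuous_ofReal.continuousAt.eventually (isOpen_ball.mem_nhds hx)
  filter_upwards [this] with y hy
  exact normalDeriv_eq hu hy

/-- The normal derivative of a harmonic function and its tangential derivative depend on the
function and on the point in a Lipschitz way. -/
theorem exists_normalDeriv_lipschitz (x₀ : ℝ) (hρ : 0 < ρ) :
    ∃ K : ℝ, 0 ≤ K ∧ ∀ (u₁ u₂ : ℂ → ℝ) (B δ : ℝ), HarmonicOnNhd u₁ (closedBall (x₀ : ℂ) ρ) →
      HarmonicOnNhd u₂ (closedBall (x₀ : ℂ) ρ) →
      (∀ z ∈ closedBall (x₀ : ℂ) ρ, |u₂ z| ≤ B) →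
      (∀ z ∈ closedBall (x₀ : ℂ) ρ, |u₁ z - u₂ z| ≤ δ) →
      ∀ x₁ x₂ : ℝ, |x₁ - x₀| ≤ ρ / 8 → |x₂ - x₀| ≤ ρ / 8 →
        |deriv (normalDeriv u₂) x₂| ≤ K * B ∧
        |normalDeriv u₁ x₁ - normalDeriv u₂ x₂| ≤ K * (δ + B * |x₁ - x₂|) ∧
        |deriv (normalDeriv u₁) x₁ - deriv (normalDeriv u₂) x₂| ≤ K * (δ + B * |x₁ - x₂|) := by
  -- Three Cauchy estimates are applied in turn, on radii `4 * t = ρ / 2`, `3 * t` and `2 * t`, each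
  -- losing `t`. The third derivative is needed for the Lipschitz bound on the second.
  set t := ρ / 8 with ht
  have ht0 : 0 < t := by positivity
  set K₁ := 3 / t
  set K₂ := 3 / t / t
  set K₃ := 3 / t / t / t
  have hK₁ : 0 ≤ K₁ := by positivity
  have hK₂ : 0 ≤ K₂ := by positivity
  have hK₃ : 0 ≤ K₃ := by positivity
  -- derivative bounds for the Herglotz integral
  have hbd : ∀ (u : ℂ → ℝ) (B : ℝ), HarmonicOnNhd u (closedBall (x₀ : ℂ) ρ) →
      (∀ z ∈ closedBall (x₀ : ℂ) ρ, |u z| ≤ B) →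
      (∀ z ∈ closedBall (x₀ : ℂ) t, ‖deriv (herglotzIntegral u x₀ ρ) z‖ ≤ K₁ * B) ∧
      (∀ z ∈ closedBall (x₀ : ℂ) t, ‖deriv (deriv (herglotzIntegral u x₀ ρ)) z‖ ≤ K₂ * B) ∧
      (∀ z ∈ closedBall (x₀ : ℂ) t,
        ‖deriv (deriv (deriv (herglotzIntegral u x₀ ρ))) z‖ ≤ K₃ * B) := by
    intro u B hu hB
    have hF := analyticOnNhd_herglotzIntegral (circleIntegrable_of_harmonicOnNhd hρ.le hu)
    have hsub : ∀ s, s ≤ ρ / 2 → closedBall (x₀ : ℂ) s ⊆ ball (x₀ : ℂ) ρ := fun s hs =>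
      closedBall_subset_ball (by linarith)
    have h0 : ∀ z ∈ closedBall (x₀ : ℂ) (3 * t + t), ‖herglotzIntegral u x₀ ρ z‖ ≤ 3 * B :=
      fun z hz => norm_herglotzIntegral_le hρ (fun z hz => hB z (sphere_subset_closedBall hz))
        (closedBall_subset_closedBall (by linarith) hz)
    have h1 := norm_deriv_le_of_closedBall ht0 (hF.mono (hsub _ (by linarith))) h0
    have h2 := norm_deriv_le_of_closedBall (s := 2 * t) ht0 (hF.deriv.mono (hsub _ (by linarith)))
      (fun z hz => h1 z (closedBall_subset_closedBall (by linarith) hz))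
    have h3 := norm_deriv_le_of_closedBall (s := t) ht0
      (hF.deriv.deriv.mono (hsub _ (by linarith)))
      (fun z hz => h2 z (closedBall_subset_closedBall (by linarith) hz))
    refine ⟨fun z hz => (h1 z (closedBall_subset_closedBall (by linarith) hz)).trans_eq ?_,
      fun z hz => (h2 z (closedBall_subset_closedBall (by linarith) hz)).trans_eq ?_,
      fun z hz => (h3 z hz).trans_eq ?_⟩
    · simp only [K₁]; ring
    · simp only [K₂]; ring
    · simp only [K₃]; ring
  refine ⟨K₁ + K₂ + K₃, by positivity, ?_⟩
  intro u₁ u₂ B δ hu₁ hu₂ hB hδ x₁ x₂ hx₁ hx₂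
  have hx₀ : (x₀ : ℂ) ∈ closedBall (x₀ : ℂ) ρ := mem_closedBall_self hρ.le
  have hB0 : 0 ≤ B := (abs_nonneg _).trans (hB _ hx₀)
  have hδ0 : 0 ≤ δ := (abs_nonneg _).trans (hδ _ hx₀)
  have hmem : ∀ {x : ℝ}, |x - x₀| ≤ t → (x : ℂ) ∈ closedBall (x₀ : ℂ) t := fun hx => by
    rwa [mem_closedBall, dist_eq_norm, ← Complex.ofReal_sub, Complex.norm_real]
  have hsub : closedBall (x₀ : ℂ) t ⊆ ball (x₀ : ℂ) ρ := closedBall_subset_ball (by linarith)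
  have hb₁ := hsub (hmem hx₁)
  have hb₂ := hsub (hmem hx₂)
  have hi₁ := circleIntegrable_of_harmonicOnNhd hρ.le hu₁
  have hi₂ := circleIntegrable_of_harmonicOnNhd hρ.le hu₂
  have hF₁ := analyticOnNhd_herglotzIntegral hi₁
  have hF₂ := analyticOnNhd_herglotzIntegral hi₂
  obtain ⟨hd1, hd2, -⟩ := hbd (fun z => u₁ z - u₂ z) δ (hu₁.sub hu₂) hδ
  obtain ⟨-, he2, he3⟩ := hbd u₂ B hu₂ hB
  have heq : ∀ z ∈ ball (x₀ : ℂ) ρ, herglotzIntegral (fun z => u₁ z - u₂ z) x₀ ρ =ᶠ[𝓝 z]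
      fun z => herglotzIntegral u₁ x₀ ρ z - herglotzIntegral u₂ x₀ ρ z := fun z hz => by
    filter_upwards [isOpen_ball.mem_nhds hz] with w hw using herglotzIntegral_sub hi₁ hi₂ hw
  have heq1 : ∀ z ∈ ball (x₀ : ℂ) ρ, deriv (herglotzIntegral (fun z => u₁ z - u₂ z) x₀ ρ) z =
      deriv (herglotzIntegral u₁ x₀ ρ) z - deriv (herglotzIntegral u₂ x₀ ρ) z := fun z hz => by
    rw [(heq z hz).deriv_eq]
    exact deriv_fun_sub (hF₁ z hz).differentiableAt (hF₂ z hz).differentiableAt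
  have heq2 : ∀ z ∈ ball (x₀ : ℂ) ρ,
      deriv (deriv (herglotzIntegral (fun z => u₁ z - u₂ z) x₀ ρ)) z =
      deriv (deriv (herglotzIntegral u₁ x₀ ρ)) z -
        deriv (deriv (herglotzIntegral u₂ x₀ ρ)) z := fun z hz => by
    have : deriv (herglotzIntegral (fun z => u₁ z - u₂ z) x₀ ρ) =ᶠ[𝓝 z]
        fun z => deriv (herglotzIntegral u₁ x₀ ρ) z - deriv (herglotzIntegral u₂ x₀ ρ) z := by
      filter_upwards [isOpen_ball.mem_nhds hz] with w hw using heq1 w hw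
    rw [this.deriv_eq]
    exact deriv_fun_sub (hF₁ z hz).deriv.differentiableAt (hF₂ z hz).deriv.differentiableAt
  have hx12 : ‖(x₁ : ℂ) - x₂‖ = |x₁ - x₂| := by
    rw [← Complex.ofReal_sub, Complex.norm_real, Real.norm_eq_abs]
  have hl1 : ‖deriv (herglotzIntegral u₂ x₀ ρ) x₁ - deriv (herglotzIntegral u₂ x₀ ρ) x₂‖ ≤
      K₂ * B * |x₁ - x₂| := by
    rw [← hx12]
    exact (convex_closedBall (x₀ : ℂ) t).norm_image_sub_le_of_norm_deriv_le
      (fun z hz => (hF₂ z (hsub hz)).deriv.differentiableAt) he2 (hmem hx₂) (hmem hx₁)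
  have hl2 : ‖deriv (deriv (herglotzIntegral u₂ x₀ ρ)) x₁ -
      deriv (deriv (herglotzIntegral u₂ x₀ ρ)) x₂‖ ≤ K₃ * B * |x₁ - x₂| := by
    rw [← hx12]
    exact (convex_closedBall (x₀ : ℂ) t).norm_image_sub_le_of_norm_deriv_le
      (fun z hz => (hF₂ z (hsub hz)).deriv.deriv.differentiableAt) he3 (hmem hx₂) (hmem hx₁)
  have hm1 := hd1 x₁ (hmem hx₁)
  have hm2 := hd2 x₁ (hmem hx₁)
  rw [heq1 x₁ hb₁] at hm1
  rw [heq2 x₁ hb₁] at hm2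
  rw [normalDeriv_eq hu₁ hb₁, normalDeriv_eq hu₂ hb₂, deriv_normalDeriv_eq hu₁ hb₁,
    deriv_normalDeriv_eq hu₂ hb₂]
  have him : ∀ a b c : ℂ, |-a.im - -c.im| ≤ ‖a - b‖ + ‖b - c‖ := by
    intro a b c
    have : -a.im - -c.im = -((a - b) + (b - c)).im := by simp; ring
    rw [this, abs_neg]
    exact (Complex.abs_im_le_norm _).trans (norm_add_le _ _)
  have hBx : 0 ≤ B * |x₁ - x₂| := by positivity
  refine ⟨?_, (him _ _ _).trans ((add_le_add hm1 hl1).trans ?_),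
    (him _ _ _).trans ((add_le_add hm2 hl2).trans ?_)⟩
  · rw [abs_neg]
    refine (Complex.abs_im_le_norm _).trans ((he2 x₂ (hmem hx₂)).trans ?_)
    nlinarith [mul_nonneg hK₁ hB0, mul_nonneg hK₃ hB0]
  · nlinarith [mul_nonneg hK₂ hδ0, mul_nonneg hK₃ hδ0, mul_nonneg hK₁ hBx, mul_nonneg hK₃ hBx]
  · nlinarith [mul_nonneg hK₁ hδ0, mul_nonneg hK₃ hδ0, mul_nonneg hK₁ hBx, mul_nonneg hK₂ hBx]

end

/-! ### Reflection across the real line -/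

/-- If `u` is locally `Re F`, then `u ∘ conj` is locally the real part of the holomorphic function
`conj ∘ F ∘ conj`. -/
theorem HarmonicAt.comp_conj {u : ℂ → ℝ} {z : ℂ} (hu : HarmonicAt u ((starRingEnd ℂ) z)) :
    HarmonicAt (fun w => u ((starRingEnd ℂ) w)) z := by
  obtain ⟨ε, hε, hb⟩ := Metric.isOpen_iff.1 (isOpen_setOfPred_harmonicAt (f := u)) _ hu
  obtain ⟨F, hF, hFu⟩ := InnerProductSpace.HarmonicOnNhd.exists_analyticOnNhd_ball_re_eq
    (f := u) (fun y hy => hb hy)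
  have hd : DifferentiableOn ℂ ((starRingEnd ℂ) ∘ F ∘ (starRingEnd ℂ)) (ball z ε) := by
    intro w hw
    have hw' : (starRingEnd ℂ) w ∈ ball ((starRingEnd ℂ) z) ε := by
      rwa [mem_ball, Complex.dist_conj_conj]
    have := (hF _ hw').differentiableAt.conj_conj
    rw [Complex.conj_conj] at this
    exact this.differentiableWithinAt
  have ha := (hd.analyticAt (isOpen_ball.mem_nhds (mem_ball_self hε))).harmonicAt_re
  refine (harmonicAt_congr_nhds ?_).1 ha
  filter_upwards [isOpen_ball.mem_nhds (mem_ball_self hε)] with w hw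
  have hw' : (starRingEnd ℂ) w ∈ ball ((starRingEnd ℂ) z) ε := by
    rwa [mem_ball, Complex.dist_conj_conj]
  have := hFu hw'
  simpa using this

/-- For a real centre, conjugation reverses the angle on the circle; periodicity restores the
interval of integration. -/
theorem circleAverage_comp_conj (u : ℂ → ℝ) (x r : ℝ) :
    circleAverage (fun z => u ((starRingEnd ℂ) z)) x r = circleAverage u x r := by
  have h1 : ∀ θ : ℝ, (starRingEnd ℂ) (circleMap x r θ) = circleMap x r (-θ) := by
    intro θ
    simp [circleMap, ← Complex.exp_conj]
  have hper : Function.Periodic (fun θ : ℝ => u (circleMap x r θ)) (2 * π) := fun θ => by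
    simp only [periodic_circleMap (x : ℂ) r θ]
  rw [circleAverage_def, circleAverage_def]
  simp only [h1]
  rw [intervalIntegral.integral_comp_neg (fun θ => u (circleMap x r θ))]
  have := hper.intervalIntegral_add_eq (-(2 * π)) 0
  simp only [neg_add_cancel, zero_add] at this
  rw [neg_zero, this]

/-- The function `g` lifted by `z ↦ e^{iz}` and extended by Schwarz reflection. -/
noncomputable def stripLift (g : ℂ → ℝ) (z : ℂ) : ℝ :=
  if 0 < z.im then g (Complex.exp (Complex.I * z))
  else if z.im = 0 then 0
  else - g (Complex.exp (Complex.I * (starRingEnd ℂ) z))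

theorem norm_exp_I_mul (z : ℂ) : ‖Complex.exp (Complex.I * z)‖ = Real.exp (-z.im) := by
  rw [Complex.norm_exp]
  simp

/-- At most one of the two terms is nonzero. Written this way, the continuity of `zeroExtend` gives
continuity across the real line. -/
theorem stripLift_eq (g : ℂ → ℝ) (z : ℂ) : stripLift g z =
    zeroExtend g (Complex.exp (Complex.I * z)) -
      zeroExtend g (Complex.exp (Complex.I * (starRingEnd ℂ) z)) := by
  simp only [stripLift, zeroExtend, norm_exp_I_mul, Complex.conj_im, neg_neg, Real.exp_lt_one_iff]
  rcases lt_trichotomy z.im 0 with h | h | h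
  · simp [h, h.not_gt, h.ne]
  · simp [h]
  · simp [h, h.not_gt]

section

variable {Ω : Set ℂ} {p : ℂ} {r d : ℝ} {φ : ℂ → ℂ} {D : Set ℂ} {g : ℂ → ℝ}

/-- Half the width of the strip on which the lifted Green functions are harmonic. -/
noncomputable def stripWidth (r d : ℝ) : ℝ := -Real.log (r + 3 * d)

theorem IsCollared.stripWidth_pos (hΩ : IsCollared Ω p r d) : 0 < stripWidth r d := by
  have := hΩ.r_pos
  have := hΩ.d_pos
  have := hΩ.eq_one
  exact neg_pos.2 (Real.log_neg (by linarith) (by linarith))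

theorem IsCollared.lt_exp (hΩ : IsCollared Ω p r d) {y : ℝ} (hy : y < stripWidth r d) :
    r + 3 * d < Real.exp (-y) := by
  have := hΩ.r_pos
  have := hΩ.d_pos
  rw [← Real.log_lt_iff_lt_exp (by linarith)]
  unfold stripWidth at hy
  linarith

theorem IsCollared.lt_norm_exp (hΩ : IsCollared Ω p r d) {z : ℂ} (hz : |z.im| < stripWidth r d) :
    r + 3 * d < ‖Complex.exp (Complex.I * z)‖ := by
  rw [norm_exp_I_mul]
  exact hΩ.lt_exp (abs_lt.1 hz).2

theorem continuousAt_stripLift (hΩ : IsCollared Ω p r d) (h : IsNearIdentity Ω r d φ D)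
    (hg : IsGreenFunction D (φ p) g) {z : ℂ} (hz : |z.im| < stripWidth r d) :
    ContinuousAt (stripLift g) z := by
  have hd := hΩ.d_pos
  have h1 := hΩ.lt_norm_exp hz
  have h2 := hΩ.lt_norm_exp (z := (starRingEnd ℂ) z) (by simpa using hz)
  have hfun : stripLift g = fun z => zeroExtend g (Complex.exp (Complex.I * z)) -
      zeroExtend g (Complex.exp (Complex.I * (starRingEnd ℂ) z)) := funext (stripLift_eq g)
  rw [hfun]
  refine ContinuousAt.sub ?_ ?_
  · exact ContinuousAt.comp (f := fun z => Complex.exp (Complex.I * z))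
      (hg.continuousAt_zeroExtend hΩ h (by linarith)) (by fun_prop)
  · exact ContinuousAt.comp (f := fun z => Complex.exp (Complex.I * (starRingEnd ℂ) z))
      (hg.continuousAt_zeroExtend hΩ h (by linarith))
      (by
        have := Complex.continuous_conj
        fun_prop)

theorem stripLift_conj (g : ℂ → ℝ) (z : ℂ) :
    stripLift g ((starRingEnd ℂ) z) = -stripLift g z := by
  rw [stripLift_eq, stripLift_eq, Complex.conj_conj]
  ring

theorem harmonicAt_stripLift_of_pos (hΩ : IsCollared Ω p r d) (h : IsNearIdentity Ω r d φ D)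
    (hg : IsGreenFunction D (φ p) g) {z : ℂ} (hz : |z.im| < stripWidth r d) (hz0 : 0 < z.im) :
    HarmonicAt (stripLift g) z := by
  have hd := hΩ.d_pos
  have hmem : Complex.exp (Complex.I * z) ∈ D \ {φ p} :=
    h.mem_diff hΩ (by linarith [hΩ.lt_norm_exp hz]) (by
      rw [norm_exp_I_mul, Real.exp_lt_one_iff]
      linarith)
  have ha := HarmonicAt.comp_analyticAt (g := fun z => Complex.exp (Complex.I * z))
    (hg.1.harmonic _ hmem) (by fun_prop)
  refine (harmonicAt_congr_nhds ?_).1 ha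
  filter_upwards [(isOpen_lt continuous_const Complex.continuous_im).mem_nhds hz0] with w hw
  exact (if_pos hw).symm

/-- Schwarz reflection through mean values: about a real point the odd function has mean zero on
every circle, which equals its value. Elsewhere it is harmonic by composition, so it is continuous
with the mean value property throughout the strip. -/
theorem harmonicAt_stripLift (hΩ : IsCollared Ω p r d) (h : IsNearIdentity Ω r d φ D)
    (hg : IsGreenFunction D (φ p) g) {z : ℂ} (hz : |z.im| < stripWidth r d) :
    HarmonicAt (stripLift g) z := by
  have hne : ∀ z : ℂ, |z.im| < stripWidth r d → z.im ≠ 0 → HarmonicAt (stripLift g) z := by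
    intro z hz hz0
    rcases lt_or_gt_of_ne hz0 with hlt | hgt
    · have h1 := harmonicAt_stripLift_of_pos hΩ h hg (z := (starRingEnd ℂ) z) (by simpa using hz)
        (by simpa using hlt)
      refine (harmonicAt_congr_nhds (Eventually.of_forall fun w => ?_)).1
        (HarmonicAt.comp_conj h1).neg
      simp [stripLift_conj]
    · exact harmonicAt_stripLift_of_pos hΩ h hg hz hgt
  have hopen : {z : ℂ | |z.im| < stripWidth r d} ∈ 𝓝 z :=
    (isOpen_lt (continuous_abs.comp Complex.continuous_im) continuous_const).mem_nhds hz
  have hcont : ∀ z : ℂ, |z.im| < stripWidth r d → ∀ᶠ y in 𝓝 z, ContinuousAt (stripLift g) y :=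
    fun z hz => by
    filter_upwards [(isOpen_lt (continuous_abs.comp Complex.continuous_im)
      continuous_const).mem_nhds hz] with y hy using continuousAt_stripLift hΩ h hg hy
  have havg : ∀ z : ℂ, |z.im| < stripWidth r d → z.im = 0 →
      ∀ᶠ ρ in 𝓝[>] (0 : ℝ), circleAverage (stripLift g) z ρ = 0 := by
    intro z hz hz0
    have hzr : z = (z.re : ℂ) := Complex.ext rfl (by simpa using hz0)
    refine Eventually.of_forall fun ρ => ?_
    have h1 := circleAverage_comp_conj (stripLift g) z.re ρ
    rw [← hzr] at h1
    have h2 : (fun w => stripLift g ((starRingEnd ℂ) w)) = (-1 : ℝ) • stripLift g := by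
      ext w
      simp [stripLift_conj]
    rw [h2, circleAverage_smul] at h1
    simp only [smul_eq_mul] at h1
    linarith
  have hzero : ∀ z : ℂ, z.im = 0 → stripLift g z = 0 := fun z hz => by simp [stripLift, hz]
  refine harmonicAt_of_submeanAt ?_ ?_
  · filter_upwards [hopen] with y hy
    by_cases hy0 : y.im = 0
    · refine ⟨hcont y hy, (havg y hy hy0).mono fun ρ hρ => ?_⟩
      rw [hρ, hzero y hy0]
    · exact HarmonicAt.submeanAt (hne y hy hy0)
  · filter_upwards [hopen] with y hy
    by_cases hy0 : y.im = 0
    · refine ⟨(hcont y hy).mono fun w hw => hw.neg, (havg y hy hy0).mono fun ρ hρ => ?_⟩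
      have : (fun w => -stripLift g w) = (-1 : ℝ) • stripLift g := by ext w; simp
      rw [this, circleAverage_smul, hρ]
      simp [hzero y hy0]
    · exact HarmonicAt.submeanAt (hne y hy hy0).neg

theorem abs_stripLift_le {f : ℂ → ℝ} {B : ℝ} (hΩ : IsCollared Ω p r d) (hB0 : 0 ≤ B)
    (hB : ∀ w : ℂ, r + 3 * d ≤ ‖w‖ → ‖w‖ < 1 → |f w| ≤ B) {z : ℂ}
    (hz : |z.im| < stripWidth r d) : |stripLift f z| ≤ B := by
  unfold stripLift
  split_ifs with h1 h2
  · refine hB _ (hΩ.lt_norm_exp hz).le ?_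
    rw [norm_exp_I_mul, Real.exp_lt_one_iff]
    linarith
  · simpa using hB0
  · rw [abs_neg]
    refine hB _ (hΩ.lt_norm_exp (by simpa using hz)).le ?_
    rw [norm_exp_I_mul, Real.exp_lt_one_iff]
    have : z.im < 0 := lt_of_le_of_ne (not_lt.1 h1) h2
    simpa using this

theorem stripLift_sub (f₁ f₂ : ℂ → ℝ) (z : ℂ) :
    stripLift (fun w => f₁ w - f₂ w) z = stripLift f₁ z - stripLift f₂ z := by
  unfold stripLift
  split_ifs <;> ring

/-! ### Positivity of the normal derivative -/

/-- The maximum modulus principle for `exp (-F)`, where `F` is holomorphic with real part `u`. -/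
theorem eventually_eq_zero_of_harmonicAt {u : ℂ → ℝ} {z : ℂ} (hu : HarmonicAt u z)
    (hnn : ∀ᶠ w in 𝓝 z, 0 ≤ u w) (hz : u z = 0) : ∀ᶠ w in 𝓝 z, u w = 0 := by
  obtain ⟨ε, hε, hb⟩ := Metric.isOpen_iff.1 (isOpen_setOfPred_harmonicAt (f := u)) _ hu
  obtain ⟨F, hF, hFu⟩ := InnerProductSpace.HarmonicOnNhd.exists_analyticOnNhd_ball_re_eq
    (f := u) (fun y hy => hb hy)
  have hball := isOpen_ball.mem_nhds (mem_ball_self (x := z) hε)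
  have hnorm : ∀ w ∈ ball z ε, ‖Complex.exp (-F w)‖ = Real.exp (-u w) := fun w hw => by
    rw [Complex.norm_exp, Complex.neg_re]
    congr 2
    exact hFu hw
  have hmax : IsLocalMax (norm ∘ fun w => Complex.exp (-F w)) z := by
    filter_upwards [hball, hnn] with w hw hw0
    simp only [Function.comp_apply]
    rw [hnorm w hw, hnorm z (mem_ball_self hε), hz]
    exact Real.exp_le_exp.2 (by linarith)
  have hdiff : ∀ᶠ w in 𝓝 z, DifferentiableAt ℂ (fun w => Complex.exp (-F w)) w := by
    filter_upwards [hball] with w hw using ((hF w hw).differentiableAt.neg).cexp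
  filter_upwards [Complex.eventually_eq_of_isLocalMax_norm hdiff hmax, hball] with w hw hwb
  have := congrArg norm hw
  rw [hnorm w hwb, hnorm z (mem_ball_self hε), hz, Real.exp_eq_exp] at this
  linarith

/-- The zero set is open by `eventually_eq_zero_of_harmonicAt`. The positive set together with `p`
is open because `g` tends to infinity at `p`. Including `p` lets connectedness of `D` be used
instead of that of `D \ {p}`. -/
theorem HasLogPole.pos {D : Set ℂ} {p : ℂ} (hD : IsOpen D) (hDc : IsPreconnected D) (hp : p ∈ D)
    (hg : HasLogPole D p g) : ∀ z ∈ D \ {p}, 0 < g z := by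
  have hDp : IsOpen (D \ {p}) := hD.sdiff isClosed_singleton
  set A : Set ℂ := {z | z ∈ D \ {p} ∧ g z = 0} with hA
  set B : Set ℂ := {z | z = p ∨ (z ∈ D \ {p} ∧ 0 < g z)} with hB
  have hAo : IsOpen A := isOpen_iff_mem_nhds.2 fun z hz => by
    have hnn : ∀ᶠ w in 𝓝 z, 0 ≤ g w := by
      filter_upwards [hDp.mem_nhds hz.1] with w hw using hg.nonneg w hw
    filter_upwards [eventually_eq_zero_of_harmonicAt (hg.harmonic z hz.1) hnn hz.2,
      hDp.mem_nhds hz.1] with w h1 h2 using ⟨h2, h1⟩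
  have hBo : IsOpen B := isOpen_iff_mem_nhds.2 fun z hz => by
    rcases hz with rfl | ⟨hz, hpos⟩
    · obtain ⟨k, hk, hgk⟩ := hg.pole
      have hlog : Tendsto (fun w => k w + -Real.log ‖w - z‖) (𝓝[≠] z) atTop := by
        refine ((HarmonicAt.continuousAt hk).mono_left nhdsWithin_le_nhds).add_atTop ?_
        refine tendsto_neg_atBot_atTop.comp (Real.tendsto_log_nhdsGT_zero.comp ?_)
        refine tendsto_nhdsWithin_iff.2 ⟨?_, ?_⟩
        · have : Continuous fun w : ℂ => ‖w - z‖ := by fun_prop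
          simpa using (this.tendsto z).mono_left (nhdsWithin_le_nhds (s := {z}ᶜ))
        · filter_upwards [self_mem_nhdsWithin] with w hw
          exact norm_pos_iff.2 (sub_ne_zero.2 hw)
      have h1 := (hlog.eventually_gt_atTop 0).and hgk
      filter_upwards [eventually_nhdsWithin_iff.1 h1, hD.mem_nhds hp] with w hw hwD
      by_cases hwz : w = z
      · exact Or.inl hwz
      · have := hw hwz
        exact Or.inr ⟨⟨hwD, hwz⟩, by linarith [this.1, this.2]⟩
    · filter_upwards [hDp.mem_nhds hz,
        (HarmonicAt.continuousAt (hg.harmonic z hz)).eventually_const_lt hpos] with w h1 h2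
      exact Or.inr ⟨h1, h2⟩
  intro z hz
  by_contra hcon
  have hz0 : g z = 0 := le_antisymm (not_lt.1 hcon) (hg.nonneg z hz)
  obtain ⟨w, -, hwA, hwB⟩ := hDc A B hAo hBo (fun w hw => by
      by_cases hwp : w = p
      · exact Or.inr (Or.inl hwp)
      · rcases (hg.nonneg w ⟨hw, hwp⟩).eq_or_lt with h | h
        · exact Or.inl ⟨⟨hw, hwp⟩, h.symm⟩
        · exact Or.inr (Or.inr ⟨⟨hw, hwp⟩, h⟩)) ⟨z, hz.1, hz, hz0⟩ ⟨p, hp, Or.inl rfl⟩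
  rcases hwB with h | ⟨-, h⟩
  · exact hwA.1.2 h
  · exact h.ne' hwA.2

theorem closedBall_subset_strip (x₀ : ℝ) (hΩ : IsCollared Ω p r d) {z : ℂ}
    (hz : z ∈ closedBall (x₀ : ℂ) (stripWidth r d / 2)) : |z.im| < stripWidth r d := by
  have h1 := hΩ.stripWidth_pos
  rw [mem_closedBall, dist_eq_norm] at hz
  have h2 := Complex.abs_im_le_norm (z - x₀)
  simp only [Complex.sub_im, Complex.ofReal_im, sub_zero] at h2
  linarith

theorem harmonicOnNhd_stripLift (hΩ : IsCollared Ω p r d) (h : IsNearIdentity Ω r d φ D)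
    (hg : IsGreenFunction D (φ p) g) (x₀ : ℝ) :
    HarmonicOnNhd (stripLift g) (closedBall (x₀ : ℂ) (stripWidth r d / 2)) := fun _ hz =>
  harmonicAt_stripLift hΩ h hg (closedBall_subset_strip x₀ hΩ hz)

/-- Hopf's lemma for the lifted Green function. -/
theorem normalDeriv_stripLift_pos (hΩ : IsCollared Ω p r d) (h : IsNearIdentity Ω r d φ D)
    (hg : IsGreenFunction D (φ p) g) (hD : IsPreconnected D) (x₀ : ℝ) :
    0 < normalDeriv (stripLift g) x₀ := by
  have hd := hΩ.d_pos
  have hr := hΩ.r_pos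
  have h10 := hΩ.eq_one
  have hw := hΩ.stripWidth_pos
  set σ := r + 3 * d with hσ
  have hpos := hg.1.pos h.isOpen hD (h.pole_mem hΩ)
  have hmem : ∀ w ∈ sphere (0 : ℂ) σ, w ∈ D \ {φ p} := fun w hw => by
    rw [mem_sphere_zero_iff_norm] at hw
    exact h.mem_diff hΩ (by linarith) (by linarith)
  obtain ⟨w₀, hw₀, hmin⟩ := (isCompact_sphere (0 : ℂ) σ).exists_isMinOn
    (NormedSpace.sphere_nonempty.2 (by linarith)) (f := g)
    (fun w hw => (HarmonicAt.continuousAt (hg.1.harmonic w (hmem w hw))).continuousWithinAt)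
  have hc := hpos w₀ (hmem w₀ hw₀)
  set c := g w₀
  -- Comparison from below with `c * log ‖w‖ / log σ`, whose lift `c * y / stripWidth r d` is linear
  -- in `y`; its slope bounds the normal derivative from below.
  have hann := annulus_le (u := fun w => -zeroExtend g w) (σ := σ) (m := -c) (by linarith)
    (by linarith)
    (fun w hw => (hg.continuousAt_zeroExtend hΩ h (by linarith [hw.1])).neg.continuousWithinAt)
    (fun w hw1 hw2 => by
      refine SubmeanAt.congr (HarmonicAt.submeanAt (hg.1.harmonic w
        (h.mem_diff hΩ (by linarith) hw2)).neg) ?_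
      filter_upwards [zeroExtend_eventuallyEq (g := g) hw2] with z h1
      rw [h1]
      rfl)
    (fun w hw => by
      rw [zeroExtend, if_pos (by linarith)]
      exact neg_le_neg (hmin (mem_sphere_zero_iff_norm.2 hw)))
    (fun w hw => by simp [zeroExtend, hw])
  have hder := hasDerivAt_normal (harmonicOnNhd_stripLift hΩ h hg x₀) (x := x₀)
    (mem_ball_self (by linarith))
  rw [normalDeriv, hder.deriv]
  refine lt_of_lt_of_le (div_pos hc hw) (ge_of_tendsto hder.tendsto_slope_zero_right ?_)
  filter_upwards [Ioo_mem_nhdsGT hw] with y hy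
  have him : ((x₀ : ℂ) + (y : ℂ) * Complex.I).im = y := by simp
  have hl0 : stripLift g ((x₀ : ℂ) + ((0 : ℝ) : ℂ) * Complex.I) = 0 := by simp [stripLift]
  have hn : ‖Complex.exp (Complex.I * ((x₀ : ℂ) + (y : ℂ) * Complex.I))‖ = Real.exp (-y) := by
    rw [norm_exp_I_mul, him]
  have hn1 : Real.exp (-y) < 1 := Real.exp_lt_one_iff.2 (by linarith [hy.1])
  have hl : stripLift g ((x₀ : ℂ) + (y : ℂ) * Complex.I) =
      zeroExtend g (Complex.exp (Complex.I * ((x₀ : ℂ) + (y : ℂ) * Complex.I))) := by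
    rw [stripLift, if_pos (by rw [him]; exact hy.1), zeroExtend, if_pos (by rw [hn]; exact hn1)]
  have h1 := hann (Complex.exp (Complex.I * ((x₀ : ℂ) + (y : ℂ) * Complex.I)))
    (by rw [hn]; exact (hΩ.lt_exp hy.2).le) (by rw [hn]; exact hn1.le)
  rw [hn, Real.log_exp, ← hl] at h1
  rw [zero_add, hl0, sub_zero, smul_eq_mul, div_le_iff₀ hw]
  have h2 : -c * (-y / Real.log σ) = -(c * (y / stripWidth r d)) := by
    rw [stripWidth, ← hσ]
    ring
  rw [h2] at h1
  have h3 : c * (y / stripWidth r d) ≤ stripLift g ((x₀ : ℂ) + (y : ℂ) * Complex.I) := by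
    linarith
  rw [mul_div_assoc', div_le_iff₀ hw] at h3
  rw [mul_assoc, le_inv_mul_iff₀ hy.1]
  linarith

/-! ### The quotient of derivatives -/

/-- The quotient `∂_x ∂_y u / ∂_y u` at the real point `x`. -/
noncomputable def normalQuotient (u : ℂ → ℝ) (x : ℝ) : ℝ :=
  deriv (normalDeriv u) x / normalDeriv u x

theorem isNearIdentity_id (hΩ : IsCollared Ω p r d) (ho : IsOpen Ω) (hb : Ω ⊆ ball 0 1) :
    IsNearIdentity Ω r d id Ω where
  differentiableOn := differentiableOn_id
  injOn := injOn_id _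
  deriv_ne_zero := fun z _ => by simp
  norm_le := fun z _ => le_rfl
  norm_sub_le := fun z _ => by simpa using hΩ.d_pos.le
  surj := fun w hw => ⟨w, by simpa using hw, rfl⟩
  isOpen := ho
  subset := hb
  mem_iff := fun z _ => Iff.rfl
  annulus := fun w h1 h2 => hΩ.annulus w (by linarith [hΩ.d_pos]) h2

/-- Numerator and denominator are Lipschitz by the two previous estimates. The denominator is
positive for `Ω` itself at `x₀` by Hopf's lemma, and for small `η` it stays above half that value,
so the quotient is Lipschitz too. -/
theorem exists_normalQuotient_lipschitz (hΩ : IsCollared Ω p r d) (ho : IsOpen Ω)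
    (hb : Ω ⊆ ball 0 1) (hc : IsPreconnected Ω) (x₀ : ℝ) :
    ∃ η K : ℝ, 0 < η ∧ 0 ≤ K ∧ ∀ (φ₁ φ₂ : ℂ → ℂ) (D₁ D₂ : Set ℂ) (g₁ g₂ : ℂ → ℝ),
      IsNearIdentity Ω r d φ₁ D₁ → IsNearIdentity Ω r d φ₂ D₂ →
      IsGreenFunction D₁ (φ₁ p) g₁ → IsGreenFunction D₂ (φ₂ p) g₂ →
      (∀ z ∈ ball (0 : ℂ) (r + 9 * d), ‖φ₁ z - z‖ ≤ η) →
      (∀ z ∈ ball (0 : ℂ) (r + 9 * d), ‖φ₂ z - z‖ ≤ η) →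
      ∀ δ : ℝ, (∀ z ∈ ball (0 : ℂ) (r + 9 * d), ‖φ₁ z - φ₂ z‖ ≤ δ) →
      ∀ x₁ x₂ : ℝ, |x₁ - x₀| ≤ η → |x₂ - x₀| ≤ η →
        normalDeriv (stripLift g₁) x₁ ≠ 0 ∧
        |normalQuotient (stripLift g₁) x₁| ≤ K ∧
        |normalQuotient (stripLift g₁) x₁ - normalQuotient (stripLift g₂) x₂| ≤
          K * (δ + |x₁ - x₂|) := by
  have hw := hΩ.stripWidth_pos
  obtain ⟨C, hC0, hC⟩ := exists_green_lipschitz hΩ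
  obtain ⟨K, hK0, hK⟩ := exists_normalDeriv_lipschitz (ρ := stripWidth r d / 2) x₀ (by linarith)
  set B := greenBound d with hB
  have hB0 : 0 ≤ B := hΩ.greenBound_nonneg
  have hid := isNearIdentity_id hΩ ho hb
  have hg₀ : IsGreenFunction Ω (id p) (greenFunction Ω p) :=
    isGreenFunction_greenFunction ho hb hΩ.mem
  set N₀ := normalDeriv (stripLift (greenFunction Ω p)) x₀ with hN₀
  have hN₀pos : 0 < N₀ := normalDeriv_stripLift_pos hΩ hid hg₀ hc x₀
  have hbound : ∀ (φ : ℂ → ℂ) (D : Set ℂ) (g : ℂ → ℝ), IsNearIdentity Ω r d φ D →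
      IsGreenFunction D (φ p) g →
      ∀ z ∈ closedBall (x₀ : ℂ) (stripWidth r d / 2), |stripLift g z| ≤ B :=
    fun φ D g h hg z hz => abs_stripLift_le hΩ hB0
      (fun w h1 h2 => hg.le_greenBound hΩ h (by linarith [hΩ.d_pos]) h2)
      (closedBall_subset_strip x₀ hΩ hz)
  have hdiff : ∀ (φ₁ φ₂ : ℂ → ℂ) (D₁ D₂ : Set ℂ) (g₁ g₂ : ℂ → ℝ),
      IsNearIdentity Ω r d φ₁ D₁ → IsNearIdentity Ω r d φ₂ D₂ →
      IsGreenFunction D₁ (φ₁ p) g₁ → IsGreenFunction D₂ (φ₂ p) g₂ →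
      ∀ δ : ℝ, (∀ z ∈ ball (0 : ℂ) (r + 9 * d), ‖φ₁ z - φ₂ z‖ ≤ δ) →
      ∀ z ∈ closedBall (x₀ : ℂ) (stripWidth r d / 2),
        |stripLift g₁ z - stripLift g₂ z| ≤ C * δ := by
    intro φ₁ φ₂ D₁ D₂ g₁ g₂ h₁ h₂ hg₁ hg₂ δ hδ z hz
    rw [← stripLift_sub]
    have hδ0 : 0 ≤ δ := (norm_nonneg _).trans (hδ p hΩ.mem_ball)
    exact abs_stripLift_le hΩ (by positivity)
      (fun w h1 h2 => hC φ₁ φ₂ D₁ D₂ g₁ g₂ h₁ h₂ hg₁ hg₂ δ hδ w h1 h2)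
      (closedBall_subset_strip x₀ hΩ hz)
  -- The first entry keeps the points in the range of the derivative estimates; the second limits
  -- the change of the normal derivative to `N₀ / 2`.
  set η := min (stripWidth r d / 2 / 8) (N₀ / 2 / (K * (C + B) + 1)) with hη
  have hKCB : 0 < K * (C + B) + 1 := by positivity
  have hη0 : 0 < η := lt_min (by linarith) (by positivity)
  have hη1 : η ≤ stripWidth r d / 2 / 8 := min_le_left _ _
  have hη2 : K * (C + B) * η ≤ N₀ / 2 := by
    have h1 : η * (K * (C + B) + 1) ≤ N₀ / 2 := (le_div_iff₀ hKCB).1 (min_le_right _ _)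
    nlinarith
  -- a lower bound for the normal derivative
  have hlow : ∀ (φ : ℂ → ℂ) (D : Set ℂ) (g : ℂ → ℝ), IsNearIdentity Ω r d φ D →
      IsGreenFunction D (φ p) g → (∀ z ∈ ball (0 : ℂ) (r + 9 * d), ‖φ z - z‖ ≤ η) →
      ∀ x : ℝ, |x - x₀| ≤ η → N₀ / 2 ≤ normalDeriv (stripLift g) x := by
    intro φ D g h hg hφ x hx
    have h1 := (hK (stripLift g) (stripLift (greenFunction Ω p)) B (C * η)
      (harmonicOnNhd_stripLift hΩ h hg x₀) (harmonicOnNhd_stripLift hΩ hid hg₀ x₀)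
      (hbound id Ω _ hid hg₀) (hdiff φ id D Ω _ _ h hid hg hg₀ η hφ) x x₀
      (hx.trans hη1) (by simpa using (by linarith : 0 ≤ stripWidth r d / 2 / 8))).2.1
    have h2 : K * (C * η + B * |x - x₀|) ≤ N₀ / 2 := by
      have : K * (C * η + B * |x - x₀|) ≤ K * (C * η + B * η) := by gcongr
      nlinarith
    have h3 := (abs_le.1 (h1.trans h2)).1
    linarith
  set c := N₀ / 2 with hcdef
  have hc0 : 0 < c := by positivity
  set A := K * (C + B) with hA
  have hA0 : 0 ≤ A := by positivity
  refine ⟨η, K * B / c + (A / c + K * B * A / (c * c)), hη0, by positivity, ?_⟩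
  intro φ₁ φ₂ D₁ D₂ g₁ g₂ h₁ h₂ hg₁ hg₂ hφ₁ hφ₂ δ hδ x₁ x₂ hx₁ hx₂
  have hδ0 : 0 ≤ δ := (norm_nonneg _).trans (hδ p hΩ.mem_ball)
  have hl1 := hlow φ₁ D₁ g₁ h₁ hg₁ hφ₁ x₁ hx₁
  have hl2 := hlow φ₂ D₂ g₂ h₂ hg₂ hφ₂ x₂ hx₂
  have hs1 := harmonicOnNhd_stripLift hΩ h₁ hg₁ x₀
  have hs2 := harmonicOnNhd_stripLift hΩ h₂ hg₂ x₀
  obtain ⟨hb2, hn, hn'⟩ := hK (stripLift g₁) (stripLift g₂) B (C * δ) hs1 hs2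
    (hbound φ₂ D₂ g₂ h₂ hg₂) (hdiff φ₁ φ₂ D₁ D₂ g₁ g₂ h₁ h₂ hg₁ hg₂ δ hδ) x₁ x₂
    (hx₁.trans hη1) (hx₂.trans hη1)
  -- Comparing `g₁` with itself extracts the bound on its own tangential derivative.
  obtain ⟨hb1, -, -⟩ := hK (stripLift g₁) (stripLift g₁) B 0 hs1 hs1
    (hbound φ₁ D₁ g₁ h₁ hg₁) (fun z _ => by simp) x₁ x₁ (hx₁.trans hη1) (hx₁.trans hη1)
  have hsum : K * (C * δ + B * |x₁ - x₂|) ≤ A * (δ + |x₁ - x₂|) := by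
    have h1 : 0 ≤ K * C * |x₁ - x₂| := by positivity
    have h2 : 0 ≤ K * B * δ := by positivity
    rw [hA]
    nlinarith
  have hn := hn.trans hsum
  have hn' := hn'.trans hsum
  set s := δ + |x₁ - x₂| with hs
  have hs0 : 0 ≤ s := by positivity
  unfold normalQuotient
  set n₁ := normalDeriv (stripLift g₁) x₁
  set n₂ := normalDeriv (stripLift g₂) x₂
  set t₁ := deriv (normalDeriv (stripLift g₁)) x₁
  set t₂ := deriv (normalDeriv (stripLift g₂)) x₂
  have hn₁ : 0 < n₁ := hc0.trans_le hl1
  have hn₂ : 0 < n₂ := hc0.trans_le hl2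
  refine ⟨hn₁.ne', ?_, ?_⟩
  · rw [abs_div, abs_of_pos hn₁]
    have : |t₁| / n₁ ≤ K * B / c := by gcongr
    have h1 : 0 ≤ A / c + K * B * A / (c * c) := by positivity
    linarith
  · have heq : t₁ / n₁ - t₂ / n₂ = (t₁ - t₂) / n₁ + t₂ * (n₂ - n₁) / (n₁ * n₂) := by
      field_simp
      ring
    rw [heq]
    refine (abs_add_le _ _).trans ?_
    rw [abs_div, abs_div, abs_mul, abs_of_pos hn₁, abs_of_pos (mul_pos hn₁ hn₂)]
    rw [abs_sub_comm] at hn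
    have e1 : |t₁ - t₂| / n₁ ≤ A * s / c := by gcongr
    have e2 : |t₂| * |n₂ - n₁| / (n₁ * n₂) ≤ K * B * (A * s) / (c * c) := by gcongr
    have e3 : A * s / c + K * B * (A * s) / (c * c) = (A / c + K * B * A / (c * c)) * s := by ring
    have e4 : 0 ≤ K * B / c * s := by positivity
    linarith

end

/-! ### The Loewner vector field -/

/-- The vector field of the radial Loewner equation. -/
noncomputable def loewnerField (e u : ℂ) : ℂ := u * ((e + u) / (e - u))

theorem continuous_circlePoint : Continuous circlePoint := by
  unfold circlePoint
  fun_prop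

theorem norm_circlePoint (x : ℝ) : ‖circlePoint x‖ = 1 := by
  rw [circlePoint, norm_exp_I_mul]
  simp

theorem norm_circlePoint_sub_le (x y : ℝ) : ‖circlePoint x - circlePoint y‖ ≤ |x - y| := by
  have h : circlePoint x - circlePoint y =
      circlePoint y * (Complex.exp (Complex.I * (x - y : ℝ)) - 1) := by
    simp only [circlePoint]
    rw [mul_sub, ← Complex.exp_add, mul_one]
    congr 2
    push_cast
    ring
  rw [h, norm_mul, norm_circlePoint, one_mul]
  simpa using Real.norm_exp_I_mul_ofReal_sub_one_le (x := x - y)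

theorem one_sub_le_norm_sub {e u : ℂ} {ρ : ℝ} (he : ‖e‖ = 1) (hu : ‖u‖ ≤ ρ) :
    1 - ρ ≤ ‖e - u‖ := by
  have := norm_sub_norm_le e u
  linarith

theorem sub_ne_zero_of_norm_lt {e u : ℂ} (he : ‖e‖ = 1) (hu : ‖u‖ < 1) : e - u ≠ 0 := by
  intro h
  have := one_sub_le_norm_sub he (le_refl ‖u‖)
  rw [h, norm_zero] at this
  linarith

/-- The difference of the fields is an exact multiple of `u - v`, so the difference of two
trajectories solves a scalar linear equation. Uniqueness, injectivity and the spatial derivative of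
the flow all follow from this. -/
theorem loewnerField_sub {e u v : ℂ} (hu : e - u ≠ 0) (hv : e - v ≠ 0) :
    loewnerField e u - loewnerField e v =
      (2 * e ^ 2 / ((e - u) * (e - v)) - 1) * (u - v) := by
  unfold loewnerField
  field_simp
  ring

theorem norm_loewnerField_le {e u : ℂ} {ρ : ℝ} (he : ‖e‖ = 1) (hu : ‖u‖ ≤ ρ) (hρ : ρ < 1) :
    ‖loewnerField e u‖ ≤ 2 / (1 - ρ) := by
  have h1 := one_sub_le_norm_sub he hu
  have h2 : ‖e + u‖ ≤ 2 := (norm_add_le _ _).trans (by linarith)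
  rw [loewnerField, norm_mul, norm_div]
  have h3 : ‖e + u‖ / ‖e - u‖ ≤ 2 / (1 - ρ) := by
    gcongr
  have h4 : ‖u‖ * (‖e + u‖ / ‖e - u‖) ≤ 1 * (2 / (1 - ρ)) := by
    gcongr
    linarith
  linarith

theorem norm_loewner_coeff_le {e u v : ℂ} {ρ : ℝ} (he : ‖e‖ = 1) (hu : ‖u‖ ≤ ρ) (hv : ‖v‖ ≤ ρ)
    (hρ : ρ < 1) : ‖2 * e ^ 2 / ((e - u) * (e - v)) - 1‖ ≤ 2 / (1 - ρ) ^ 2 + 1 := by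
  have h1 := one_sub_le_norm_sub he hu
  have h2 := one_sub_le_norm_sub he hv
  refine (norm_sub_le _ _).trans ?_
  rw [norm_div, norm_mul, norm_mul, norm_pow, he, norm_one, Complex.norm_ofNat, one_pow, mul_one,
    pow_two]
  have : 0 < 1 - ρ := by linarith
  gcongr

theorem norm_loewnerField_sub_le {e u v : ℂ} {ρ : ℝ} (he : ‖e‖ = 1) (hu : ‖u‖ ≤ ρ)
    (hv : ‖v‖ ≤ ρ) (hρ : ρ < 1) :
    ‖loewnerField e u - loewnerField e v‖ ≤ (2 / (1 - ρ) ^ 2 + 1) * ‖u - v‖ := by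
  rw [loewnerField_sub (sub_ne_zero_of_norm_lt he (by linarith))
    (sub_ne_zero_of_norm_lt he (by linarith)), norm_mul]
  exact mul_le_mul_of_nonneg_right (norm_loewner_coeff_le he hu hv hρ) (norm_nonneg _)

theorem norm_loewnerField_sub_left_le {e e' u : ℂ} {ρ : ℝ} (he : ‖e‖ = 1) (he' : ‖e'‖ = 1)
    (hu : ‖u‖ ≤ ρ) (hρ : ρ < 1) :
    ‖loewnerField e u - loewnerField e' u‖ ≤ 2 / (1 - ρ) ^ 2 * ‖e - e'‖ := by
  have h1 := sub_ne_zero_of_norm_lt he (by linarith : ‖u‖ < 1)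
  have h2 := sub_ne_zero_of_norm_lt he' (by linarith : ‖u‖ < 1)
  have h3 := one_sub_le_norm_sub he hu
  have h4 := one_sub_le_norm_sub he' hu
  have h : loewnerField e u - loewnerField e' u =
      2 * u ^ 2 / ((e - u) * (e' - u)) * (e' - e) := by
    unfold loewnerField
    field_simp
    ring
  rw [h, norm_mul, norm_sub_rev e' e, norm_div, norm_mul, norm_mul, norm_pow, Complex.norm_ofNat]
  refine mul_le_mul_of_nonneg_right ?_ (norm_nonneg _)
  have h5 : 0 < 1 - ρ := by linarith
  have h6 : ‖u‖ ^ 2 ≤ 1 := pow_le_one₀ (norm_nonneg _) (by linarith)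
  rw [pow_two (1 - ρ)]
  gcongr
  linarith

/-- Radial retraction of the plane onto the closed disc of radius `ρ`. -/
noncomputable def ballRetract (ρ : ℝ) (u : ℂ) : ℂ := ((ρ / max ρ ‖u‖ : ℝ) : ℂ) * u

theorem norm_ballRetract_le {ρ : ℝ} (hρ : 0 < ρ) (u : ℂ) : ‖ballRetract ρ u‖ ≤ ρ := by
  have hm : 0 < max ρ ‖u‖ := hρ.trans_le (le_max_left _ _)
  rw [ballRetract, norm_mul, Complex.norm_real, Real.norm_of_nonneg (by positivity),
    div_mul_eq_mul_div, div_le_iff₀ hm]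
  exact mul_le_mul_of_nonneg_left (le_max_right _ _) hρ.le

theorem ballRetract_of_le {ρ : ℝ} (hρ : 0 < ρ) {u : ℂ} (hu : ‖u‖ ≤ ρ) : ballRetract ρ u = u := by
  rw [ballRetract, max_eq_left hu, div_self hρ.ne']
  simp

theorem norm_ballRetract_sub_le {ρ : ℝ} (hρ : 0 < ρ) (u v : ℂ) :
    ‖ballRetract ρ u - ballRetract ρ v‖ ≤ 2 * ‖u - v‖ := by
  set mu := max ρ ‖u‖ with hmu
  set mv := max ρ ‖v‖ with hmv
  have h1 : 0 < mu := hρ.trans_le (le_max_left _ _)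
  have h2 : 0 < mv := hρ.trans_le (le_max_left _ _)
  have heq : ballRetract ρ u - ballRetract ρ v =
      ((ρ / mu : ℝ) : ℂ) * (u - v) + ((ρ / mu - ρ / mv : ℝ) : ℂ) * v := by
    rw [ballRetract, ballRetract, ← hmu, ← hmv]
    push_cast
    ring
  have h3 : ρ / mu ≤ 1 := (div_le_one h1).2 (le_max_left _ _)
  have h4 : |mv - mu| ≤ ‖u - v‖ := by
    rw [hmu, hmv]
    refine (abs_max_sub_max_le_max _ _ _ _).trans ?_
    rw [sub_self, abs_zero, max_eq_right (abs_nonneg _), norm_sub_rev]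
    exact abs_norm_sub_norm_le v u
  have h5 : |ρ / mu - ρ / mv| * ‖v‖ ≤ ‖u - v‖ := by
    have : ρ / mu - ρ / mv = ρ / mu * ((mv - mu) / mv) := by field_simp
    rw [this, abs_mul, abs_of_pos (by positivity), abs_div, abs_of_pos h2]
    have h6 : |mv - mu| / mv * ‖v‖ ≤ |mv - mu| := by
      rw [div_mul_eq_mul_div, div_le_iff₀ h2]
      exact mul_le_mul_of_nonneg_left (le_max_right _ _) (abs_nonneg _)
    have h7 : 0 ≤ |mv - mu| / mv * ‖v‖ := by positivity
    nlinarith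
  rw [heq]
  refine (norm_add_le _ _).trans ?_
  rw [norm_mul, norm_mul, Complex.norm_real, Complex.norm_real, Real.norm_eq_abs, Real.norm_eq_abs,
    abs_of_pos (by positivity : 0 < ρ / mu)]
  nlinarith [norm_nonneg (u - v)]

/-- Global solutions of the truncated Loewner equation. -/
theorem exists_truncated_solution {e : ℝ → ℂ} (he : Continuous e) (he1 : ∀ s, ‖e s‖ = 1) {ρ : ℝ}
    (hρ0 : 0 < ρ) (hρ1 : ρ < 1) {t : ℝ} (ht : 0 ≤ t) (z c : ℂ) (hc : ‖c‖ = 1) :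
    ∃ u : ℝ → ℂ, u 0 = z ∧ ∀ s ∈ Icc 0 t,
      HasDerivWithinAt u (c * loewnerField (e s) (ballRetract ρ (u s))) (Icc 0 t) s := by
  set L : NNReal := (2 / (1 - ρ)).toNNReal with hL
  set K : NNReal := ((2 / (1 - ρ) ^ 2 + 1) * 2).toNNReal with hK
  have h1ρ : 0 < 1 - ρ := by linarith
  have hLv : (L : ℝ) = 2 / (1 - ρ) := Real.coe_toNNReal _ (by positivity)
  have hKv : (K : ℝ) = (2 / (1 - ρ) ^ 2 + 1) * 2 := Real.coe_toNNReal _ (by positivity)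
  -- After retraction the field is globally bounded and Lipschitz, so the solution lives on all of
  -- `[0, t]`. The factor `c` allows the forward flow, `c = 1`, and the time-reversed flow, `c =
  -- -1`.
  have hPL : IsPicardLindelof (fun s u => c * loewnerField (e s) (ballRetract ρ u))
      (⟨0, left_mem_Icc.2 ht⟩ : Icc (0 : ℝ) t) z (L * t.toNNReal) 0 L K := by
    refine ⟨fun s _ => ?_, fun x _ => ?_, fun s _ x _ => ?_, ?_⟩
    · refine LipschitzOnWith.of_dist_le_mul fun x _ y _ => ?_
      rw [dist_eq_norm, dist_eq_norm, ← mul_sub, norm_mul, hc, one_mul, hKv]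
      refine (norm_loewnerField_sub_le (he1 s) (norm_ballRetract_le hρ0 x)
        (norm_ballRetract_le hρ0 y) hρ1).trans ?_
      rw [mul_assoc]
      exact mul_le_mul_of_nonneg_left (norm_ballRetract_sub_le hρ0 x y) (by positivity)
    · refine Continuous.continuousOn ?_
      unfold loewnerField
      have hne : ∀ s, e s - ballRetract ρ x ≠ 0 := fun s =>
        sub_ne_zero_of_norm_lt (he1 s) ((norm_ballRetract_le hρ0 x).trans_lt hρ1)
      fun_prop (disch := exact hne _)
    · rw [norm_mul, hc, one_mul, hLv]
      exact norm_loewnerField_le (he1 s) (norm_ballRetract_le hρ0 x) hρ1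
    · simp [ht]
  exact hPL.exists_eq_forall_mem_Icc_hasDerivWithinAt₀

/-- The solution formula for a scalar linear differential equation. -/
theorem eq_mul_exp_of_hasDerivWithinAt {w a : ℝ → ℂ} {t : ℝ} (ha : ContinuousOn a (Icc 0 t))
    (hw : ∀ s ∈ Icc 0 t, HasDerivWithinAt w (a s * w s) (Icc 0 t) s) :
    ∀ s ∈ Icc 0 t, w s = w 0 * Complex.exp (∫ x in (0 : ℝ)..s, a x) := by
  intro s hs
  have ht : 0 ≤ t := hs.1.trans hs.2
  set b : ℝ → ℂ := IccExtend ht (fun x => a x) with hb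
  have hbc : Continuous b := (continuousOn_iff_continuous_domRestrict.1 ha).Icc_extend'
  have hba : ∀ x ∈ Icc 0 t, b x = a x := fun x hx => IccExtend_of_mem ht _ hx
  set A : ℝ → ℂ := fun s => ∫ x in (0 : ℝ)..s, b x with hA
  have hAd : ∀ s, HasDerivAt A (b s) s := fun s =>
    intervalIntegral.integral_hasDerivAt_right (hbc.intervalIntegrable _ _)
      (hbc.stronglyMeasurableAtFilter _ _) hbc.continuousAt
  have hq : ∀ x ∈ Icc 0 t, HasDerivWithinAt (fun s => w s * Complex.exp (-A s)) 0 (Icc 0 t) x := by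
    intro x hx
    have h1 := (hw x hx).mul ((hAd x).neg.cexp.hasDerivWithinAt (s := Icc 0 t))
    refine h1.congr_deriv ?_
    rw [hba x hx]
    ring
  have hconst := constant_of_has_deriv_right_zero (f := fun s => w s * Complex.exp (-A s))
    (fun x hx => (hq x hx).continuousWithinAt)
    (fun x hx => (hq x (Ico_subset_Icc_self hx)).mono_of_mem_nhdsWithin
      (Icc_mem_nhdsGE_of_mem hx)) s hs
  have hA0 : A 0 = 0 := by simp [hA]
  have hAs : A s = ∫ x in (0 : ℝ)..s, a x := by
    refine intervalIntegral.integral_congr fun x hx => ?_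
    rw [uIcc_of_le hs.1] at hx
    exact hba x ⟨hx.1, hx.2.trans hs.2⟩
  simp only [hA0, neg_zero, Complex.exp_zero, mul_one] at hconst
  rw [← hAs, ← hconst, mul_assoc, ← Complex.exp_add, neg_add_cancel, Complex.exp_zero, mul_one]

/-- This is the Poisson kernel; its positivity in the disc makes the modulus grow along
trajectories. -/
theorem re_loewner_quotient {e u : ℂ} (he : ‖e‖ = 1) :
    ((e + u) / (e - u)).re = (1 - ‖u‖ ^ 2) / ‖e - u‖ ^ 2 := by
  have h := congrFun (poissonKernel_eq_re_herglotzRieszKernel (c := 0) (w := u)) e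
  simp only [poissonKernel, Function.comp_apply, herglotzRieszKernel, sub_zero, he] at h
  rw [← h]
  norm_num

theorem hasDerivWithinAt_norm_sq {u : ℝ → ℂ} {u' : ℂ} {S : Set ℝ} {s : ℝ}
    (h : HasDerivWithinAt u u' S s) :
    HasDerivWithinAt (fun s => ‖u s‖ ^ 2) (2 * ((starRingEnd ℂ) (u s) * u').re) S s := by
  refine h.norm_sq.congr_deriv ?_
  rw [Complex.inner]
  ring_nf

section

variable {ξ : ℝ → ℝ} {t : ℝ} {z : ℂ} {u : ℝ → ℂ}

theorem IsRadialTrajectory.continuousOn (h : IsRadialTrajectory ξ t z u) :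
    ContinuousOn u (Icc 0 t) := fun s hs => (h.2 s hs).2.continuousWithinAt

theorem IsRadialTrajectory.mono (h : IsRadialTrajectory ξ t z u) {t' : ℝ} (ht' : t' ≤ t) :
    IsRadialTrajectory ξ t' z u :=
  ⟨h.1, fun s hs => ⟨(h.2 s ⟨hs.1, hs.2.trans ht'⟩).1,
    (h.2 s ⟨hs.1, hs.2.trans ht'⟩).2.mono (Icc_subset_Icc_right ht')⟩⟩

/-- The quantity `1 - ‖u‖ ^ 2` solves a linear equation, hence is its initial value times an
exponential and stays positive. -/
theorem IsRadialTrajectory.norm_lt_one (h : IsRadialTrajectory ξ t z u) (hξ : Continuous ξ)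
    (hz : ‖z‖ < 1) : ∀ s ∈ Icc 0 t, ‖u s‖ < 1 := by
  have hne : ∀ s ∈ Icc 0 t, ‖circlePoint (ξ s) - u s‖ ^ 2 ≠ 0 := fun s hs =>
    pow_ne_zero 2 (norm_ne_zero_iff.2 (sub_ne_zero.2 (h.2 s hs).1.symm))
  set b : ℝ → ℝ := fun s => -(2 * ‖u s‖ ^ 2 / ‖circlePoint (ξ s) - u s‖ ^ 2) with hb
  have hbc : ContinuousOn b (Icc 0 t) := by
    have h1 := h.continuousOn
    have h2 : ContinuousOn (fun s => circlePoint (ξ s)) (Icc 0 t) :=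
      (continuous_circlePoint.comp hξ).continuousOn
    exact ((continuousOn_const.mul (h1.norm.pow 2)).div ((h2.sub h1).norm.pow 2) hne).neg
  have hder : ∀ s ∈ Icc 0 t, HasDerivWithinAt (fun s => ((1 - ‖u s‖ ^ 2 : ℝ) : ℂ))
      ((b s : ℂ) * ((1 - ‖u s‖ ^ 2 : ℝ) : ℂ)) (Icc 0 t) s := by
    intro s hs
    have h1 := (hasDerivWithinAt_norm_sq (h.2 s hs).2).const_sub 1
    refine (h1.ofReal_comp).congr_deriv ?_
    rw [← Complex.ofReal_mul]
    congr 1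
    have h2 : (starRingEnd ℂ) (u s) * (u s * ((circlePoint (ξ s) + u s) /
        (circlePoint (ξ s) - u s))) = ((‖u s‖ ^ 2 : ℝ) : ℂ) * ((circlePoint (ξ s) + u s) /
        (circlePoint (ξ s) - u s)) := by
      rw [← mul_assoc, mul_comm ((starRingEnd ℂ) (u s)), Complex.mul_conj,
        Complex.normSq_eq_norm_sq]
    rw [h2, Complex.re_ofReal_mul, re_loewner_quotient (norm_circlePoint _)]
    simp only [hb]
    ring
  have hsol := eq_mul_exp_of_hasDerivWithinAt
    (Complex.continuous_ofReal.comp_continuousOn hbc) hder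
  intro s hs
  have h3 := hsol s hs
  simp only [Function.comp_apply, intervalIntegral.integral_ofReal, ← Complex.ofReal_exp,
    ← Complex.ofReal_mul, Complex.ofReal_inj, h.1] at h3
  have h4 : 0 < (1 - ‖z‖ ^ 2) * Real.exp (∫ x in (0 : ℝ)..s, b x) :=
    mul_pos (by nlinarith [norm_nonneg z]) (Real.exp_pos _)
  nlinarith [norm_nonneg (u s)]

theorem IsRadialTrajectory.le_norm (h : IsRadialTrajectory ξ t z u) (hξ : Continuous ξ)
    (hz : ‖z‖ < 1) : ∀ s ∈ Icc 0 t, ‖z‖ ≤ ‖u s‖ := by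
  have hlt := h.norm_lt_one hξ hz
  have hmono : MonotoneOn (fun s => ‖u s‖ ^ 2) (Icc 0 t) := by
    refine monotoneOn_of_hasDerivWithinAt_nonneg (f' := fun s => 2 * ((starRingEnd ℂ) (u s) *
      (u s * ((circlePoint (ξ s) + u s) / (circlePoint (ξ s) - u s)))).re) (convex_Icc 0 t)
      (h.continuousOn.norm.pow 2)
      (fun s hs => (hasDerivWithinAt_norm_sq (h.2 s (interior_subset hs)).2).mono
        interior_subset) fun s hs => ?_
    have hs' := interior_subset hs
    have h2 : (starRingEnd ℂ) (u s) * (u s * ((circlePoint (ξ s) + u s) /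
        (circlePoint (ξ s) - u s))) = ((‖u s‖ ^ 2 : ℝ) : ℂ) * ((circlePoint (ξ s) + u s) /
        (circlePoint (ξ s) - u s)) := by
      rw [← mul_assoc, mul_comm ((starRingEnd ℂ) (u s)), Complex.mul_conj,
        Complex.normSq_eq_norm_sq]
    rw [h2, Complex.re_ofReal_mul, re_loewner_quotient (norm_circlePoint _)]
    have : 0 ≤ 1 - ‖u s‖ ^ 2 := by nlinarith [hlt s hs', norm_nonneg (u s)]
    positivity
  intro s hs
  have := hmono (left_mem_Icc.2 (hs.1.trans hs.2)) hs hs.1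
  simp only [h.1] at this
  exact le_of_sq_le_sq this (norm_nonneg _)

/-- The exponential never vanishes: trajectories with the same start coincide, and those with
different starts never meet. -/
theorem IsRadialTrajectory.sub_eq (h : IsRadialTrajectory ξ t z u) (hξ : Continuous ξ) {w : ℂ}
    {v : ℝ → ℂ} (h' : IsRadialTrajectory ξ t w v) :
    ∀ s ∈ Icc 0 t, u s - v s = (z - w) * Complex.exp (∫ x in (0 : ℝ)..s,
      (2 * circlePoint (ξ x) ^ 2 /
        ((circlePoint (ξ x) - u x) * (circlePoint (ξ x) - v x)) - 1)) := by
  have hu : ∀ s ∈ Icc 0 t, circlePoint (ξ s) - u s ≠ 0 := fun s hs =>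
    sub_ne_zero.2 (h.2 s hs).1.symm
  have hv : ∀ s ∈ Icc 0 t, circlePoint (ξ s) - v s ≠ 0 := fun s hs =>
    sub_ne_zero.2 (h'.2 s hs).1.symm
  have hec : ContinuousOn (fun s => circlePoint (ξ s)) (Icc 0 t) :=
    (continuous_circlePoint.comp hξ).continuousOn
  intro s hs
  rw [← h.1, ← h'.1]
  refine eq_mul_exp_of_hasDerivWithinAt (w := fun s => u s - v s) ?_ (fun x hx => ?_) s hs
  · exact ((continuousOn_const.mul (hec.pow 2)).div ((hec.sub h.continuousOn).mul
      (hec.sub h'.continuousOn)) fun x hx => mul_ne_zero (hu x hx) (hv x hx)).sub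
      continuousOn_const
  · refine ((h.2 x hx).2.sub (h'.2 x hx).2).congr_deriv ?_
    exact loewnerField_sub (hu x hx) (hv x hx)

theorem IsRadialTrajectory.eqOn (h : IsRadialTrajectory ξ t z u) (hξ : Continuous ξ)
    {v : ℝ → ℂ} (h' : IsRadialTrajectory ξ t z v) : EqOn u v (Icc 0 t) := fun s hs => by
  have := h.sub_eq hξ h' s hs
  rwa [sub_self, zero_mul, sub_eq_zero] at this

theorem IsRadialTrajectory.radialMap_eq (h : IsRadialTrajectory ξ t z u) (hξ : Continuous ξ)
    (ht : 0 ≤ t) : radialMap ξ t z = u t := by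
  have hex : ∃ u : ℝ → ℂ, IsRadialTrajectory ξ t z u := ⟨u, h⟩
  rw [radialMap, dif_pos hex]
  exact hex.choose_spec.eqOn hξ h (right_mem_Icc.2 ht)

/-- The Loewner maps are onto the disc. -/
theorem exists_trajectory_ending_at (hξ : Continuous ξ) (ht : 0 ≤ t) {w : ℂ} (hw : ‖w‖ < 1) :
    ∃ z : ℂ, ‖z‖ < 1 ∧ ∃ u : ℝ → ℂ, IsRadialTrajectory ξ t z u ∧ u t = w := by
  set ρ := (1 + ‖w‖) / 2 with hρ
  have hρ0 : 0 < ρ := by positivity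
  have hρ1 : ρ < 1 := by rw [hρ]; linarith
  have hec : Continuous fun s => circlePoint (ξ (t - s)) := by
    have := continuous_circlePoint
    fun_prop
  obtain ⟨v, hv0, hv⟩ := exists_truncated_solution hec (fun s => norm_circlePoint _) hρ0 hρ1 ht w
    (-1) (by simp)
  have hvc : ContinuousOn v (Icc 0 t) := fun s hs => (hv s hs).continuousWithinAt
  -- The reversed flow decreases the modulus, so it stays within `‖w‖ < ρ` and the truncation is
  -- never active.
  have hanti : AntitoneOn (fun s => ‖v s‖ ^ 2) (Icc 0 t) := by
    refine antitoneOn_of_hasDerivWithinAt_nonpos (f' := fun s => 2 * ((starRingEnd ℂ) (v s) *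
      (-1 * loewnerField (circlePoint (ξ (t - s))) (ballRetract ρ (v s)))).re) (convex_Icc 0 t)
      (hvc.norm.pow 2)
      (fun s hs => (hasDerivWithinAt_norm_sq (hv s (interior_subset hs))).mono
        interior_subset) fun s hs => ?_
    set e := circlePoint (ξ (t - s))
    set y := ballRetract ρ (v s) with hy
    have h2 : (starRingEnd ℂ) (v s) * (-1 * loewnerField e y) =
        ((-(ρ / max ρ ‖v s‖ * ‖v s‖ ^ 2) : ℝ) : ℂ) * ((e + y) / (e - y)) := by
      have h3 : (starRingEnd ℂ) (v s) * y = ((ρ / max ρ ‖v s‖ * ‖v s‖ ^ 2 : ℝ) : ℂ) := by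
        rw [hy, ballRetract, mul_left_comm, mul_comm ((starRingEnd ℂ) (v s)), Complex.mul_conj,
          Complex.normSq_eq_norm_sq]
        push_cast
        ring
      rw [loewnerField, Complex.ofReal_neg, ← h3]
      ring
    rw [h2, Complex.re_ofReal_mul, re_loewner_quotient (norm_circlePoint _)]
    have hyn : ‖y‖ ≤ ρ := norm_ballRetract_le hρ0 _
    have h4 : 0 ≤ (1 - ‖y‖ ^ 2) / ‖e - y‖ ^ 2 :=
      div_nonneg (by nlinarith [norm_nonneg y]) (by positivity)
    have h5 : 0 ≤ ρ / max ρ ‖v s‖ * ‖v s‖ ^ 2 := by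
      have : 0 < max ρ ‖v s‖ := hρ0.trans_le (le_max_left _ _)
      positivity
    nlinarith
  have hvn : ∀ s ∈ Icc 0 t, ‖v s‖ ≤ ‖w‖ := fun s hs => by
    have := hanti (left_mem_Icc.2 ht) hs hs.1
    simp only [hv0] at this
    exact le_of_sq_le_sq this (norm_nonneg _)
  have hmaps : MapsTo (fun s => t - s) (Icc 0 t) (Icc 0 t) := fun s hs =>
    ⟨by linarith [hs.2], by linarith [hs.1]⟩
  refine ⟨v t, (hvn t (right_mem_Icc.2 ht)).trans_lt hw, fun s => v (t - s),
    ⟨by simp, fun s hs => ⟨?_, ?_⟩⟩, by simp [hv0]⟩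
  · intro h
    have h1 := hvn (t - s) (hmaps hs)
    rw [show v (t - s) = circlePoint (ξ s) from h, norm_circlePoint] at h1
    linarith
  · have h1 := HasDerivWithinAt.scomp s (hv (t - s) (hmaps hs))
      ((hasDerivWithinAt_id s (Icc 0 t)).const_sub t) hmaps
    refine h1.congr_deriv ?_
    rw [ballRetract_of_le hρ0 ((hvn _ (hmaps hs)).trans (by rw [hρ]; linarith)),
      sub_sub_cancel, loewnerField]
    simp

end

/-! ### Loewner maps at small times -/

section

variable {ξ : ℝ → ℝ} {t d : ℝ} {z : ℂ} {u : ℝ → ℂ}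

/-- Trajectories started in `‖z‖ ≤ 1 - d` exist at least up to time `d ^ 2 / 8`. -/
theorem exists_trajectory (hξ : Continuous ξ) (hd : 0 < d) (hd1 : d < 1) (ht : 0 ≤ t)
    (htd : t ≤ d ^ 2 / 8) (hz : ‖z‖ ≤ 1 - d) : ∃ u : ℝ → ℂ, IsRadialTrajectory ξ t z u ∧
      ∀ s ∈ Icc 0 t, ‖u s‖ ≤ 1 - d / 2 := by
  set ρ := 1 - d / 2 with hρ
  have hρ0 : 0 < ρ := by linarith
  have hρ1 : ρ < 1 := by linarith
  obtain ⟨u, hu0, hu⟩ := exists_truncated_solution (continuous_circlePoint.comp hξ)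
    (fun s => norm_circlePoint _) hρ0 hρ1 ht z 1 (by simp)
  have hbd : ∀ s ∈ Icc 0 t, ‖u s‖ ≤ ρ := by
    intro s hs
    have h1 := norm_image_sub_le_of_norm_deriv_le_segment' (C := 2 / (1 - ρ)) hu (fun x _ => by
      rw [one_mul]
      exact norm_loewnerField_le (norm_circlePoint _) (norm_ballRetract_le hρ0 _) hρ1) s hs
    -- The truncated field has size at most `4 / d`, so the displacement up to time `d ^ 2 / 8` is
    -- at most `d / 2` and the retraction acts as the identity.
    have h2 : 2 / (1 - ρ) * (s - 0) ≤ d / 2 := by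
      have : 2 / (1 - ρ) = 4 / d := by
        rw [show 1 - ρ = d / 2 by rw [hρ]; ring, div_div_eq_mul_div]
        norm_num
      rw [this, sub_zero, div_mul_eq_mul_div, div_le_iff₀ hd]
      nlinarith [hs.2]
    rw [hu0] at h1
    have := norm_add_le (u s - z) z
    rw [sub_add_cancel] at this
    linarith
  refine ⟨u, ⟨hu0, fun s hs => ⟨?_, ?_⟩⟩, hbd⟩
  · intro h
    have h1 := hbd s hs
    rw [h, norm_circlePoint] at h1
    linarith
  · have := hu s hs
    rw [ballRetract_of_le hρ0 (hbd s hs), one_mul] at this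
    exact this

theorem IsRadialTrajectory.norm_sub_le (h : IsRadialTrajectory ξ t z u) (hd : 0 < d)
    (hu : ∀ s ∈ Icc 0 t, ‖u s‖ ≤ 1 - d / 2) {s s' : ℝ} (hs : s ∈ Icc 0 t) (hs' : s' ∈ Icc 0 t) :
    ‖u s - u s'‖ ≤ 4 / d * |s - s'| := by
  have := (convex_Icc 0 t).norm_image_sub_le_of_norm_hasDerivWithin_le (C := 2 / (1 - (1 - d / 2)))
    (fun x hx => (h.2 x hx).2)
    (fun x hx => norm_loewnerField_le (norm_circlePoint _) (hu x hx) (by linarith)) hs' hs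
  rw [Real.norm_eq_abs] at this
  rwa [sub_sub_cancel, div_div_eq_mul_div, show (2 : ℝ) * 2 = 4 by norm_num] at this

theorem gronwallBound_eq_mul (K ε x : ℝ) :
    gronwallBound 0 K ε x = ε * gronwallBound 0 K 1 x := by
  unfold gronwallBound
  split_ifs <;> ring

/-- A constant controlling the Loewner flow in the disc of radius `1 - d / 2`. -/
noncomputable def flowConst (d : ℝ) : ℝ :=
  2 / (d / 2) ^ 2 * gronwallBound 0 (2 / (d / 2) ^ 2 + 1) 1 (d ^ 2 / 8)

theorem flowConst_nonneg (hd : 0 < d) : 0 ≤ flowConst d := by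
  refine mul_nonneg (by positivity) ?_
  have h := gronwallBound_mono (δ := 0) (K := 2 / (d / 2) ^ 2 + 1) (ε := 1) le_rfl zero_le_one
    (by positivity) (show (0 : ℝ) ≤ d ^ 2 / 8 by positivity)
  rwa [gronwallBound_x0] at h

/-- Gronwall's inequality: `u'` solves the equation driven by `ξ` up to an error `2 / (d / 2) ^ 2 *
ε`. -/
theorem norm_trajectory_sub_le (hd : 0 < d) (ht : 0 ≤ t) (htd : t ≤ d ^ 2 / 8)
    {ξ' : ℝ → ℝ} {u' : ℝ → ℂ} (h : IsRadialTrajectory ξ t z u) (h' : IsRadialTrajectory ξ' t z u')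
    (hu : ∀ s ∈ Icc 0 t, ‖u s‖ ≤ 1 - d / 2) (hu' : ∀ s ∈ Icc 0 t, ‖u' s‖ ≤ 1 - d / 2) {ε : ℝ}
    (hε : ∀ s ∈ Icc 0 t, |ξ s - ξ' s| ≤ ε) : ‖u t - u' t‖ ≤ flowConst d * ε := by
  have hε0 : 0 ≤ ε := (abs_nonneg _).trans (hε 0 (left_mem_Icc.2 ht))
  have hρ : 1 - (1 - d / 2) = d / 2 := by ring
  have hρ1 : 1 - d / 2 < 1 := by linarith
  set K : NNReal := (2 / (d / 2) ^ 2 + 1).toNNReal with hK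
  have hKv : (K : ℝ) = 2 / (d / 2) ^ 2 + 1 := Real.coe_toNNReal _ (by positivity)
  have hright : ∀ {v : ℝ → ℂ} {v' : ℝ → ℂ}, (∀ s ∈ Icc 0 t, HasDerivWithinAt v (v' s) (Icc 0 t) s) →
      ∀ s ∈ Ico 0 t, HasDerivWithinAt v (v' s) (Ici s) s := fun hv s hs =>
    (hv s (Ico_subset_Icc_self hs)).mono_of_mem_nhdsWithin (Icc_mem_nhdsGE_of_mem hs)
  have key := dist_le_of_approx_trajectories_ODE_of_mem (K := K) (δ := 0) (εf := 0)
    (εg := 2 / (d / 2) ^ 2 * ε) (s := fun _ => closedBall (0 : ℂ) (1 - d / 2))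
    (v := fun s => loewnerField (circlePoint (ξ s))) (f := u) (g := u')
    (f' := fun s => loewnerField (circlePoint (ξ s)) (u s))
    (g' := fun s => loewnerField (circlePoint (ξ' s)) (u' s)) (a := 0) (b := t)
    (fun s _ => LipschitzOnWith.of_dist_le_mul fun x hx y hy => by
      rw [dist_eq_norm, dist_eq_norm, hKv]
      have := norm_loewnerField_sub_le (norm_circlePoint (ξ s)) (mem_closedBall_zero_iff.1 hx)
        (mem_closedBall_zero_iff.1 hy) hρ1
      rwa [hρ] at this)
    h.continuousOn (hright fun s hs => (h.2 s hs).2) (fun s _ => by simp)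
    (fun s hs => mem_closedBall_zero_iff.2 (hu s (Ico_subset_Icc_self hs)))
    h'.continuousOn (hright fun s hs => (h'.2 s hs).2)
    (fun s hs => by
      have hs' := Ico_subset_Icc_self hs
      rw [dist_eq_norm]
      have h1 := norm_loewnerField_sub_left_le (norm_circlePoint (ξ' s)) (norm_circlePoint (ξ s))
        (hu' s hs') hρ1
      rw [hρ] at h1
      refine h1.trans (mul_le_mul_of_nonneg_left ?_ (by positivity))
      refine (norm_circlePoint_sub_le _ _).trans ?_
      rw [abs_sub_comm]
      exact hε s hs')
    (fun s hs => mem_closedBall_zero_iff.2 (hu' s (Ico_subset_Icc_self hs)))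
    (by rw [h.1, h'.1, dist_self]) t (right_mem_Icc.2 ht)
  rw [dist_eq_norm, zero_add, sub_zero, gronwallBound_eq_mul, hKv] at key
  refine key.trans ?_
  have hmono := gronwallBound_mono (δ := 0) (K := 2 / (d / 2) ^ 2 + 1) (ε := 1) le_rfl zero_le_one
    (by positivity) htd
  unfold flowConst
  have h2 : 0 ≤ 2 / (d / 2) ^ 2 * ε := by positivity
  calc _ ≤ 2 / (d / 2) ^ 2 * ε * gronwallBound 0 (2 / (d / 2) ^ 2 + 1) 1 (d ^ 2 / 8) :=
        mul_le_mul_of_nonneg_left hmono h2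
    _ = _ := by ring

/-- The spatial derivative of the Loewner map. -/
theorem hasDerivAt_radialMap (hξ : Continuous ξ) (hd : 0 < d) (hd1 : d < 1) (ht : 0 ≤ t)
    (htd : t ≤ d ^ 2 / 8) (hz : ‖z‖ < 1 - d) :
    ∃ a : ℂ, HasDerivAt (radialMap ξ t) (Complex.exp a) z := by
  have hex : ∀ w : ℂ, ∃ u : ℝ → ℂ, ‖w‖ < 1 - d → IsRadialTrajectory ξ t w u ∧
      ∀ s ∈ Icc 0 t, ‖u s‖ ≤ 1 - d / 2 := fun w => by
    by_cases hw : ‖w‖ < 1 - d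
    · obtain ⟨u, hu⟩ := exists_trajectory hξ hd hd1 ht htd hw.le
      exact ⟨u, fun _ => hu⟩
    · exact ⟨0, fun h => (hw h).elim⟩
  choose U hU using hex
  have hball : ∀ᶠ w in 𝓝 z, ‖w‖ < 1 - d :=
    (isOpen_lt continuous_norm continuous_const).mem_nhds hz
  set e : ℝ → ℂ := fun s => circlePoint (ξ s) with he
  have hec : Continuous e := continuous_circlePoint.comp hξ
  have hρ1 : 1 - d / 2 < 1 := by linarith
  -- The difference quotient of the Loewner map is exactly the exponential of the integral of `q w`.
  -- Letting `w` tend to `z` by dominated convergence gives the derivative as an exponential, hence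
  -- nonzero.
  set q : ℂ → ℝ → ℂ := fun w s => 2 * e s ^ 2 / ((e s - U w s) * (e s - U z s)) - 1 with hq
  set M := 2 / (1 - (1 - d / 2)) ^ 2 + 1 with hM
  have hM0 : 0 ≤ M := by positivity
  have hqb : ∀ w, ‖w‖ < 1 - d → ∀ s ∈ Icc 0 t, ‖q w s‖ ≤ M := fun w hw s hs =>
    norm_loewner_coeff_le (norm_circlePoint _) ((hU w hw).2 s hs) ((hU z hz).2 s hs) hρ1
  have hne : ∀ w, ‖w‖ < 1 - d → ∀ s ∈ Icc 0 t, e s - U w s ≠ 0 := fun w hw s hs =>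
    sub_ne_zero_of_norm_lt (norm_circlePoint _) (((hU w hw).2 s hs).trans_lt hρ1)
  have hqc : ∀ w, ‖w‖ < 1 - d → ContinuousOn (q w) (Icc 0 t) := fun w hw =>
    ((continuousOn_const.mul (hec.continuousOn.pow 2)).div
      ((hec.continuousOn.sub (hU w hw).1.continuousOn).mul
        (hec.continuousOn.sub (hU z hz).1.continuousOn))
      fun s hs => mul_ne_zero (hne w hw s hs) (hne z hz s hs)).sub continuousOn_const
  have hsub : ∀ w, ‖w‖ < 1 - d → ∀ s ∈ Icc 0 t,
      U w s - U z s = (w - z) * Complex.exp (∫ x in (0 : ℝ)..s, q w x) := fun w hw s hs =>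
    (hU w hw).1.sub_eq hξ (hU z hz).1 s hs
  have hlip : ∀ w, ‖w‖ < 1 - d → ∀ s ∈ Icc 0 t,
      ‖U w s - U z s‖ ≤ ‖w - z‖ * Real.exp (M * t) := fun w hw s hs => by
    rw [hsub w hw s hs, norm_mul]
    refine mul_le_mul_of_nonneg_left ((Complex.norm_exp_le_exp_norm _).trans ?_) (norm_nonneg _)
    refine Real.exp_le_exp.2 ?_
    have h1 := intervalIntegral.norm_integral_le_of_norm_le_const (a := 0) (b := s) (f := q w)
      (C := M) fun x hx => by
        rw [uIoc_of_le hs.1] at hx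
        exact hqb w hw x ⟨hx.1.le, hx.2.trans hs.2⟩
    rw [sub_zero, abs_of_nonneg hs.1] at h1
    exact h1.trans (mul_le_mul_of_nonneg_left hs.2 hM0)
  have hlim : ∀ s ∈ Icc 0 t, Tendsto (fun w => U w s) (𝓝 z) (𝓝 (U z s)) := fun s hs => by
    rw [tendsto_iff_norm_sub_tendsto_zero]
    have h0 : Tendsto (fun w => ‖w - z‖ * Real.exp (M * t)) (𝓝 z) (𝓝 0) := by
      have : Continuous fun w : ℂ => ‖w - z‖ * Real.exp (M * t) := by fun_prop
      simpa using this.tendsto z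
    refine squeeze_zero' (Eventually.of_forall fun w => norm_nonneg _) ?_ h0
    filter_upwards [hball] with w hw using hlip w hw s hs
  have hint : Tendsto (fun w => ∫ x in (0 : ℝ)..t, q w x) (𝓝 z) (𝓝 (∫ x in (0 : ℝ)..t, q z x)) := by
    refine intervalIntegral.tendsto_integral_filter_of_dominated_convergence (fun _ => M) ?_ ?_
      intervalIntegrable_const ?_
    · filter_upwards [hball] with w hw
      rw [uIoc_of_le ht]
      exact ((hqc w hw).mono Ioc_subset_Icc_self).aestronglyMeasurable measurableSet_Ioc
    · filter_upwards [hball] with w hw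
      refine MeasureTheory.ae_of_all _ fun s hs => ?_
      rw [uIoc_of_le ht] at hs
      exact hqb w hw s (Ioc_subset_Icc_self hs)
    · refine MeasureTheory.ae_of_all _ fun s hs => ?_
      rw [uIoc_of_le ht] at hs
      have hs' := Ioc_subset_Icc_self hs
      refine Tendsto.sub (Tendsto.div tendsto_const_nhds ((tendsto_const_nhds.sub
        (hlim s hs')).mul tendsto_const_nhds) (mul_ne_zero (hne z hz s hs') (hne z hz s hs')))
        tendsto_const_nhds
  refine ⟨∫ x in (0 : ℝ)..t, q z x, ?_⟩
  rw [hasDerivAt_iff_tendsto_slope]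
  refine Tendsto.congr' ?_ (((Complex.continuous_exp.tendsto _).comp hint).mono_left
    nhdsWithin_le_nhds)
  filter_upwards [nhdsWithin_le_nhds hball, self_mem_nhdsWithin] with w hw hwz
  rw [slope_def_field, (hU w hw).1.radialMap_eq hξ ht, (hU z hz).1.radialMap_eq hξ ht,
    hsub w hw t (right_mem_Icc.2 ht), mul_div_cancel_left₀ _ (sub_ne_zero.2 hwz)]
  rfl

end

section

variable {Ω : Set ℂ} {p : ℂ} {r d : ℝ} {ξ : ℝ → ℝ} {t : ℝ}

theorem IsCollared.d_lt_one (hΩ : IsCollared Ω p r d) : d < 1 := by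
  have := hΩ.d_pos
  have := hΩ.r_pos
  have := hΩ.eq_one
  linarith

theorem IsCollared.r_add (hΩ : IsCollared Ω p r d) : r + 9 * d = 1 - d := by
  linarith [hΩ.eq_one]

theorem IsCollared.exists_trajectory (hΩ : IsCollared Ω p r d) (hξ : Continuous ξ) (ht : 0 ≤ t)
    (htd : t ≤ d ^ 2 / 8) {z : ℂ} (hz : z ∈ ball (0 : ℂ) (r + 9 * d)) :
    ∃ u : ℝ → ℂ, IsRadialTrajectory ξ t z u ∧ ∀ s ∈ Icc 0 t, ‖u s‖ ≤ 1 - d / 2 := by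
  rw [mem_ball_zero_iff, hΩ.r_add] at hz
  exact RadialLERW.exists_trajectory hξ hΩ.d_pos hΩ.d_lt_one ht htd hz.le

theorem IsCollared.norm_radialMap_sub_le (hΩ : IsCollared Ω p r d) (hξ : Continuous ξ)
    (ht : 0 ≤ t) (htd : t ≤ d ^ 2 / 8) {z : ℂ} (hz : z ∈ ball (0 : ℂ) (r + 9 * d)) :
    ‖radialMap ξ t z - z‖ ≤ 4 / d * t := by
  obtain ⟨u, hu, hub⟩ := hΩ.exists_trajectory hξ ht htd hz
  have h1 := hu.norm_sub_le hΩ.d_pos hub (right_mem_Icc.2 ht) (left_mem_Icc.2 ht)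
  rw [hu.1, sub_zero, abs_of_nonneg ht] at h1
  rwa [hu.radialMap_eq hξ ht]

/-- The Loewner maps depend on time and on the driving function in a Lipschitz way. -/
theorem IsCollared.norm_radialMap_sub_radialMap_le (hΩ : IsCollared Ω p r d) {ξ' : ℝ → ℝ}
    (hξ : Continuous ξ) (hξ' : Continuous ξ') {t' : ℝ} (ht : 0 ≤ t) (htt' : t ≤ t')
    (htd : t' ≤ d ^ 2 / 8) {ε : ℝ} (hε : ∀ s ∈ Icc 0 t, |ξ s - ξ' s| ≤ ε) {z : ℂ}
    (hz : z ∈ ball (0 : ℂ) (r + 9 * d)) :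
    ‖radialMap ξ t z - radialMap ξ' t' z‖ ≤ flowConst d * ε + 4 / d * (t' - t) := by
  obtain ⟨u, hu, hub⟩ := hΩ.exists_trajectory hξ ht (htt'.trans htd) hz
  obtain ⟨u', hu', hub'⟩ := hΩ.exists_trajectory hξ' (ht.trans htt') htd hz
  rw [hu.radialMap_eq hξ ht, hu'.radialMap_eq hξ' (ht.trans htt')]
  have h1 := norm_trajectory_sub_le hΩ.d_pos ht (htt'.trans htd) hu (hu'.mono htt') hub
    (fun s hs => hub' s ⟨hs.1, hs.2.trans htt'⟩) hε
  have h2 := hu'.norm_sub_le hΩ.d_pos hub' (s := t) (s' := t') ⟨ht, htt'⟩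
    (right_mem_Icc.2 (ht.trans htt'))
  rw [abs_sub_comm, abs_of_nonneg (sub_nonneg.2 htt')] at h2
  have h3 := norm_add_le (u t - u' t) (u' t - u' t')
  rw [sub_add_sub_cancel] at h3
  linarith

theorem IsCollared.radialHull_subset (hΩ : IsCollared Ω p r d) (hξ : Continuous ξ) (ht : 0 ≤ t)
    (htd : t ≤ d ^ 2 / 8) : radialHull ξ t ⊆ Ω \ {p} := by
  rintro z ⟨hz, hno⟩
  have hzb : z ∉ ball (0 : ℂ) (r + 9 * d) := fun h => hno (by
    obtain ⟨u, hu, -⟩ := hΩ.exists_trajectory hξ ht htd h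
    exact ⟨u, hu⟩)
  refine ⟨hΩ.annulus z ?_ (mem_ball_zero_iff.1 hz), ?_⟩
  · rw [mem_ball_zero_iff, not_lt] at hzb
    linarith [hΩ.d_pos]
  · rintro rfl
    exact hzb hΩ.mem_ball

/-- The Loewner map is a bijection from the surviving points onto the unit disc. The image domain is
therefore the disc minus the image of the holes, a compact set on which the map is close to the
identity. -/
theorem IsCollared.isNearIdentity_radialMap (hΩ : IsCollared Ω p r d) (ho : IsOpen Ω)
    (hb : Ω ⊆ ball 0 1) (hξ : Continuous ξ) (ht : 0 ≤ t) (htd : t ≤ d ^ 2 / 8) :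
    IsNearIdentity Ω r d (radialMap ξ t) (imageDomain Ω ξ t) := by
  have hd := hΩ.d_pos
  have hd1 := hΩ.d_lt_one
  have h10 := hΩ.eq_one
  have hr := hΩ.r_pos
  have hder : ∀ z ∈ ball (0 : ℂ) (r + 9 * d),
      ∃ a : ℂ, HasDerivAt (radialMap ξ t) (Complex.exp a) z := fun z hz => by
    rw [mem_ball_zero_iff, hΩ.r_add] at hz
    exact hasDerivAt_radialMap hξ hd hd1 ht htd hz
  have hlt : ∀ z ∈ ball (0 : ℂ) (r + 9 * d), ‖z‖ < 1 := fun z hz => by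
    rw [mem_ball_zero_iff] at hz
    linarith
  have hinj : ∀ z w : ℂ, (∃ u, IsRadialTrajectory ξ t z u) → (∃ v, IsRadialTrajectory ξ t w v) →
      radialMap ξ t z = radialMap ξ t w → z = w := by
    rintro z w ⟨u, hu⟩ ⟨v, hv⟩ h
    have h1 := hu.sub_eq hξ hv t (right_mem_Icc.2 ht)
    rw [← hu.radialMap_eq hξ ht, ← hv.radialMap_eq hξ ht, h, sub_self, eq_comm, mul_eq_zero] at h1
    exact sub_eq_zero.1 (h1.resolve_right (Complex.exp_ne_zero _))
  have hball : ∀ z ∈ ball (0 : ℂ) (r + 9 * d), ∃ u, IsRadialTrajectory ξ t z u := fun z hz => by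
    obtain ⟨u, hu, -⟩ := hΩ.exists_trajectory hξ ht htd hz
    exact ⟨u, hu⟩
  have hsmall : ∀ z ∈ ball (0 : ℂ) (r + 9 * d), ‖radialMap ξ t z - z‖ ≤ d := fun z hz => by
    refine (hΩ.norm_radialMap_sub_le hξ ht htd hz).trans ?_
    rw [div_mul_eq_mul_div, div_le_iff₀ hd]
    nlinarith
  have hle : ∀ z, ‖z‖ < 1 → (∃ u, IsRadialTrajectory ξ t z u) → ‖z‖ ≤ ‖radialMap ξ t z‖ := by
    rintro z hz ⟨u, hu⟩
    rw [hu.radialMap_eq hξ ht]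
    exact hu.le_norm hξ hz t (right_mem_Icc.2 ht)
  have hsurj : ∀ w : ℂ, ‖w‖ < 1 →
      ∃ z : ℂ, ‖z‖ < 1 ∧ (∃ u, IsRadialTrajectory ξ t z u) ∧ radialMap ξ t z = w := fun w hw => by
    obtain ⟨z, hz, u, hu, rfl⟩ := exists_trajectory_ending_at hξ ht hw
    exact ⟨z, hz, ⟨u, hu⟩, hu.radialMap_eq hξ ht⟩
  have himage : ∀ w : ℂ, w ∈ imageDomain Ω ξ t ↔
      ∃ z ∈ Ω, (∃ u, IsRadialTrajectory ξ t z u) ∧ radialMap ξ t z = w := by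
    intro w
    constructor
    · rintro ⟨z, ⟨hz, hzL⟩, rfl⟩
      refine ⟨z, hz, ?_, rfl⟩
      by_contra hno
      exact hzL ⟨hb hz, hno⟩
    · rintro ⟨z, hz, hu, rfl⟩
      exact ⟨z, ⟨hz, fun h => h.2 hu⟩, rfl⟩
  have hsub : imageDomain Ω ξ t ⊆ ball 0 1 := by
    intro w hw
    obtain ⟨z, hz, ⟨u, hu⟩, rfl⟩ := (himage w).1 hw
    rw [mem_ball_zero_iff, hu.radialMap_eq hξ ht]
    exact hu.norm_lt_one hξ (mem_ball_zero_iff.1 (hb hz)) t (right_mem_Icc.2 ht)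
  -- Injectivity gives one inclusion and surjectivity the other. The holes are compact, so this
  -- description yields openness of the image domain.
  have hcompl : imageDomain Ω ξ t =
      ball 0 1 \ (radialMap ξ t '' (closedBall 0 r \ Ω)) := by
    ext w
    constructor
    · intro hw
      refine ⟨hsub hw, ?_⟩
      rintro ⟨y, ⟨hy, hyΩ⟩, hyw⟩
      obtain ⟨z, hz, hzu, rfl⟩ := (himage w).1 hw
      have hyb : y ∈ ball (0 : ℂ) (r + 9 * d) := by
        rw [mem_closedBall_zero_iff] at hy
        rw [mem_ball_zero_iff]
        linarith
      exact hyΩ (hinj y z (hball y hyb) hzu hyw ▸ hz)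
    · rintro ⟨hw, hwn⟩
      obtain ⟨z, hz, hzu, rfl⟩ := hsurj w (mem_ball_zero_iff.1 hw)
      refine (himage _).2 ⟨z, ?_, hzu, rfl⟩
      by_contra hzΩ
      refine hwn ⟨z, ⟨?_, hzΩ⟩, rfl⟩
      rw [mem_closedBall_zero_iff]
      by_contra hzr
      exact hzΩ (hΩ.annulus z (not_le.1 hzr) hz)
  have hdiff : DifferentiableOn ℂ (radialMap ξ t) (ball 0 (r + 9 * d)) := fun z hz => by
    obtain ⟨a, ha⟩ := hder z hz
    exact ha.differentiableAt.differentiableWithinAt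
  have hopen : IsOpen (imageDomain Ω ξ t) := by
    rw [hcompl]
    refine isOpen_ball.sdiff (IsCompact.isClosed (IsCompact.image_of_continuousOn
      ((isCompact_closedBall 0 r).diff ho) (hdiff.continuousOn.mono ?_)))
    intro z hz
    have := mem_closedBall_zero_iff.1 hz.1
    rw [mem_ball_zero_iff]
    linarith
  refine ⟨hdiff, fun z hz w hw h => hinj z w (hball z hz) (hball w hw) h, fun z hz => ?_,
    fun z hz => hle z (hlt z hz) (hball z hz), hsmall, fun w hw => ?_, hopen, hsub,
    fun z hz => ?_, fun w hw1 hw2 => ?_⟩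
  · obtain ⟨a, ha⟩ := hder z hz
    rw [ha.deriv]
    exact Complex.exp_ne_zero a
  · obtain ⟨z, hz, hzu, rfl⟩ := hsurj w (by linarith)
    exact ⟨z, mem_ball_zero_iff.2 ((hle z hz hzu).trans_lt hw), rfl⟩
  · constructor
    · intro h
      obtain ⟨y, hy, hyu, hyz⟩ := (himage _).1 h
      exact hinj y z hyu (hball z hz) hyz ▸ hy
    · intro h
      exact (himage _).2 ⟨z, h, hball z hz, rfl⟩
  · rw [hcompl]
    refine ⟨mem_ball_zero_iff.2 hw2, ?_⟩
    rintro ⟨z, ⟨hz, -⟩, rfl⟩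
    rw [mem_closedBall_zero_iff] at hz
    have h1 := hsmall z (by rw [mem_ball_zero_iff]; linarith)
    have h2 := norm_add_le (radialMap ξ t z - z) z
    rw [sub_add_cancel] at h2
    linarith

end

/-! ### Locality in the driving function -/

section

variable {ξ ξ' : ℝ → ℝ} {t : ℝ}

theorem isRadialTrajectory_congr (h : EqOn ξ ξ' (Icc 0 t)) :
    IsRadialTrajectory ξ t = IsRadialTrajectory ξ' t := by
  funext z u
  refine propext (and_congr_right fun _ => forall₂_congr fun s hs => ?_)
  rw [h hs]

theorem radialHull_congr (h : EqOn ξ ξ' (Icc 0 t)) : radialHull ξ t = radialHull ξ' t := by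
  unfold radialHull
  rw [isRadialTrajectory_congr h]

theorem radialMap_congr (h : EqOn ξ ξ' (Icc 0 t)) : radialMap ξ t = radialMap ξ' t := by
  funext z
  unfold radialMap
  rw [isRadialTrajectory_congr h]

variable (Ω : Set ℂ) (p : ℂ)

theorem imageDomain_congr (h : EqOn ξ ξ' (Icc 0 t)) :
    imageDomain Ω ξ t = imageDomain Ω ξ' t := by
  unfold imageDomain
  rw [radialMap_congr h, radialHull_congr h]

theorem J_congr (h : EqOn ξ ξ' (Icc 0 t)) : J Ω p ξ t = J Ω p ξ' t := by
  unfold J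
  rw [radialMap_congr h, imageDomain_congr Ω h]

theorem tildeJ_congr (h : EqOn ξ ξ' (Icc 0 t)) : tildeJ Ω p ξ t = tildeJ Ω p ξ' t := by
  funext z
  unfold tildeJ
  rw [J_congr Ω p h]

theorem X_congr (ht : 0 ≤ t) (h : EqOn ξ ξ' (Icc 0 t)) : X Ω p ξ t = X Ω p ξ' t := by
  unfold X
  rw [tildeJ_congr Ω p h, h (right_mem_Icc.2 ht)]

theorem xIsDefined_congr (ht : 0 ≤ t) (h : EqOn ξ ξ' (Icc 0 t)) (hX : XIsDefined Ω p ξ' t) :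
    XIsDefined Ω p ξ t := by
  refine ⟨?_, ?_, ?_⟩
  · rw [imageDomain_congr Ω h, radialMap_congr h, J_congr Ω p h]
    exact hX.green
  · rw [tildeJ_congr Ω p h]
    exact hX.harmonic
  · rw [tildeJ_congr Ω p h, h (right_mem_Icc.2 ht)]
    exact hX.denom_ne_zero

end

/-- The flow lemmas ask for continuity on the whole line, while solutions are continuous on an
interval only. By the locality lemmas the extension changes nothing up to time `t`. -/
theorem exists_continuous_extension {ξ : ℝ → ℝ} {t : ℝ} (ht : 0 ≤ t)
    (hξ : ContinuousOn ξ (Icc 0 t)) : ∃ ξ' : ℝ → ℝ, Continuous ξ' ∧ EqOn ξ ξ' (Icc 0 t) :=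
  ⟨IccExtend ht ((Icc 0 t).domRestrict ξ), (continuousOn_iff_continuous_domRestrict.1 hξ).Icc_extend',
    fun s hs => by rw [IccExtend_of_mem ht _ hs]; rfl⟩

/-! ### Local Lipschitz bounds for the functional -/

/-- Up to time `T`, and for driving functions with values within `η` of `x₀` at the relevant times,
the functional `X` is well defined, bounded and Lipschitz with constant `K`. -/
def XIsLocallyLipschitz (Ω : Set ℂ) (p : ℂ) (x₀ η T K : ℝ) : Prop :=
  ∀ (ξ ξ' : ℝ → ℝ) (t t' ε : ℝ), 0 ≤ t → t ≤ t' → t' ≤ T → ContinuousOn ξ (Icc 0 t) →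
    ContinuousOn ξ' (Icc 0 t') → |ξ t - x₀| ≤ η → |ξ' t' - x₀| ≤ η →
    (∀ s ∈ Icc 0 t, |ξ s - ξ' s| ≤ ε) →
    radialHull ξ t ⊆ Ω \ {p} ∧ XIsDefined Ω p ξ t ∧ |X Ω p ξ t| ≤ K ∧
      |X Ω p ξ t - X Ω p ξ' t'| ≤ K * (ε + (t' - t) + |ξ t - ξ' t'|)

theorem IsCollared.exists_xIsLocallyLipschitz {Ω : Set ℂ} {p : ℂ} {r d : ℝ}
    (hΩ : IsCollared Ω p r d) (ho : IsOpen Ω) (hb : Ω ⊆ ball 0 1) (hc : IsPreconnected Ω) (x₀ : ℝ) :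
    ∃ η T K : ℝ, 0 < η ∧ 0 < T ∧ 0 ≤ K ∧ XIsLocallyLipschitz Ω p x₀ η T K := by
  obtain ⟨η, K, hη, hK, hlip⟩ := exists_normalQuotient_lipschitz hΩ ho hb hc x₀
  have hd := hΩ.d_pos
  have hF := flowConst_nonneg hd
  have h4 : 0 < 4 / d := by positivity
  have hC : 1 ≤ 1 + flowConst d + 4 / d := by linarith
  -- Up to `d ^ 2 / 8` the flow is controlled; up to `d / 4 * η` it moves points by at most `η`.
  refine ⟨η, min (d ^ 2 / 8) (d / 4 * η), K * (1 + flowConst d + 4 / d), hη,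
    lt_min (by positivity) (by positivity), by positivity, ?_⟩
  intro ξ ξ' t t' ε ht htt' hT hξ hξ' hx hx' hε
  obtain ⟨ζ, hζ, hξζ⟩ := exists_continuous_extension ht hξ
  obtain ⟨ζ', hζ', hξζ'⟩ := exists_continuous_extension (ht.trans htt') hξ'
  have ht' := ht.trans htt'
  have htd' := hT.trans (min_le_left _ _)
  have htd := htt'.trans htd'
  have heta : 4 / d * t' ≤ η := by
    have := hT.trans (min_le_right _ _)
    rw [div_mul_eq_mul_div, div_le_iff₀ hd]
    linarith
  have hε0 : 0 ≤ ε := (abs_nonneg _).trans (hε 0 (left_mem_Icc.2 ht))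
  have hmem := right_mem_Icc.2 ht
  have hmem' := right_mem_Icc.2 ht'
  have hn := hΩ.isNearIdentity_radialMap ho hb hζ ht htd
  have hn' := hΩ.isNearIdentity_radialMap ho hb hζ' ht' htd'
  have hg := isGreenFunction_greenFunction hn.isOpen hn.subset (hn.pole_mem hΩ)
  have hg' := isGreenFunction_greenFunction hn'.isOpen hn'.subset (hn'.pole_mem hΩ)
  obtain ⟨h1, h2, h3⟩ := hlip _ _ _ _ _ _ hn hn' hg hg'
    (fun z hz => (hΩ.norm_radialMap_sub_le hζ ht htd hz).trans
      ((mul_le_mul_of_nonneg_left htt' h4.le).trans heta))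
    (fun z hz => (hΩ.norm_radialMap_sub_le hζ' ht' htd' hz).trans heta)
    (flowConst d * ε + 4 / d * (t' - t))
    (fun z hz => hΩ.norm_radialMap_sub_radialMap_le hζ hζ' ht htt' htd' (fun s hs => by
      rw [← hξζ hs, ← hξζ' ⟨hs.1, hs.2.trans htt'⟩]
      exact hε s hs) hz) (ζ t) (ζ' t') (by rwa [← hξζ hmem]) (by rwa [← hξζ' hmem'])
  refine ⟨?_, xIsDefined_congr Ω p ht hξζ ⟨hg, fun x => ?_, h1⟩, ?_, ?_⟩
  · rw [radialHull_congr hξζ]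
    exact hΩ.radialHull_subset hζ ht htd
  -- `tildeJ` is by definition `stripLift` of `J`.
  · exact harmonicAt_stripLift hΩ hn hg (by simpa using hΩ.stripWidth_pos)
  · rw [X_congr Ω p ht hξζ]
    exact h2.trans (le_mul_of_one_le_right hK hC)
  · rw [X_congr Ω p ht hξζ, X_congr Ω p ht' hξζ', hξζ hmem, hξζ' hmem']
    refine h3.trans ?_
    rw [mul_assoc]
    refine mul_le_mul_of_nonneg_left ?_ hK
    have e1 : 0 ≤ t' - t := sub_nonneg.2 htt'
    have e2 := abs_nonneg (ζ t - ζ' t')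
    have e3 := mul_nonneg hF e1
    have e4 := mul_nonneg hF e2
    have e5 := mul_nonneg h4.le e2
    have e6 := mul_nonneg h4.le hε0
    nlinarith

theorem IsAlmostDiscDomain.exists_isCollared {Ω : Set ℂ} (hΩ : IsAlmostDiscDomain Ω) {p : ℂ}
    (hp : p ∈ Ω) : ∃ r d : ℝ, IsCollared Ω p r d := by
  obtain ⟨h, hh, hann⟩ := hΩ.annulus
  have h1 : Real.exp (-h) < 1 := by simpa using hh
  have h2 : ‖p‖ < 1 := mem_ball_zero_iff.1 (hΩ.subset_disc hp)
  have h3 : max (Real.exp (-h)) ‖p‖ < 1 := max_lt h1 h2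
  refine ⟨max (Real.exp (-h)) ‖p‖, (1 - max (Real.exp (-h)) ‖p‖) / 10, ?_⟩
  exact {
    r_pos := lt_max_of_lt_left (Real.exp_pos _)
    d_pos := by linarith
    eq_one := by ring
    mem := hp
    norm_le := le_max_right _ _
    annulus := fun z hz hz1 => hann ⟨(le_max_left _ _).trans_lt hz, hz1⟩ }

theorem IsAlmostDiscDomain.exists_xIsLocallyLipschitz {Ω : Set ℂ} (hΩ : IsAlmostDiscDomain Ω)
    {p : ℂ} (hp : p ∈ Ω) (x₀ : ℝ) :
    ∃ η T K : ℝ, 0 < η ∧ 0 < T ∧ 0 ≤ K ∧ XIsLocallyLipschitz Ω p x₀ η T K := by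
  obtain ⟨r, d, h⟩ := hΩ.exists_isCollared hp
  exact h.exists_xIsLocallyLipschitz hΩ.finitelyConnected.isOpen hΩ.subset_disc
    hΩ.finitelyConnected.isConnected.isPreconnected x₀

namespace XIsLocallyLipschitz

variable {Ω : Set ℂ} {p : ℂ} {x₀ η T K : ℝ} {ξ ξ' : ℝ → ℝ} {a t : ℝ}

theorem good (h : XIsLocallyLipschitz Ω p x₀ η T K) (hξ : ContinuousOn ξ (Icc 0 a)) (haT : a ≤ T)
    (hη : ∀ s ∈ Icc 0 a, |ξ s - x₀| ≤ η) (ht : t ∈ Icc 0 a) :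
    radialHull ξ t ⊆ Ω \ {p} ∧ XIsDefined Ω p ξ t ∧ |X Ω p ξ t| ≤ K := by
  have hc := hξ.mono (Icc_subset_Icc_right ht.2)
  obtain ⟨h1, h2, h3, -⟩ := h ξ ξ t t 0 ht.1 le_rfl (ht.2.trans haT) hc hc (hη t ht) (hη t ht)
    (by simp)
  exact ⟨h1, h2, h3⟩

theorem abs_sub_le (h : XIsLocallyLipschitz Ω p x₀ η T K) (hK : 0 ≤ K)
    (hξ : ContinuousOn ξ (Icc 0 a)) (hξ' : ContinuousOn ξ' (Icc 0 a)) (haT : a ≤ T)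
    (hη : ∀ s ∈ Icc 0 a, |ξ s - x₀| ≤ η) (hη' : ∀ s ∈ Icc 0 a, |ξ' s - x₀| ≤ η) {ε : ℝ}
    (hε : ∀ s ∈ Icc 0 a, |ξ s - ξ' s| ≤ ε) (ht : t ∈ Icc 0 a) :
    |X Ω p ξ t - X Ω p ξ' t| ≤ 2 * K * ε := by
  have hsub : Icc 0 t ⊆ Icc 0 a := Icc_subset_Icc_right ht.2
  obtain ⟨-, -, -, h4⟩ := h ξ ξ' t t ε ht.1 le_rfl (ht.2.trans haT) (hξ.mono hsub) (hξ'.mono hsub)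
    (hη t ht) (hη' t ht) fun s hs => hε s (hsub hs)
  refine h4.trans ?_
  have := mul_le_mul_of_nonneg_left (hε t ht) hK
  rw [sub_self]
  linarith

/-- The Lipschitz bound is applied to one driving function at two times, with `ε = 0`. This provides
the integrability in the fixed point argument. -/
theorem continuousOn (h : XIsLocallyLipschitz Ω p x₀ η T K)
    (hξ : ContinuousOn ξ (Icc 0 a)) (haT : a ≤ T) (hη : ∀ s ∈ Icc 0 a, |ξ s - x₀| ≤ η) :
    ContinuousOn (X Ω p ξ) (Icc 0 a) := by
  have key : ∀ t ∈ Icc 0 a, ∀ t' ∈ Icc 0 a, t ≤ t' →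
      |X Ω p ξ t - X Ω p ξ t'| ≤ K * (|t - t'| + |ξ t - ξ t'|) := fun t ht t' ht' htt' => by
    obtain ⟨-, -, -, h4⟩ := h ξ ξ t t' 0 ht.1 htt' (ht'.2.trans haT)
      (hξ.mono (Icc_subset_Icc_right ht.2)) (hξ.mono (Icc_subset_Icc_right ht'.2)) (hη t ht)
      (hη t' ht') (by simp)
    rwa [zero_add, ← abs_of_nonneg (sub_nonneg.2 htt'), abs_sub_comm t' t] at h4
  have key' : ∀ t ∈ Icc 0 a, ∀ t' ∈ Icc 0 a,
      |X Ω p ξ t - X Ω p ξ t'| ≤ K * (|t - t'| + |ξ t - ξ t'|) := fun t ht t' ht' => by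
    rcases le_total t t' with hle | hle
    · exact key t ht t' ht' hle
    · rw [abs_sub_comm (X Ω p ξ t), abs_sub_comm t, abs_sub_comm (ξ t)]
      exact key t' ht' t ht hle
  intro t ht
  have h0 : Tendsto (fun s => K * (|s - t| + |ξ s - ξ t|)) (𝓝[Icc 0 a] t) (𝓝 0) := by
    have hc : ContinuousWithinAt (fun s => K * (|s - t| + |ξ s - ξ t|)) (Icc 0 a) t :=
      continuousWithinAt_const.mul ((continuousWithinAt_id.sub continuousWithinAt_const).abs.add
        ((hξ t ht).sub continuousWithinAt_const).abs)
    simpa [ContinuousWithinAt] using hc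
  rw [ContinuousWithinAt, tendsto_iff_dist_tendsto_zero]
  refine squeeze_zero' (Eventually.of_forall fun s => dist_nonneg) ?_ h0
  filter_upwards [self_mem_nhdsWithin] with s hs using key' s hs t ht

end XIsLocallyLipschitz

/-! ### The integral equation -/

section

variable {Ω : Set ℂ} {p : ℂ} {f : ℝ → ℝ} {x₀ η T K a lam : ℝ}

theorem intervalIntegrable_of_continuousOn {g : ℝ → ℝ} (hg : ContinuousOn g (Icc 0 a)) {t : ℝ}
    (ht : t ∈ Icc 0 a) : IntervalIntegrable g MeasureTheory.volume 0 t :=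
  (hg.mono (by rw [uIcc_of_le ht.1]; exact Icc_subset_Icc_right ht.2)).intervalIntegrable

/-- Picard iteration in the ball of radius `η` about the constant `x₀`: `hfη` and `ha1` keep the
ball invariant, and `ha2` gives contraction by one half. -/
theorem XIsLocallyLipschitz.exists_isSolutionOn (h : XIsLocallyLipschitz Ω p x₀ η T K)
    (hη : 0 < η) (hK : 0 ≤ K) (ha : 0 < a) (haT : a ≤ T) (hf : ContinuousOn f (Icc 0 a))
    (hfη : ∀ t ∈ Icc 0 a, |f t - x₀| ≤ η / 2) (ha1 : |lam| * K * a ≤ η / 2)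
    (ha2 : |lam| * (2 * K) * a ≤ 1 / 2) :
    ∃ ξ : ℝ → ℝ, IsSolutionOn Ω p f lam ξ (Icc 0 a) ∧ ∀ t ∈ Icc 0 a, XIsDefined Ω p ξ t := by
  set B : Set C(Icc 0 a, ℝ) := closedBall (ContinuousMap.const _ x₀) η with hB
  let E : C(Icc 0 a, ℝ) → ℝ → ℝ := fun ζ => IccExtend ha.le ζ
  have hE : ∀ ζ, ContinuousOn (E ζ) (Icc 0 a) := fun ζ => (ζ.continuous.Icc_extend').continuousOn
  have hEv : ∀ ζ (t : ℝ) (ht : t ∈ Icc 0 a), E ζ t = ζ ⟨t, ht⟩ := fun ζ t ht =>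
    IccExtend_of_mem ha.le _ ht
  have hEη : ∀ ζ ∈ B, ∀ s ∈ Icc 0 a, |E ζ s - x₀| ≤ η := fun ζ hζ s hs => by
    rw [hEv ζ s hs]
    exact (ContinuousMap.dist_le hη.le).1 hζ ⟨s, hs⟩
  have hXc : ∀ ζ ∈ B, ContinuousOn (X Ω p (E ζ)) (Icc 0 a) := fun ζ hζ =>
    h.continuousOn (hE ζ) haT (hEη ζ hζ)
  -- The Picard map is obtained as a choice of values in `B`, so the invariance of the ball is built
  -- into it.
  have hex : ∀ ζ : B, ∃ ζ' : B, ∀ t (ht : t ∈ Icc 0 a),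
      (ζ' : C(Icc 0 a, ℝ)) ⟨t, ht⟩ = f t + lam * ∫ s in (0 : ℝ)..t, X Ω p (E ζ) s := by
    rintro ⟨ζ, hζ⟩
    have hprim : ContinuousOn (fun t => f t + lam * ∫ s in (0 : ℝ)..t, X Ω p (E ζ) s) (Icc 0 a) :=
      hf.add (continuousOn_const.mul (by
        have := intervalIntegral.continuousOn_primitive_interval (μ := MeasureTheory.volume)
          (a := 0) (b := a) (f := X Ω p (E ζ)) (by
            rw [uIcc_of_le ha.le]
            exact (hXc ζ hζ).integrableOn_Icc)
        rwa [uIcc_of_le ha.le] at this))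
    refine ⟨⟨⟨_, continuousOn_iff_continuous_domRestrict.1 hprim⟩, ?_⟩, fun t ht => rfl⟩
    refine (ContinuousMap.dist_le hη.le).2 fun t => ?_
    have h1 := hfη t t.2
    have h2 := intervalIntegral.norm_integral_le_of_norm_le_const (a := 0) (b := (t : ℝ))
      (f := X Ω p (E ζ)) (C := K) fun s hs => by
        rw [uIoc_of_le t.2.1] at hs
        exact (h.good (hE ζ) haT (hEη ζ hζ) ⟨hs.1.le, hs.2.trans t.2.2⟩).2.2
    rw [sub_zero, abs_of_nonneg t.2.1, Real.norm_eq_abs] at h2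
    have h3 : |lam * ∫ s in (0 : ℝ)..t, X Ω p (E ζ) s| ≤ η / 2 := by
      rw [abs_mul]
      refine (mul_le_mul_of_nonneg_left (h2.trans (mul_le_mul_of_nonneg_left t.2.2 hK))
        (abs_nonneg _)).trans ?_
      rwa [← mul_assoc]
    have h4 := abs_add_le (f t - x₀) (lam * ∫ s in (0 : ℝ)..t, X Ω p (E ζ) s)
    rw [sub_add_eq_add_sub] at h4
    exact h4.trans (by linarith)
  choose Φ hΦ using hex
  have hcontr : ContractingWith (1 / 2) Φ := by
    refine ⟨by rw [← NNReal.coe_lt_coe]; norm_num, LipschitzWith.of_dist_le_mul fun ζ ζ' => ?_⟩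
    have hD : (0 : ℝ) ≤ dist ζ ζ' := dist_nonneg
    refine (ContinuousMap.dist_le (by positivity)).2 fun t => ?_
    obtain ⟨t, ht⟩ := t
    rw [hΦ, hΦ, Real.dist_eq, add_sub_add_left_eq_sub, ← mul_sub,
      ← intervalIntegral.integral_sub (intervalIntegrable_of_continuousOn (hXc ζ ζ.2) ht)
        (intervalIntegrable_of_continuousOn (hXc ζ' ζ'.2) ht), abs_mul]
    have h2 := intervalIntegral.norm_integral_le_of_norm_le_const (a := 0) (b := t)
      (f := fun s => X Ω p (E ζ) s - X Ω p (E ζ') s) (C := 2 * K * dist ζ ζ') fun s hs => by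
        rw [uIoc_of_le ht.1] at hs
        refine h.abs_sub_le hK (hE ζ) (hE ζ') haT (hEη ζ ζ.2) (hEη ζ' ζ'.2) (fun x hx => ?_)
          ⟨hs.1.le, hs.2.trans ht.2⟩
        rw [hEv _ x hx, hEv _ x hx]
        exact ContinuousMap.dist_apply_le_dist (f := (ζ : C(Icc 0 a, ℝ))) ⟨x, hx⟩
    rw [sub_zero, abs_of_nonneg ht.1, Real.norm_eq_abs] at h2
    refine (mul_le_mul_of_nonneg_left (h2.trans (mul_le_mul_of_nonneg_left ht.2 (by positivity)))
      (abs_nonneg _)).trans ?_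
    have := mul_le_mul_of_nonneg_right ha2 hD
    push_cast
    linarith
  have : Nonempty B := ⟨⟨_, mem_closedBall_self hη.le⟩⟩
  have : CompleteSpace B := isClosed_closedBall.completeSpace_coe
  set ζ := hcontr.fixedPoint Φ with hζ
  have hfix : Φ ζ = ζ := hcontr.fixedPoint_isFixedPt
  have hgood := fun t (ht : t ∈ Icc 0 a) => h.good (hE ζ) haT (hEη ζ ζ.2) ht
  refine ⟨E ζ, ⟨hE ζ, fun t ht => (hgood t ht).1,
    fun t ht => intervalIntegrable_of_continuousOn (hXc ζ ζ.2) ht, fun t ht => ?_⟩,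
    fun t ht => (hgood t ht).2.1⟩
  rw [hEv _ t ht, ← hΦ ζ t ht, hfix]

theorem IsSolutionOn.mono {ξ : ℝ → ℝ} {S S' : Set ℝ} (h : IsSolutionOn Ω p f lam ξ S)
    (hS : S' ⊆ S) : IsSolutionOn Ω p f lam ξ S' :=
  ⟨h.continuousOn.mono hS, fun t ht => h.hull_subset t (hS ht),
    fun t ht => h.integrable t (hS ht), fun t ht => h.equation t (hS ht)⟩

/-- At a point where `|ξ - ξ'|` is maximal, the equation bounds this maximum by half of itself. -/
theorem XIsLocallyLipschitz.eqOn_of_isSolutionOn (h : XIsLocallyLipschitz Ω p x₀ η T K)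
    (hK : 0 ≤ K) (ha : 0 < a) (haT : a ≤ T) (ha2 : |lam| * (2 * K) * a ≤ 1 / 2) {ξ ξ' : ℝ → ℝ}
    (hξ : IsSolutionOn Ω p f lam ξ (Icc 0 a)) (hξ' : IsSolutionOn Ω p f lam ξ' (Icc 0 a))
    (hη : ∀ s ∈ Icc 0 a, |ξ s - x₀| ≤ η) (hη' : ∀ s ∈ Icc 0 a, |ξ' s - x₀| ≤ η) :
    EqOn ξ ξ' (Icc 0 a) := by
  obtain ⟨t, ht, hmax⟩ := isCompact_Icc.exists_isMaxOn (nonempty_Icc.2 ha.le)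
    (hξ.continuousOn.sub hξ'.continuousOn).abs
  have hM : ∀ s ∈ Icc 0 a, |ξ s - ξ' s| ≤ |ξ t - ξ' t| := fun s hs => hmax hs
  set M := |ξ t - ξ' t| with hMdef
  have hM0 : 0 ≤ M := abs_nonneg _
  have h2 := intervalIntegral.norm_integral_le_of_norm_le_const (a := 0) (b := t)
    (f := fun s => X Ω p ξ s - X Ω p ξ' s) (C := 2 * K * M) fun s hs => by
      rw [uIoc_of_le ht.1] at hs
      exact h.abs_sub_le hK hξ.continuousOn hξ'.continuousOn haT hη hη' hM
        ⟨hs.1.le, hs.2.trans ht.2⟩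
  rw [sub_zero, abs_of_nonneg ht.1, Real.norm_eq_abs] at h2
  have h3 : M ≤ |lam| * (2 * K * M * a) := by
    have e : M = |lam| * |∫ s in (0 : ℝ)..t, (X Ω p ξ s - X Ω p ξ' s)| := by
      rw [hMdef, hξ.equation t ht, hξ'.equation t ht, add_sub_add_left_eq_sub, ← mul_sub,
        ← intervalIntegral.integral_sub (hξ.integrable t ht) (hξ'.integrable t ht), abs_mul]
    exact e.le.trans <| mul_le_mul_of_nonneg_left (h2.trans (mul_le_mul_of_nonneg_left ht.2 (by positivity)))
      (abs_nonneg _)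
  have h4 := mul_le_mul_of_nonneg_right ha2 hM0
  intro s hs
  have h5 := hM s hs
  have h6 : |ξ s - ξ' s| ≤ 0 := by linarith
  exact sub_eq_zero.1 (abs_nonpos_iff.1 h6)

theorem exists_small_time {S : Set ℝ} {g : ℝ → ℝ} (hg : ContinuousWithinAt g S 0) {ε : ℝ}
    (hε : 0 < ε) : ∃ δ > 0, ∀ t ∈ S, 0 ≤ t → t ≤ δ → |g t - g 0| ≤ ε := by
  obtain ⟨δ, hδ, h⟩ := Metric.continuousWithinAt_iff.1 hg ε hε
  refine ⟨δ / 2, half_pos hδ, fun t ht h0 hle => (h ht ?_).le⟩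
  rw [Real.dist_eq, sub_zero, abs_of_nonneg h0]
  linarith

end

end RadialLERW

/-! ### Choice of the time intervals -/

theorem theorem3p1 (Ω : Set ℂ) (hΩ : RadialLERW.IsAlmostDiscDomain Ω) (p : ℂ) (hp : p ∈ Ω)
    (f : ℝ → ℝ) (hf : ContinuousOn f (Set.Ici 0)) (lam : ℝ) :
    (∃ a : ℝ, 0 < a ∧ ∃ ξ : ℝ → ℝ,
      RadialLERW.IsSolutionOn Ω p f lam ξ (Set.Icc 0 a) ∧
      ∀ t ∈ Set.Icc 0 a, RadialLERW.XIsDefined Ω p ξ t) ∧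
    (∀ (T₁ T₂ : EReal) (ξ₁ ξ₂ : ℝ → ℝ), 0 < T₁ → 0 < T₂ →
      RadialLERW.IsSolutionOn Ω p f lam ξ₁ {t : ℝ | 0 ≤ t ∧ (t : EReal) < T₁} →
      RadialLERW.IsSolutionOn Ω p f lam ξ₂ {t : ℝ | 0 ≤ t ∧ (t : EReal) < T₂} →
      ∃ S : ℝ, 0 < S ∧ (S : EReal) < T₁ ∧ (S : EReal) < T₂ ∧
        ∀ t ∈ Set.Icc 0 S, ξ₁ t = ξ₂ t) := by
  obtain ⟨η, T, K, hη, hT, hK, h⟩ := hΩ.exists_xIsLocallyLipschitz hp (f 0)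
  obtain ⟨c, hc, hcT, hc1, hc2⟩ : ∃ c > 0, c ≤ T ∧ |lam| * K * c ≤ η / 2 ∧
      |lam| * (2 * K) * c ≤ 1 / 2 := by
    set A := |lam| * K + 1 with hA
    have hA0 : 0 ≤ |lam| * K := by positivity
    have hA1 : 0 < A := by linarith
    -- The summand `1` in `A` avoids division by zero; the last two entries give `|lam| * K * c` at
    -- most `η / 2` and at most `1 / 4`.
    refine ⟨min T (min (η / 2 / A) (1 / 4 / A)), by positivity, min_le_left _ _, ?_, ?_⟩
    · have h1 : min T (min (η / 2 / A) (1 / 4 / A)) ≤ η / 2 / A :=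
        (min_le_right _ _).trans (min_le_left _ _)
      refine (mul_le_mul_of_nonneg_left h1 hA0).trans ?_
      rw [← mul_div_assoc, div_le_iff₀ hA1]
      nlinarith
    · have h1 : min T (min (η / 2 / A) (1 / 4 / A)) ≤ 1 / 4 / A :=
        (min_le_right _ _).trans (min_le_right _ _)
      refine (mul_le_mul_of_nonneg_left h1 (by positivity)).trans ?_
      rw [← mul_div_assoc, div_le_iff₀ hA1]
      nlinarith
  constructor
  · obtain ⟨δ, hδ, hfδ⟩ := RadialLERW.exists_small_time (hf 0 Set.self_mem_Ici) (half_pos hη)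
    have hac := min_le_left c δ
    have hlam : 0 ≤ |lam| * K := by positivity
    refine ⟨min c δ, lt_min hc hδ, h.exists_isSolutionOn hη hK (lt_min hc hδ) (hac.trans hcT)
      (hf.mono Set.Icc_subset_Ici_self)
      (fun t ht => hfδ t ht.1 ht.1 (ht.2.trans (min_le_right _ _))) ?_ ?_⟩
    · exact (mul_le_mul_of_nonneg_left hac hlam).trans hc1
    · exact (mul_le_mul_of_nonneg_left hac (by positivity)).trans hc2
  · intro T₁ T₂ ξ₁ ξ₂ hT₁ hT₂ h₁ h₂
    -- The equation gives `ξ 0 = f 0`, so by continuity any solution starts inside the window where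
    -- the Lipschitz bound applies.
    have key : ∀ (T' : EReal) (ξ : ℝ → ℝ), 0 < T' →
        RadialLERW.IsSolutionOn Ω p f lam ξ {t : ℝ | 0 ≤ t ∧ (t : EReal) < T'} →
        ∃ δ > 0, ∀ t : ℝ, 0 ≤ t → (t : EReal) < T' → t ≤ δ → |ξ t - f 0| ≤ η := by
      intro T' ξ hT' hξ
      have h0 : (0 : ℝ) ∈ {t : ℝ | 0 ≤ t ∧ (t : EReal) < T'} := ⟨le_rfl, by simpa using hT'⟩
      obtain ⟨δ, hδ, hb⟩ := RadialLERW.exists_small_time (hξ.continuousOn 0 h0) hη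
      have h1 : ξ 0 = f 0 := by simpa using hξ.equation 0 h0
      exact ⟨δ, hδ, fun t ht htT htδ => h1 ▸ hb t ⟨ht, htT⟩ ht htδ⟩
    obtain ⟨δ₁, hδ₁, hb₁⟩ := key T₁ ξ₁ hT₁ h₁
    obtain ⟨δ₂, hδ₂, hb₂⟩ := key T₂ ξ₂ hT₂ h₂
    have hm : 0 < min c (min δ₁ δ₂) := lt_min hc (lt_min hδ₁ hδ₂)
    -- The lifetimes may be infinite, so a real `S` below all the constraints is picked in `EReal`.
    obtain ⟨S, hS0, hS⟩ := EReal.lt_iff_exists_real_btwn.1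
      (show (0 : EReal) < min (min T₁ T₂) ((min c (min δ₁ δ₂) : ℝ) : EReal) from
        lt_min (lt_min hT₁ hT₂) (by exact_mod_cast hm))
    have hS0' : 0 < S := by exact_mod_cast hS0
    obtain ⟨hST, hSm⟩ := lt_min_iff.1 hS
    obtain ⟨hS1, hS2⟩ := lt_min_iff.1 hST
    have hSm' : S < min c (min δ₁ δ₂) := by exact_mod_cast hSm
    obtain ⟨hSc, hSδ⟩ := lt_min_iff.1 hSm'
    obtain ⟨hSδ₁, hSδ₂⟩ := lt_min_iff.1 hSδ
    have hlt : ∀ t ∈ Set.Icc 0 S, ∀ T' : EReal, (S : EReal) < T' → (t : EReal) < T' :=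
      fun t ht T' hT' => lt_of_le_of_lt (EReal.coe_le_coe_iff.2 ht.2) hT'
    refine ⟨S, hS0', hS1, hS2, ?_⟩
    exact h.eqOn_of_isSolutionOn hK hS0' (hSc.le.trans hcT)
      ((mul_le_mul_of_nonneg_left hSc.le (by positivity)).trans hc2)
      (h₁.mono fun t ht => ⟨ht.1, hlt t ht T₁ hS1⟩) (h₂.mono fun t ht => ⟨ht.1, hlt t ht T₂ hS2⟩)
      (fun t ht => hb₁ t ht.1 (hlt t ht T₁ hS1) (ht.2.trans hSδ₁.le))
      (fun t ht => hb₂ t ht.1 (hlt t ht T₂ hS2) (ht.2.trans hSδ₂.le))
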